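/- Let $\mathbb K=\mathbb C$, $\Lambda=\mathbb Z\sigma_1\oplus\mathbb Z\sigma_2$, $\tau_0=0$, $\tau_1=\sigma_1$, $\tau_2=\sigma_2$, $\tau_3=\sigma_1+\sigma_2$ and $S_i=\tau_i+2\Lambda$. Let $\mathcal J=\bigoplus_{\lambda\in\Lambda}\mathcal J^\lambda$ be one of the following rank $2$ Jordan tori. * $\mathcal J_S$, where $S=S_0\cup S_1\cup S_2$ or $S=\Lambda$ (up to similarity, all semilattices of rank $2$): it has the basis $\{x^\lambda\}_{\lambda\in S}$, with $x^\lambda x^\mu=x^{\lambda+\mu}$ if $\lambda,\mu\in S_0\cup S_i$ for some $i$, and $x^\lambda x^\mu=0$ otherwise. * $\mathbb K_{\mathbf e}^+$, where $\mathbf e$ is an elementary $2\times2$ quantum matrix, with off-diagonal entries $e\in\{1,-1\}$: the quantum torus $\mathbb K_{\mathbf e}$ has the basis $x^\lambda=x_1^{l_1}x_2^{l_2}$ ($\lambda=l_1\sigma_1+l_2\sigma_2$), with $x_2x_1=e\,x_1x_2$, so that $x^\lambda x^\mu=\eta(\lambda,\mu)x^{\lambda+\mu}$ with $\eta(\lambda,\mu)=e^{l_2m_1}$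 for $\mu=m_1\sigma_1+m_2\sigma_2$, and $\mathbb K_{\mathbf e}^+$ has the product $a\cdot b=\frac12(ab+ba)$. * $H(\mathbb K_{\mathbf e},-)$: the subalgebra of $\mathbb K_{\mathbf e}^+$ of the elements fixed by the involution (anti-automorphism of order at most $2$) with $x_i\mapsto x_i$ for $i=1,2$. We set $x^\lambda=0$ if $\mathcal J^\lambda=0$. Let $L_a(b)=ab$, and let $\mathrm{Instrl}(\mathcal J)=L_{\mathcal J}+[L_{\mathcal J},L_{\mathcal J}]$. Let $\mathfrak g=\mathrm{TKK}(\mathcal J)=\mathcal J\oplus\mathrm{Instrl}(\mathcal J)\oplus\bar{\mathcal J}$, with its $\Lambda$-grading and the bracket $$[a+U+\bar b,\;a'+U'+\bar b']=(Ua'-U'a)+(a\triangle b'-a'\triangle b+[U,U'])+\overline{(\bar Ub'-\bar U'b)},$$ where $a\triangle b=L_{ab}+[L_a,L_b]$ and $\overline{L_a+D}=-L_a+D$ for $D\in[L_{\mathcal J},L_{\mathcal J}]$. Let $\epsilon$ be the linear form on $\mathcal J$ with $\epsilon(1)=1$ and $\epsilon(\mathcal J^\lambda)=0$ for $\lambda\ne0$.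 The form of $\mathfrak g$ is the invariant symmetric bilinear form in which $\mathcal J\oplus\bar{\mathcal J}$ and $\mathrm{Instrl}(\mathcal J)$ are orthogonal, $(a,b)=(\bar a,\bar b)=0$, $(a,\bar b)=\epsilon(ab)$, and, on $\mathrm{Instrl}(\mathcal J)$, $(L_a+D,L_b+[L_c,L_d])=\epsilon(ab)+\epsilon(D(c)d)$ for $D\in[L_{\mathcal J},L_{\mathcal J}]$. For $\theta\in\mathrm{Hom}(\Lambda,\mathbb K)$ let $\partial_\theta$ be the degree derivation that multiplies $\mathfrak g^\lambda$ by $\theta(\lambda)$. Let $\theta_i(\sigma_j)=\delta_{ij}$, and let $\theta_\lambda=k_2\theta_1-k_1\theta_2$ for $\lambda=k_1\sigma_1+k_2\sigma_2$. The centroid of $\mathfrak g$ has the basis $\{\chi^\gamma\}_{\gamma\in\Gamma}$ for a subgroup $\Gamma\le\Lambda$, where $\chi^\gamma$ is homogeneous of degree $\gamma$ and normalized by $\chi^\gamma(x^\lambda)=x^{\gamma+\lambda}$. Let $D=\mathrm{SCDer}(\mathfrak g)$ be the Lie algebra of the skew centroidal derivations: the elements $d$ of the span of all $\chi^\gamma\partial_\theta$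 such that $(d(u),u)=0$ for all $u\in\mathfrak g$. Let $E=E(\mathfrak g,D,0)=\mathfrak g\oplus D^{gr*}\oplus D$ be the elliptic extended affine Lie algebra with the bracket $$[u+c+d,\;u'+c'+d']=([u,u']_{\mathfrak g}+d(u')-d'(u))+(c_D(u,u')+d.c'-d'.c)+[d,d'],$$ where $D^{gr*}=\bigoplus_\mu (D^\mu)^*$ is the graded dual, $c_D(u,u')(d'')=(d''(u),u')$ and $(d.c)(d'')=c([d'',d])$. Let $c^\lambda\in(D^{-\lambda})^*$, $0\ne\lambda\in\Gamma$, be the element with $c^\lambda(\chi^{-\lambda}\partial_{\theta_{-\lambda}})=1$, let $c^i\in(D^0)^*$, $i=1,2$, be the elements with $c^i(\partial_{\theta_j})=\delta_{ij}$, and let $h_\alpha=2L_1=[\sqrt2x^0,\sqrt2\bar{x^0}]_{\mathfrak g}$. If $\mathcal J$ is $\mathbb K_{\mathbf e}^+$ or $H(\mathbb K_{\mathbf e},-)$, let $r_\lambda$ be the operator on $\mathcal J$ with $r_\lambda(x^\gamma)=\eta(\lambda,\gamma)x^{\lambda+\gamma}$ whenever $\mathcal J^\gamma\neq 0$, and let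 $\mathrm{rad}(f)=\{\lambda\mid\eta(\lambda,\mu)=\eta(\mu,\lambda)\ \text{for all}\ \mu\in\Lambda\}$. Let $\mathcal B\subseteq E$ consist of 1. $\sqrt2\,x^\lambda$ and $\sqrt2\,\bar{x^\lambda}$ for all $\lambda$ with $\mathcal J^\lambda\neq0$; 2. $\chi^\lambda\partial_{\theta_\lambda}$ and $c^\lambda$ for $0\neq\lambda\in\Gamma$; 3. $h_\alpha,\ \partial_{\theta_1},\ \partial_{\theta_2},\ c^1,\ c^2$; 4. the following elements of $\mathrm{Instrl}(\mathcal J)$: * if $\mathcal J=\mathcal J_S$ with $S=S_0\cup S_1\cup S_2$: $L_{x^\lambda}$ for $0\ne\lambda\in S_0\cup S_1\cup S_2$, and $[L_{x^{\lambda+\sigma_2}},L_{x^{-\sigma_2}}]$ for $\lambda\in S_3$; * if $\mathcal J=\mathcal J_\Lambda$: $L_{x^\lambda}$ for all $\lambda\neq0$, $[L_{x^{\lambda+\sigma_2}},L_{x^{-\sigma_2}}]$ for $\lambda\in S_1\cup S_3$, and $[L_{x^{\lambda+\sigma_1}},L_{x^{-\sigma_1}}]$ for $\lambda\in S_2$;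 * if $\mathcal J=\mathbb K_{\mathbf e}^+$: $L_{x^\lambda}$ for all $\lambda\ne0$, and $L_{x^\lambda}-r_\lambda$ for $\lambda\notin\mathrm{rad}(f)$; * if $\mathcal J=H(\mathbb K_{\mathbf e},-)$: $L_{x^\lambda}$ for $0\neq\lambda\notin S_3$, and $r_\lambda$ for $\lambda\in S_3$. Then $\mathcal B$ is a Chevalley basis of $E$: it is a $\mathbb K$-basis of $E$, and $[\mathcal B,\mathcal B]\subseteq\mathbb Z\mathcal B$. -/

import Mathlib

set_option linter.unusedSectionVars false

namespace Elliptic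

section TKKDefs

variable {J : Type} [NonAssocCommRing J] [Module ℂ J] [IsScalarTower ℂ J J] [SMulCommClass ℂ J J]

/-- The left multiplication operator `L_a` of a Jordan algebra. -/
def L (a : J) : Module.End ℂ J := LinearMap.mulLeft ℂ a

@[simp] theorem L_apply (a b : J) : L a b = a * b := rfl

theorem L_add (a b : J) : L (a + b) = L a + L b := by ext; simp [add_mul]
theorem L_sub (a b : J) : L (a - b) = L a - L b := by ext; simp [sub_mul]
theorem L_neg (a : J) : L (-a) = - L a := by ext; simp
theorem L_zero : L (0 : J) = 0 := by ext; simp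
theorem L_smul (c : ℂ) (a : J) : L (c • a) = c • L a := by
  ext; simp [smul_mul_assoc]

variable (J) in
/-- The span of the commutators `[L_a, L_b]`. -/
def inder : Submodule ℂ (Module.End ℂ J) :=
  Submodule.span ℂ {T | ∃ a b : J, T = ⁅L a, L b⁆}

variable (J) in
/-- The inner structure algebra `L_J + [L_J, L_J]`. -/
def instrl : Submodule ℂ (Module.End ℂ J) :=
  Submodule.span ℂ (Set.range L) ⊔ inder J

theorem lie_L_mem_inder (a b : J) : ⁅L a, L b⁆ ∈ inder J := Submodule.subset_span ⟨a, b, rfl⟩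

theorem inder_le : inder J ≤ instrl J := le_sup_right

theorem L_mem (a : J) : L a ∈ instrl J :=
  (le_sup_left : _ ≤ instrl J) (Submodule.subset_span ⟨a, rfl⟩)

theorem inder_one {T : Module.End ℂ J} (hT : T ∈ inder J) : T 1 = 0 := by
  induction hT using Submodule.span_induction with
  | mem x h => obtain ⟨a, b, rfl⟩ := h; simp [Ring.lie_def, mul_comm]
  | zero => rfl
  | add x y _ _ hx hy => simp [hx, hy]
  | smul c x _ hx => simp [hx]

theorem sub_L_mem_inder {T : Module.End ℂ J} (hT : T ∈ instrl J) : T - L (T 1) ∈ inder J := by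
  obtain ⟨S, hS, D, hD, rfl⟩ := Submodule.mem_sup.1 hT
  have : S = L (S 1) := by
    clear hT
    induction hS using Submodule.span_induction with
    | mem x h => obtain ⟨a, rfl⟩ := h; simp
    | zero => ext; simp
    | add x y _ _ hx hy => rw [LinearMap.add_apply, L_add, ← hx, ← hy]
    | smul c x _ hx => rw [LinearMap.smul_apply, L_smul, ← hx]
  rw [LinearMap.add_apply, inder_one hD, add_zero, ← this]
  simpa using hD

variable [IsCommJordan J]

/-- Linearized Jordan identity. -/
theorem jordan_lin (a b c d : J) :
    a * (b * c * d) - b * c * (a * d) + (b * (c * a * d) - c * a * (b * d))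
      + (c * (a * b * d) - a * b * (c * d)) = 0 := by
  have h := congrArg (fun f : AddMonoid.End J => f d) (two_nsmul_lie_lmul_lmul_add_add_eq_zero a b c)
  have h2 : (2 : ℂ) • (a * (b * c * d) - b * c * (a * d) + (b * (c * a * d) - c * a * (b * d))
      + (c * (a * b * d) - a * b * (c * d))) = 0 := by
    rw [two_smul, ← two_nsmul]; exact h
  exact (smul_eq_zero.1 h2).resolve_left two_ne_zero

theorem lie_lie_L (a b c : J) : ⁅⁅L a, L b⁆, L c⁆ = L (⁅L a, L b⁆ c) := by
  ext d
  have h1 := jordan_lin a c d b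
  have h2 := jordan_lin b c d a
  simp only [Ring.lie_def, LinearMap.sub_apply, Module.End.mul_apply, L_apply, sub_mul, mul_sub]
  rw [← sub_eq_zero] at h1 h2 ⊢
  linear_combination (norm := skip) h1 - h2
  simp only [mul_comm]
  abel

theorem inder_lie_L {D : Module.End ℂ J} (hD : D ∈ inder J) (c : J) : ⁅D, L c⁆ = L (D c) := by
  induction hD using Submodule.span_induction with
  | mem x h => obtain ⟨a, b, rfl⟩ := h; exact lie_lie_L a b c
  | zero => simp [Ring.lie_def, L_zero]
  | add x y _ _ hx hy =>
    rw [LinearMap.add_apply, L_add, ← hx, ← hy]; simp only [Ring.lie_def, add_mul, mul_add]; abel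
  | smul k x _ hx =>
    rw [LinearMap.smul_apply, L_smul, ← hx]
    simp only [Ring.lie_def, smul_mul_assoc, mul_smul_comm, smul_sub]

theorem inder_mul {D : Module.End ℂ J} (hD : D ∈ inder J) (a b : J) :
    D (a * b) = D a * b + a * D b := by
  have h := LinearMap.congr_fun (inder_lie_L hD a) b
  simp only [Ring.lie_def, LinearMap.sub_apply, Module.End.mul_apply, L_apply] at h
  rw [← h]; abel

theorem inder_lie_lie {D : Module.End ℂ J} (hD : D ∈ inder J) (a b : J) :
    ⁅D, ⁅L a, L b⁆⁆ = ⁅L (D a), L b⁆ + ⁅L a, L (D b)⁆ := by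
  rw [← inder_lie_L hD, ← inder_lie_L hD]
  simp only [Ring.lie_def]
  noncomm_ring

theorem inder_lie_mem {D T : Module.End ℂ J} (hD : D ∈ inder J) (hT : T ∈ inder J) :
    ⁅D, T⁆ ∈ inder J := by
  induction hT using Submodule.span_induction with
  | mem x h =>
    obtain ⟨a, b, rfl⟩ := h
    rw [inder_lie_lie hD]
    exact add_mem (lie_L_mem_inder _ _) (lie_L_mem_inder _ _)
  | zero => simp [Ring.lie_def]
  | add x y _ _ hx hy =>
    have : ⁅D, x + y⁆ = ⁅D, x⁆ + ⁅D, y⁆ := by simp only [Ring.lie_def, mul_add, add_mul]; abel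
    rw [this]; exact add_mem hx hy
  | smul k x _ hx =>
    have : ⁅D, k • x⁆ = k • ⁅D, x⁆ := by
      simp only [Ring.lie_def, smul_mul_assoc, mul_smul_comm, smul_sub]
    rw [this]; exact Submodule.smul_mem _ _ hx

theorem instrl_lie_mem {S T : Module.End ℂ J} (hS : S ∈ instrl J) (hT : T ∈ instrl J) :
    ⁅S, T⁆ ∈ instrl J := by
  have hD := sub_L_mem_inder hS
  have hE := sub_L_mem_inder hT
  have key : ⁅S, T⁆ = ⁅L (S 1), L (T 1)⁆ + ⁅S - L (S 1), L (T 1)⁆ - ⁅T - L (T 1), L (S 1)⁆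
      + ⁅S - L (S 1), T - L (T 1)⁆ := by
    simp only [Ring.lie_def]; noncomm_ring
  rw [key, inder_lie_L hD, inder_lie_L hE]
  exact add_mem (sub_mem (add_mem (inder_le (lie_L_mem_inder _ _)) (L_mem _)) (L_mem _))
    (inder_le (inder_lie_mem hD hE))

/-- The involution `L_a + D ↦ -L_a + D` of the inner structure algebra. As `D 1 = 0` for every `D`
in `[L_J, L_J]`, the component `a` of `E = L_a + D` is `E 1`. -/
def bar (E : instrl J) : instrl J :=
  ⟨(E : Module.End ℂ J) - (2 : ℂ) • L ((E : Module.End ℂ J) 1),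
    sub_mem E.2 (Submodule.smul_mem _ _ (L_mem _))⟩

/-- `a △ b = L_{ab} + [L_a, L_b]`. -/
def tri (a b : J) : instrl J :=
  ⟨L (a * b) + ⁅L a, L b⁆, add_mem (L_mem _) (inder_le (lie_L_mem_inder _ _))⟩

/-- The commutator on the inner structure algebra. -/
def instrlLie (S T : instrl J) : instrl J :=
  ⟨⁅(S : Module.End ℂ J), (T : Module.End ℂ J)⁆, instrl_lie_mem S.2 T.2⟩

theorem bar_coe (E : instrl J) :
    (bar E : Module.End ℂ J) = (E : Module.End ℂ J) - (2 : ℂ) • L ((E : Module.End ℂ J) 1) := rfl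

theorem tri_coe (a b : J) : (tri a b : Module.End ℂ J) = L (a * b) + ⁅L a, L b⁆ := rfl

theorem instrlLie_coe (S T : instrl J) :
    (instrlLie S T : Module.End ℂ J) = ⁅(S : Module.End ℂ J), (T : Module.End ℂ J)⁆ := rfl

theorem exists_decomp (E : instrl J) : ∃ (e : J) (D : Module.End ℂ J), D ∈ inder J ∧
    (E : Module.End ℂ J) = L e + D ∧ (bar E : Module.End ℂ J) = -L e + D := by
  refine ⟨(E : Module.End ℂ J) 1, _, sub_L_mem_inder E.2, by abel, ?_⟩
  rw [bar_coe, two_smul]; abel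

theorem tri_apply_swap (a b c : J) :
    (tri a b : Module.End ℂ J) c = (tri c b : Module.End ℂ J) a := by
  simp only [tri_coe, Ring.lie_def, LinearMap.add_apply, LinearMap.sub_apply,
    Module.End.mul_apply, L_apply, mul_comm]
  abel

theorem lie_tri (E : instrl J) (a b : J) :
    instrlLie E (tri a b) = tri ((E : Module.End ℂ J) a) b + tri a ((bar E : Module.End ℂ J) b) := by
  obtain ⟨e, D, hD, hE, hb⟩ := exists_decomp E
  apply Subtype.ext
  have h1 : ⁅L e, ⁅L a, L b⁆⁆ = -L (⁅L a, L b⁆ e) := by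
    rw [← lie_lie_L]; simp only [Ring.lie_def]; abel
  have h2 : ⁅L e, L (a * b)⁆ = ⁅L (e * a), L b⁆ - ⁅L a, L (e * b)⁆ := by
    ext d
    have := jordan_lin e a b d
    simp only [Ring.lie_def, LinearMap.sub_apply, Module.End.mul_apply, L_apply]
    rw [← sub_eq_zero]
    linear_combination (norm := skip) this
    simp only [mul_comm]
    abel
  have h3 : ⁅(L e + D), (L (a * b) + ⁅L a, L b⁆)⁆ = ⁅L e, L (a * b)⁆ + ⁅L e, ⁅L a, L b⁆⁆
      + ⁅D, L (a * b)⁆ + ⁅D, ⁅L a, L b⁆⁆ := by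
    simp only [Ring.lie_def]; noncomm_ring
  rw [instrlLie_coe, Submodule.coe_add, tri_coe, tri_coe, tri_coe, hE, hb, h3, h1, h2,
    inder_lie_L hD, inder_lie_lie hD, inder_mul hD]
  simp only [LinearMap.add_apply, LinearMap.neg_apply, L_apply, L_add, add_mul, mul_add, Ring.lie_def,
    LinearMap.sub_apply, Module.End.mul_apply, L_sub, L_neg, neg_mul, mul_neg, mul_comm e, mul_comm _ b]
  abel

theorem bar_tri (a b : J) : bar (tri a b) = - tri b a := by
  apply Subtype.ext
  have h := inder_one (lie_L_mem_inder a b)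
  simp only [bar_coe, Submodule.coe_neg, tri_coe, LinearMap.add_apply, L_apply, mul_one,
    h, add_zero, two_smul, mul_comm b a]
  simp only [Ring.lie_def]
  abel

theorem bar_lie (S T : instrl J) : bar (instrlLie S T) = instrlLie (bar S) (bar T) := by
  obtain ⟨e, D, hD, hE, hb⟩ := exists_decomp S
  obtain ⟨e', D', hD', hE', hb'⟩ := exists_decomp T
  apply Subtype.ext
  have h1 : (⁅(L e + D), (L e' + D')⁆ : Module.End ℂ J) = ⁅L e, L e'⁆ + L (D e') - L (D' e)
      + ⁅D, D'⁆ := by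
    rw [← inder_lie_L hD, ← inder_lie_L hD']; simp only [Ring.lie_def]; noncomm_ring
  have h2 : (⁅(-L e + D), (-L e' + D')⁆ : Module.End ℂ J) = ⁅L e, L e'⁆ - L (D e') + L (D' e)
      + ⁅D, D'⁆ := by
    rw [← inder_lie_L hD, ← inder_lie_L hD']; simp only [Ring.lie_def]; noncomm_ring
  rw [bar_coe, instrlLie_coe, instrlLie_coe, hE, hE', hb, hb', h1, h2]
  simp only [LinearMap.add_apply, LinearMap.sub_apply, L_apply, mul_one,
    inder_one (lie_L_mem_inder e e'), inder_one (inder_lie_mem hD hD'), L_add, L_sub, L_zero, two_smul]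
  abel

theorem bar_add (S T : instrl J) : bar (S + T) = bar S + bar T := by
  apply Subtype.ext
  simp only [bar_coe, Submodule.coe_add, LinearMap.add_apply, L_add, smul_add]; abel

theorem bar_smul (c : ℂ) (S : instrl J) : bar (c • S) = c • bar S := by
  apply Subtype.ext
  simp only [bar_coe, Submodule.coe_smul, LinearMap.smul_apply, L_smul, smul_sub, smul_comm c]

end TKKDefs

/-- The space `TKK(J) = J ⊕ Instrl(J) ⊕ J̄`. -/
@[ext]
structure TKK (J : Type) [NonAssocCommRing J] [Module ℂ J] [IsScalarTower ℂ J J]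
    [SMulCommClass ℂ J J] where
  pos : J
  op : instrl J
  neg : J

namespace TKK

variable {J : Type} [NonAssocCommRing J] [Module ℂ J] [IsScalarTower ℂ J J] [SMulCommClass ℂ J J]

instance : Zero (TKK J) := ⟨⟨0, 0, 0⟩⟩
instance : Add (TKK J) := ⟨fun u v => ⟨u.pos + v.pos, u.op + v.op, u.neg + v.neg⟩⟩
instance : Neg (TKK J) := ⟨fun u => ⟨-u.pos, -u.op, -u.neg⟩⟩
instance : SMul ℂ (TKK J) := ⟨fun c u => ⟨c • u.pos, c • u.op, c • u.neg⟩⟩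

@[simp] theorem zero_pos : (0 : TKK J).pos = 0 := rfl
@[simp] theorem zero_op : (0 : TKK J).op = 0 := rfl
@[simp] theorem zero_neg : (0 : TKK J).neg = 0 := rfl
@[simp] theorem add_pos (u v : TKK J) : (u + v).pos = u.pos + v.pos := rfl
@[simp] theorem add_op (u v : TKK J) : (u + v).op = u.op + v.op := rfl
@[simp] theorem add_neg (u v : TKK J) : (u + v).neg = u.neg + v.neg := rfl
@[simp] theorem neg_pos (u : TKK J) : (-u).pos = -u.pos := rfl
@[simp] theorem neg_op (u : TKK J) : (-u).op = -u.op := rfl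
@[simp] theorem neg_neg' (u : TKK J) : (-u).neg = -u.neg := rfl
@[simp] theorem smul_pos (c : ℂ) (u : TKK J) : (c • u).pos = c • u.pos := rfl
@[simp] theorem smul_op (c : ℂ) (u : TKK J) : (c • u).op = c • u.op := rfl
@[simp] theorem smul_neg' (c : ℂ) (u : TKK J) : (c • u).neg = c • u.neg := rfl

instance : AddCommGroup (TKK J) where
  add_assoc _ _ _ := TKK.ext (add_assoc _ _ _) (add_assoc _ _ _) (add_assoc _ _ _)
  zero_add _ := TKK.ext (zero_add _) (zero_add _) (zero_add _)
  add_zero _ := TKK.ext (add_zero _) (add_zero _) (add_zero _)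
  add_comm _ _ := TKK.ext (add_comm _ _) (add_comm _ _) (add_comm _ _)
  neg_add_cancel _ := TKK.ext (neg_add_cancel _) (neg_add_cancel _) (neg_add_cancel _)
  nsmul := nsmulRec
  zsmul := zsmulRec

instance : Module ℂ (TKK J) where
  one_smul _ := TKK.ext (one_smul _ _) (one_smul _ _) (one_smul _ _)
  mul_smul _ _ _ := TKK.ext (mul_smul _ _ _) (mul_smul _ _ _) (mul_smul _ _ _)
  smul_zero _ := TKK.ext (smul_zero _) (smul_zero _) (smul_zero _)
  smul_add _ _ _ := TKK.ext (smul_add _ _ _) (smul_add _ _ _) (smul_add _ _ _)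
  add_smul _ _ _ := TKK.ext (add_smul _ _ _) (add_smul _ _ _) (add_smul _ _ _)
  zero_smul _ := TKK.ext (zero_smul _ _) (zero_smul _ _) (zero_smul _ _)

variable [IsCommJordan J]

instance : Bracket (TKK J) (TKK J) where
  bracket u v :=
    { pos := (u.op : Module.End ℂ J) v.pos - (v.op : Module.End ℂ J) u.pos
      op := tri u.pos v.neg - tri v.pos u.neg + instrlLie u.op v.op
      neg := (bar u.op : Module.End ℂ J) v.neg - (bar v.op : Module.End ℂ J) u.neg }

theorem lie_pos (u v : TKK J) :
    ⁅u, v⁆.pos = (u.op : Module.End ℂ J) v.pos - (v.op : Module.End ℂ J) u.pos := rfl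
theorem lie_op (u v : TKK J) :
    ⁅u, v⁆.op = tri u.pos v.neg - tri v.pos u.neg + instrlLie u.op v.op := rfl
theorem lie_neg (u v : TKK J) :
    ⁅u, v⁆.neg = (bar u.op : Module.End ℂ J) v.neg - (bar v.op : Module.End ℂ J) u.neg := rfl

theorem tri_add_left (a b c : J) : tri (a + b) c = tri a c + tri b c := by
  apply Subtype.ext
  simp only [tri_coe, Submodule.coe_add, add_mul, L_add, Ring.lie_def, mul_add]; abel
theorem tri_add_right (a b c : J) : tri a (b + c) = tri a b + tri a c := by
  apply Subtype.ext
  simp only [tri_coe, Submodule.coe_add, add_mul, L_add, Ring.lie_def, mul_add]; abel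
theorem tri_smul_left (k : ℂ) (a c : J) : tri (k • a) c = k • tri a c := by
  apply Subtype.ext
  simp only [tri_coe, Submodule.coe_smul, L_smul, Ring.lie_def, smul_mul_assoc, mul_smul_comm,
    smul_add, smul_sub]
theorem tri_smul_right (k : ℂ) (a c : J) : tri a (k • c) = k • tri a c := by
  apply Subtype.ext
  simp only [tri_coe, Submodule.coe_smul, L_smul, Ring.lie_def, smul_mul_assoc, mul_smul_comm,
    smul_add, smul_sub]
theorem tri_sub_left (a b c : J) : tri (a - b) c = tri a c - tri b c := by
  rw [eq_sub_iff_add_eq, ← tri_add_left, sub_add_cancel]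
theorem tri_sub_right (a b c : J) : tri a (b - c) = tri a b - tri a c := by
  rw [eq_sub_iff_add_eq, ← tri_add_right, sub_add_cancel]
theorem instrlLie_add_left (a b c : instrl J) :
    instrlLie (a + b) c = instrlLie a c + instrlLie b c := by
  apply Subtype.ext
  simp only [instrlLie_coe, Submodule.coe_add, Ring.lie_def, add_mul, mul_add]; abel
theorem instrlLie_swap (a b : instrl J) : instrlLie a b = - instrlLie b a := by
  apply Subtype.ext
  simp only [instrlLie_coe, Submodule.coe_neg, Ring.lie_def]; abel
theorem instrlLie_add_right (a b c : instrl J) :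
    instrlLie a (b + c) = instrlLie a b + instrlLie a c := by
  rw [instrlLie_swap, instrlLie_add_left, neg_add, ← instrlLie_swap, ← instrlLie_swap]
theorem instrlLie_sub_left (a b c : instrl J) :
    instrlLie (a - b) c = instrlLie a c - instrlLie b c := by
  rw [eq_sub_iff_add_eq, ← instrlLie_add_left, sub_add_cancel]
theorem instrlLie_sub_right (a b c : instrl J) :
    instrlLie a (b - c) = instrlLie a b - instrlLie a c := by
  rw [eq_sub_iff_add_eq, ← instrlLie_add_right, sub_add_cancel]
theorem instrlLie_jacobi (a b c : instrl J) : instrlLie a (instrlLie b c) =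
    instrlLie (instrlLie a b) c + instrlLie b (instrlLie a c) := by
  apply Subtype.ext
  simp only [instrlLie_coe, Submodule.coe_add, Ring.lie_def]; noncomm_ring
theorem bar_sub (S T : instrl J) : bar (S - T) = bar S - bar T := by
  rw [eq_sub_iff_add_eq, ← bar_add, sub_add_cancel]
theorem bar_bar (S : instrl J) : bar (bar S) = S := by
  obtain ⟨e, D, hD, hE, hb⟩ := exists_decomp S
  apply Subtype.ext
  rw [bar_coe, hb, hE]
  simp only [LinearMap.add_apply, LinearMap.neg_apply, L_apply, mul_one, inder_one hD, add_zero,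
    L_neg, two_smul]
  abel

instance : LieRing (TKK J) where
  add_lie u v w := by
    ext1
    · simp only [lie_pos, add_pos, add_op, Submodule.coe_add, LinearMap.add_apply, map_add]; abel
    · simp only [lie_op, add_pos, add_op, add_neg, tri_add_left, tri_add_right,
        instrlLie_add_left]; abel
    · simp only [lie_neg, add_neg, add_op, bar_add, Submodule.coe_add, LinearMap.add_apply,
        map_add]; abel
  lie_add u v w := by
    ext1
    · simp only [lie_pos, add_pos, add_op, Submodule.coe_add, LinearMap.add_apply, map_add]; abel
    · simp only [lie_op, add_pos, add_op, add_neg, tri_add_left, tri_add_right,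
        instrlLie_add_right]; abel
    · simp only [lie_neg, add_neg, add_op, bar_add, Submodule.coe_add, LinearMap.add_apply,
        map_add]; abel
  lie_self u := by
    ext1
    · simp [lie_pos]
    · apply Subtype.ext
      simp [lie_op, instrlLie_coe, Ring.lie_def]
    · simp [lie_neg]
  leibniz_lie u v w := by
    ext1
    · simp only [lie_pos, add_pos, lie_op, Submodule.coe_add, Submodule.coe_sub,
        LinearMap.add_apply, LinearMap.sub_apply, map_sub, instrlLie_coe, Ring.lie_def,
        Module.End.mul_apply]
      rw [tri_apply_swap v.pos w.neg u.pos, tri_apply_swap w.pos v.neg u.pos,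
        tri_apply_swap v.pos u.neg w.pos]
      abel
    · simp only [lie_op, lie_pos, lie_neg, add_op, instrlLie_add_left, instrlLie_add_right,
        instrlLie_sub_left, instrlLie_sub_right, lie_tri, tri_sub_left, tri_sub_right]
      rw [instrlLie_swap (tri u.pos v.neg) w.op, instrlLie_swap (tri v.pos u.neg) w.op,
        lie_tri, lie_tri, instrlLie_jacobi u.op v.op w.op]
      abel
    · simp only [lie_neg, add_neg, lie_op, bar_add, bar_sub, bar_tri, bar_lie, Submodule.coe_add,
        Submodule.coe_sub, Submodule.coe_neg, LinearMap.neg_apply,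
        LinearMap.add_apply, LinearMap.sub_apply, map_sub, instrlLie_coe, Ring.lie_def,
        Module.End.mul_apply]
      rw [tri_apply_swap w.neg v.pos u.neg, tri_apply_swap v.neg w.pos u.neg,
        tri_apply_swap v.neg u.pos w.neg]
      abel

instance : LieAlgebra ℂ (TKK J) where
  lie_smul c u v := by
    ext1
    · simp only [lie_pos, smul_pos, smul_op, Submodule.coe_smul, LinearMap.smul_apply, map_smul,
        smul_sub]
    · apply Subtype.ext
      simp only [lie_op, smul_pos, smul_op, smul_neg', tri_smul_left, tri_smul_right,
        smul_add, smul_sub, Submodule.coe_add, Submodule.coe_sub, Submodule.coe_smul, instrlLie_coe,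
        Ring.lie_def, smul_mul_assoc, mul_smul_comm]
    · simp only [lie_neg, smul_neg', smul_op, bar_smul, Submodule.coe_smul, LinearMap.smul_apply,
        map_smul, smul_sub]

end TKK


/-- The lattice `Λ = ℤσ₁ ⊕ ℤσ₂`. -/
abbrev Lat := ℤ × ℤ

/-- A unital `Λ`-graded algebra `J = ⨁ J^l` with `dim J^l ≤ 1`, whose support generates `Λ`,
together with generators `x l` of its homogeneous spaces (`x l = 0` when `J^l = 0`), and with the
linear form `eps` such that `eps 1 = 1` and `eps (x l) = 0` for `l ≠ 0`, which is associative. -/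
structure JordanTorus (J : Type) [NonAssocCommRing J] [Module ℂ J] where
  x : Lat → J
  linInd : LinearIndependent ℂ (fun l : {l : Lat // x l ≠ 0} => x l)
  span_x : Submodule.span ℂ (Set.range x) = ⊤
  x_zero : x 0 = 1
  x_mul : ∀ l m, x l * x m ∈ Submodule.span ℂ {x (l + m)}
  gen : AddSubgroup.closure {l | x l ≠ 0} = ⊤
  eps : J →ₗ[ℂ] ℂ
  eps_x : ∀ l, eps (x l) = if l = 0 then 1 else 0
  eps_assoc_x : ∀ l m n, eps (x l * x m * x n) = eps (x l * (x m * x n))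

namespace JordanTorus

variable {J : Type} [NonAssocCommRing J] [Module ℂ J] [IsScalarTower ℂ J J] [SMulCommClass ℂ J J]
variable (T : JordanTorus J)

theorem induction_x {p : J → Prop} (a : J) (hx : ∀ l, p (T.x l)) (h0 : p 0)
    (hadd : ∀ a b, p a → p b → p (a + b)) (hsmul : ∀ (c : ℂ) a, p a → p (c • a)) : p a := by
  have ha : a ∈ Submodule.span ℂ (Set.range T.x) := by rw [T.span_x]; trivial
  induction ha using Submodule.span_induction with
  | mem x h => obtain ⟨l, rfl⟩ := h; exact hx l
  | zero => exact h0
  | add x y _ _ hx hy => exact hadd _ _ hx hy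
  | smul c x _ hx => exact hsmul _ _ hx

theorem eps_assoc (a b c : J) : T.eps (a * b * c) = T.eps (a * (b * c)) := by
  induction a using T.induction_x with
  | h0 => simp
  | hadd a a' h h' => simp only [add_mul, map_add, h, h']
  | hsmul k a h => simp only [smul_mul_assoc, map_smul, h]
  | hx l =>
  induction b using T.induction_x with
  | h0 => simp
  | hadd a a' h h' => simp only [add_mul, mul_add, map_add, h, h']
  | hsmul k a h => simp only [smul_mul_assoc, mul_smul_comm, map_smul, h]
  | hx m =>
  induction c using T.induction_x with
  | h0 => simp
  | hadd a a' h h' => simp only [mul_add, map_add, h, h']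
  | hsmul k a h => simp only [mul_smul_comm, map_smul, h]
  | hx n => exact T.eps_assoc_x l m n

theorem eps_lie_swap (a b c d : J) :
    T.eps (⁅L a, L b⁆ c * d) = T.eps (⁅L c, L d⁆ a * b) := by
  have h (p q r s : J) : T.eps (p * (q * r) * s) = T.eps (q * r * (p * s)) := by
    rw [mul_comm p, T.eps_assoc]
  simp only [Ring.lie_def, LinearMap.sub_apply, Module.End.mul_apply, L_apply, sub_mul, map_sub, h]
  rw [mul_comm d a, mul_comm (a * d), mul_comm b c, mul_comm a c, mul_comm b d]

/-- Sums `∑ c [L_a, L_b]`, indexed by formal combinations of pairs `(a, b)`. -/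
noncomputable def lieSum : (J × J →₀ ℂ) →ₗ[ℂ] Module.End ℂ J :=
  Finsupp.linearCombination ℂ fun p : J × J => ⁅L p.1, L p.2⁆

/-- The sum `∑ c (D a, b)` attached to a formal combination of pairs `(a, b)`. -/
noncomputable def pairSum (D : Module.End ℂ J) : (J × J →₀ ℂ) →ₗ[ℂ] ℂ :=
  Finsupp.linearCombination ℂ fun p : J × J => T.eps (D p.1 * p.2)

theorem exists_lieSum (D : inder J) : ∃ t, lieSum t = (D : Module.End ℂ J) := by
  have h : (D : Module.End ℂ J) ∈ Submodule.span ℂ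
      (Set.range fun p : J × J => ⁅L p.1, L p.2⁆) := by
    refine Submodule.span_mono ?_ D.2
    rintro _ ⟨a, b, rfl⟩
    exact ⟨(a, b), rfl⟩
  exact (Finsupp.mem_span_range_iff_exists_finsupp.1 h)

theorem pairSum_eq_zero {D : Module.End ℂ J} (hD : D ∈ inder J) {t : J × J →₀ ℂ}
    (ht : lieSum t = 0) : T.pairSum D t = 0 := by
  induction hD using Submodule.span_induction with
  | mem x h =>
    obtain ⟨a, b, rfl⟩ := h
    have : T.pairSum ⁅L a, L b⁆ t = T.eps ((lieSum t) a * b) := by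
      simp only [pairSum, lieSum, Finsupp.linearCombination_apply, Finsupp.sum,
        LinearMap.sum_apply, Finset.sum_mul, map_sum, LinearMap.smul_apply, smul_mul_assoc, map_smul]
      exact Finset.sum_congr rfl fun p _ => by rw [T.eps_lie_swap]
    rw [this, ht]; simp
  | zero => simp [pairSum, Finsupp.linearCombination_apply]
  | add x y _ _ hx hy =>
    have : T.pairSum (x + y) t = T.pairSum x t + T.pairSum y t := by
      simp [pairSum, Finsupp.linearCombination_apply, Finsupp.sum, add_mul, mul_add,
        Finset.sum_add_distrib]
    rw [this, hx, hy, add_zero]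
  | smul k x _ hx =>
    have : T.pairSum (k • x) t = k * T.pairSum x t := by
      simp only [pairSum, Finsupp.linearCombination_apply, Finsupp.sum, LinearMap.smul_apply,
        smul_mul_assoc, map_smul, Finset.mul_sum, smul_eq_mul]
      exact Finset.sum_congr rfl fun p _ => by ring
    rw [this, hx, mul_zero]

theorem pairSum_congr {D : Module.End ℂ J} (hD : D ∈ inder J) {t s : J × J →₀ ℂ}
    (h : lieSum t = lieSum s) : T.pairSum D t = T.pairSum D s := by
  rw [← sub_eq_zero, ← map_sub]
  exact T.pairSum_eq_zero hD (by rw [map_sub, h, sub_self])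

/-- The form on `[L_J, L_J]` with `(D, [L_a, L_b]) = (D a, b)`. -/
noncomputable def inderForm : inder J →ₗ[ℂ] inder J →ₗ[ℂ] ℂ :=
  LinearMap.mk₂ ℂ (fun D D' => T.pairSum D (exists_lieSum D').choose)
    (fun D D' E => by
      simp [pairSum, Finsupp.linearCombination_apply, Finsupp.sum, add_mul, mul_add,
        Finset.sum_add_distrib])
    (fun k D E => by
      simp only [pairSum, Finsupp.linearCombination_apply, Finsupp.sum, Submodule.coe_smul,
        LinearMap.smul_apply, smul_mul_assoc, map_smul, Finset.mul_sum, smul_eq_mul]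
      exact Finset.sum_congr rfl fun p _ => by ring)
    (fun D E E' => by
      rw [← map_add]
      refine T.pairSum_congr D.2 ?_
      rw [map_add, (exists_lieSum _).choose_spec, (exists_lieSum E).choose_spec,
        (exists_lieSum E').choose_spec]; rfl)
    (fun k D E => by
      rw [← map_smul]
      refine T.pairSum_congr D.2 ?_
      rw [map_smul, (exists_lieSum _).choose_spec, (exists_lieSum E).choose_spec]; rfl)

theorem inderForm_lie (D : inder J) (a b : J) :
    T.inderForm D ⟨⁅L a, L b⁆, lie_L_mem_inder a b⟩ = T.eps ((D : Module.End ℂ J) a * b) := by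
  have h : T.pairSum D (Finsupp.single (a, b) 1) = T.eps ((D : Module.End ℂ J) a * b) := by
    simp [pairSum]
  rw [← h]
  refine T.pairSum_congr D.2 ?_
  rw [(exists_lieSum _).choose_spec]
  simp [lieSum]

theorem inderForm_comm (D D' : inder J) : T.inderForm D D' = T.inderForm D' D := by
  obtain ⟨D, hD⟩ := D
  obtain ⟨D', hD'⟩ := D'
  induction hD' using Submodule.span_induction with
  | mem x h =>
    obtain ⟨a, b, rfl⟩ := h
    induction hD using Submodule.span_induction with
    | mem x h =>
      obtain ⟨c, d, rfl⟩ := h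
      rw [inderForm_lie, inderForm_lie]
      exact T.eps_lie_swap _ _ _ _
    | zero =>
      rw [show (⟨0, _⟩ : inder J) = 0 from rfl]; simp
    | add x y hx' hy' hx hy =>
      rw [show (⟨x + y, _⟩ : inder J) = ⟨x, hx'⟩ + ⟨y, hy'⟩ from rfl]
      simp only [map_add, LinearMap.add_apply, hx, hy]
    | smul k x hx' hx =>
      rw [show (⟨k • x, _⟩ : inder J) = k • ⟨x, hx'⟩ from rfl]
      simp only [map_smul, LinearMap.smul_apply, hx]
  | zero =>
    rw [show (⟨0, _⟩ : inder J) = 0 from rfl]; simp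
  | add x y hx' hy' hx hy =>
    rw [show (⟨x + y, _⟩ : inder J) = ⟨x, hx'⟩ + ⟨y, hy'⟩ from rfl]
    simp only [map_add, LinearMap.add_apply, hx, hy]
  | smul k x hx' hx =>
    rw [show (⟨k • x, _⟩ : inder J) = k • ⟨x, hx'⟩ from rfl]
    simp only [map_smul, LinearMap.smul_apply, hx]

/-- The component `D` of `E = L_a + D`. -/
def inderPart : instrl J →ₗ[ℂ] inder J where
  toFun E := ⟨(E : Module.End ℂ J) - L ((E : Module.End ℂ J) 1), sub_L_mem_inder E.2⟩
  map_add' E F := by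
    apply Subtype.ext
    simp only [Submodule.coe_add, LinearMap.add_apply, L_add]; abel
  map_smul' k E := by
    apply Subtype.ext
    simp only [Submodule.coe_smul, LinearMap.smul_apply, L_smul, smul_sub, RingHom.id_apply]

/-- The form on the inner structure algebra: `(L_a + D, L_b + D') = (a, b) + (D, D')`. -/
noncomputable def opForm : instrl J →ₗ[ℂ] instrl J →ₗ[ℂ] ℂ :=
  LinearMap.mk₂ ℂ (fun E F => T.eps ((E : Module.End ℂ J) 1 * (F : Module.End ℂ J) 1) +
      T.inderForm (inderPart E) (inderPart F))
    (fun _ _ _ => by simp [add_mul]; ring) (fun _ _ _ => by simp [mul_add, smul_mul_assoc])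
    (fun _ _ _ => by simp [mul_add]; ring) (fun _ _ _ => by simp [mul_add, mul_smul_comm])

/-- The form on `TKK(J)`. -/
noncomputable def form : TKK J →ₗ[ℂ] TKK J →ₗ[ℂ] ℂ :=
  LinearMap.mk₂ ℂ (fun u v => T.eps (u.pos * v.neg) + T.eps (v.pos * u.neg) + T.opForm u.op v.op)
    (fun _ _ _ => by simp [add_mul, mul_add]; ring)
    (fun _ _ _ => by simp [mul_add, smul_mul_assoc, mul_smul_comm])
    (fun _ _ _ => by simp [mul_add, add_mul]; ring)
    (fun _ _ _ => by simp [mul_add, smul_mul_assoc, mul_smul_comm])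

theorem opForm_apply (E F : instrl J) : T.opForm E F =
    T.eps ((E : Module.End ℂ J) 1 * (F : Module.End ℂ J) 1) +
      T.inderForm (inderPart E) (inderPart F) := rfl

theorem form_apply (u v : TKK J) : T.form u v =
    T.eps (u.pos * v.neg) + T.eps (v.pos * u.neg) + T.opForm u.op v.op := rfl

theorem opForm_comm (E F : instrl J) : T.opForm E F = T.opForm F E := by
  rw [opForm_apply, opForm_apply, inderForm_comm, mul_comm]

theorem form_comm (u v : TKK J) : T.form u v = T.form v u := by
  rw [form_apply, form_apply, opForm_comm]; ring

/-- The homogeneous space `J^l`. -/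
def jgr (l : Lat) : Submodule ℂ J := Submodule.span ℂ {T.x l}

/-- The homogeneous space of degree `l` of the inner structure algebra. -/
def opgr (l : Lat) : Submodule ℂ (Module.End ℂ J) :=
  Submodule.span ℂ {L (T.x l)} ⊔
    Submodule.span ℂ {S | ∃ m n, m + n = l ∧ S = ⁅L (T.x m), L (T.x n)⁆}

/-- The homogeneous space of degree `l` of `TKK(J)`. -/
def gr (l : Lat) : Submodule ℂ (TKK J) where
  carrier := {u | u.pos ∈ T.jgr l ∧ (u.op : Module.End ℂ J) ∈ T.opgr l ∧ u.neg ∈ T.jgr l}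
  add_mem' hu hv := ⟨add_mem hu.1 hv.1, add_mem hu.2.1 hv.2.1, add_mem hu.2.2 hv.2.2⟩
  zero_mem' := ⟨zero_mem _, zero_mem (T.opgr l), zero_mem _⟩
  smul_mem' c _ hu := ⟨Submodule.smul_mem _ c hu.1, Submodule.smul_mem _ c hu.2.1,
    Submodule.smul_mem _ c hu.2.2⟩

theorem x_mem (l : Lat) : T.x l ∈ T.jgr l := Submodule.subset_span rfl

theorem jgr_mul {l m : Lat} {a b : J} (ha : a ∈ T.jgr l) (hb : b ∈ T.jgr m) :
    a * b ∈ T.jgr (l + m) := by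
  obtain ⟨c, rfl⟩ := Submodule.mem_span_singleton.1 ha
  obtain ⟨d, rfl⟩ := Submodule.mem_span_singleton.1 hb
  rw [smul_mul_assoc, mul_smul_comm]
  exact Submodule.smul_mem _ _ (Submodule.smul_mem _ _ (T.x_mul l m))

theorem one_mem_jgr : (1 : J) ∈ T.jgr 0 := by rw [← T.x_zero]; exact T.x_mem 0

theorem L_mem_opgr {l : Lat} {a : J} (ha : a ∈ T.jgr l) : L a ∈ T.opgr l := by
  obtain ⟨c, rfl⟩ := Submodule.mem_span_singleton.1 ha
  rw [L_smul]
  exact Submodule.smul_mem _ _ ((le_sup_left : _ ≤ T.opgr l) (Submodule.subset_span rfl))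

theorem lie_L_mem_opgr {l m : Lat} {a b : J} (ha : a ∈ T.jgr l) (hb : b ∈ T.jgr m) :
    ⁅L a, L b⁆ ∈ T.opgr (l + m) := by
  obtain ⟨c, rfl⟩ := Submodule.mem_span_singleton.1 ha
  obtain ⟨d, rfl⟩ := Submodule.mem_span_singleton.1 hb
  have : (⁅L (c • T.x l), L (d • T.x m)⁆ : Module.End ℂ J) = (c * d) • ⁅L (T.x l), L (T.x m)⁆ := by
    simp only [L_smul, Ring.lie_def, smul_mul_assoc, mul_smul_comm, smul_smul, smul_sub,
      mul_comm d c]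
  rw [this]
  exact Submodule.smul_mem _ _
    ((le_sup_right : _ ≤ T.opgr (l + m)) (Submodule.subset_span ⟨l, m, rfl, rfl⟩))

theorem opgr_induction {l : Lat} {p : Module.End ℂ J → Prop} {S : Module.End ℂ J}
    (hS : S ∈ T.opgr l) (h1 : p (L (T.x l)))
    (h2 : ∀ m n, m + n = l → p ⁅L (T.x m), L (T.x n)⁆) (h0 : p 0)
    (hadd : ∀ S S', p S → p S' → p (S + S')) (hsmul : ∀ (c : ℂ) S, p S → p (c • S)) : p S := by
  obtain ⟨A, hA, B, hB, rfl⟩ := Submodule.mem_sup.1 hS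
  clear hS
  refine hadd _ _ ?_ ?_
  · induction hA using Submodule.span_induction with
    | mem x h => obtain rfl := h; exact h1
    | zero => exact h0
    | add x y _ _ hx hy => exact hadd _ _ (hx) (hy)
    | smul c x _ hx => exact hsmul _ _ (hx)
  · induction hB using Submodule.span_induction with
    | mem x h => obtain ⟨m, n, h, rfl⟩ := h; exact h2 m n h
    | zero => exact h0
    | add x y _ _ hx hy => exact hadd _ _ (hx) (hy)
    | smul c x _ hx => exact hsmul _ _ (hx)


theorem lie_opgr_jgr_aux {l m : Lat} {a b c : J} {n : Lat} (ha : a ∈ T.jgr l) (hb : b ∈ T.jgr m)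
    (hc : c ∈ T.jgr n) : ⁅L a, L b⁆ c ∈ T.jgr (l + m + n) := by
  simp only [Ring.lie_def, LinearMap.sub_apply, Module.End.mul_apply, L_apply]
  refine sub_mem ?_ ?_
  · rw [add_assoc]; exact T.jgr_mul ha (T.jgr_mul hb hc)
  · rw [add_comm l m, add_assoc]; exact T.jgr_mul hb (T.jgr_mul ha hc)

theorem opgr_apply {l m : Lat} {S : Module.End ℂ J} (hS : S ∈ T.opgr l) {a : J}
    (ha : a ∈ T.jgr m) : S a ∈ T.jgr (l + m) := by
  refine T.opgr_induction (p := fun S => S a ∈ T.jgr (l + m)) hS ?_ ?_ ?_ ?_ ?_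
  · exact T.jgr_mul (T.x_mem l) ha
  · rintro n k rfl
    exact T.lie_opgr_jgr_aux (T.x_mem n) (T.x_mem k) ha
  · exact zero_mem _
  · intro S S' h h'; exact add_mem h h'
  · intro c S h; exact Submodule.smul_mem _ c h

section Jordan

variable [IsCommJordan J]

theorem bar_mem_opgr {l : Lat} {E : instrl J} (hE : (E : Module.End ℂ J) ∈ T.opgr l) :
    (bar E : Module.End ℂ J) ∈ T.opgr l := by
  rw [bar_coe]
  refine sub_mem hE (Submodule.smul_mem _ _ (T.L_mem_opgr ?_))
  simpa using T.opgr_apply hE T.one_mem_jgr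

theorem tri_mem_opgr {l m : Lat} {a b : J} (ha : a ∈ T.jgr l) (hb : b ∈ T.jgr m) :
    (tri a b : Module.End ℂ J) ∈ T.opgr (l + m) := by
  rw [tri_coe]
  exact add_mem (T.L_mem_opgr (T.jgr_mul ha hb)) (T.lie_L_mem_opgr ha hb)

theorem lie_mem_opgr {l m : Lat} {S S' : Module.End ℂ J} (hS : S ∈ T.opgr l)
    (hS' : S' ∈ T.opgr m) : ⁅S, S'⁆ ∈ T.opgr (l + m) := by
  have hlin : ∀ {A B C : Module.End ℂ J} {n : Lat}, ⁅A, C⁆ ∈ T.opgr n → ⁅B, C⁆ ∈ T.opgr n →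
      ⁅A + B, C⁆ ∈ T.opgr n := by
    intro A B C n h h'
    have : ⁅A + B, C⁆ = ⁅A, C⁆ + ⁅B, C⁆ := by simp only [Ring.lie_def, add_mul, mul_add]; abel
    rw [this]; exact add_mem h h'
  have hsm : ∀ {A C : Module.End ℂ J} {n : Lat} (c : ℂ), ⁅A, C⁆ ∈ T.opgr n →
      ⁅c • A, C⁆ ∈ T.opgr n := by
    intro A C n c h
    have : ⁅c • A, C⁆ = c • ⁅A, C⁆ := by
      simp only [Ring.lie_def, smul_mul_assoc, mul_smul_comm, smul_sub]
    rw [this]; exact Submodule.smul_mem _ _ h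
  have hsw : ∀ {A C : Module.End ℂ J} {n : Lat}, ⁅A, C⁆ ∈ T.opgr n → ⁅C, A⁆ ∈ T.opgr n := by
    intro A C n h
    have : ⁅C, A⁆ = -⁅A, C⁆ := by simp only [Ring.lie_def]; abel
    rw [this]; exact neg_mem h
  have hz : ∀ {C : Module.End ℂ J} {n : Lat}, ⁅(0 : Module.End ℂ J), C⁆ ∈ T.opgr n := by
    intro C n; simp [Ring.lie_def]
  refine T.opgr_induction (p := fun S => ⁅S, S'⁆ ∈ T.opgr (l + m)) hS ?_ ?_ hz
    (fun _ _ => hlin) (fun c _ => hsm c)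
  · apply hsw
    refine T.opgr_induction (p := fun S' => ⁅S', L (T.x l)⁆ ∈ T.opgr (l + m)) hS' ?_ ?_ hz
      (fun _ _ => hlin) (fun c _ => hsm c)
    · rw [add_comm]; exact T.lie_L_mem_opgr (T.x_mem m) (T.x_mem l)
    · rintro n k rfl
      rw [lie_lie_L, add_comm l]
      exact T.L_mem_opgr (T.lie_opgr_jgr_aux (T.x_mem n) (T.x_mem k) (T.x_mem l))
  · rintro p q rfl
    apply hsw
    refine T.opgr_induction (p := fun S' => ⁅S', ⁅L (T.x p), L (T.x q)⁆⁆ ∈ T.opgr (p + q + m))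
      hS' ?_ ?_ hz (fun _ _ => hlin) (fun c _ => hsm c)
    · apply hsw
      rw [lie_lie_L]
      exact T.L_mem_opgr (T.lie_opgr_jgr_aux (T.x_mem p) (T.x_mem q) (T.x_mem m))
    · rintro n k rfl
      rw [inder_lie_lie (lie_L_mem_inder _ _)]
      refine add_mem ?_ ?_
      · have := T.lie_L_mem_opgr (T.lie_opgr_jgr_aux (T.x_mem n) (T.x_mem k) (T.x_mem p))
          (T.x_mem q)
        rwa [show n + k + p + q = p + q + (n + k) by abel] at this
      · have := T.lie_L_mem_opgr (T.x_mem p)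
          (T.lie_opgr_jgr_aux (T.x_mem n) (T.x_mem k) (T.x_mem q))
        rwa [show p + (n + k + q) = p + q + (n + k) by abel] at this

theorem lie_mem_gr {l m : Lat} {u v : TKK J} (hu : u ∈ T.gr l) (hv : v ∈ T.gr m) :
    ⁅u, v⁆ ∈ T.gr (l + m) := by
  refine ⟨?_, ?_, ?_⟩
  · rw [TKK.lie_pos]
    refine sub_mem (T.opgr_apply hu.2.1 hv.1) ?_
    rw [add_comm]; exact T.opgr_apply hv.2.1 hu.1
  · rw [TKK.lie_op]
    refine add_mem (sub_mem (T.tri_mem_opgr hu.1 hv.2.2) ?_) (T.lie_mem_opgr hu.2.1 hv.2.1)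
    rw [add_comm]; exact T.tri_mem_opgr hv.1 hu.2.2
  · rw [TKK.lie_neg]
    refine sub_mem (T.opgr_apply (T.bar_mem_opgr hu.2.1) hv.2.2) ?_
    rw [add_comm]; exact T.opgr_apply (T.bar_mem_opgr hv.2.1) hu.2.2

/-- The operators `a △ b` span the inner structure algebra. -/
theorem tri_induction {p : instrl J → Prop} (E : instrl J) (htri : ∀ a b, p (tri a b))
    (h0 : p 0) (hadd : ∀ S S', p S → p S' → p (S + S'))
    (hsmul : ∀ (c : ℂ) S, p S → p (c • S)) : p E := by
  obtain ⟨E, hE⟩ := E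
  obtain ⟨S, hS, D, hD, rfl⟩ := Submodule.mem_sup.1 hE
  have hSD : (⟨S + D, hE⟩ : instrl J) =
      ⟨S, (le_sup_left : _ ≤ instrl J) hS⟩ + ⟨D, inder_le hD⟩ := rfl
  rw [hSD]
  clear hSD hE
  refine hadd _ _ ?_ ?_
  · induction hS using Submodule.span_induction with
    | mem x h =>
      obtain ⟨a, rfl⟩ := h
      convert htri a 1 using 1
      apply Subtype.ext
      have : ⁅L a, L (1 : J)⁆ = 0 := by ext; simp [Ring.lie_def]
      simp [tri_coe, this]
    | zero => exact h0
    | add x y hx' hy' hx hy => exact hadd _ _ hx hy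
    | smul c x hx' hx => exact hsmul c _ hx
  · induction hD using Submodule.span_induction with
    | mem x h =>
      obtain ⟨a, b, rfl⟩ := h
      convert hadd _ _ (htri a b) (hsmul (-1) _ (htri (a * b) 1)) using 1
      apply Subtype.ext
      have : ⁅L (a * b), L (1 : J)⁆ = 0 := by ext; simp [Ring.lie_def]
      simp [tri_coe, this]
    | zero => exact h0
    | add x y hx' hy' hx hy => exact hadd _ _ hx hy
    | smul c x hx' hx => exact hsmul c _ hx

/-- `TKK(J)` is spanned by brackets of homogeneous elements. -/
theorem tkk_induction {p : TKK J → Prop} (u : TKK J)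
    (hlie : ∀ l m, ∀ u ∈ T.gr l, ∀ v ∈ T.gr m, p ⁅u, v⁆) (h0 : p 0)
    (hadd : ∀ u v, p u → p v → p (u + v)) (hsmul : ∀ (c : ℂ) u, p u → p (c • u)) : p u := by
  have hu : u = ⟨u.pos, 0, 0⟩ + ⟨0, u.op, 0⟩ + ⟨0, 0, u.neg⟩ := by
    ext1 <;> simp
  have hL : (⟨0, ⟨L 1, L_mem 1⟩, 0⟩ : TKK J) ∈ T.gr 0 :=
    ⟨zero_mem _, T.L_mem_opgr T.one_mem_jgr, zero_mem _⟩
  have hpos (l) {a : J} (ha : a ∈ T.jgr l) : (⟨a, 0, 0⟩ : TKK J) ∈ T.gr l :=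
    ⟨ha, zero_mem (T.opgr l), zero_mem _⟩
  have hneg (l) {a : J} (ha : a ∈ T.jgr l) : (⟨0, 0, a⟩ : TKK J) ∈ T.gr l :=
    ⟨zero_mem _, zero_mem (T.opgr l), ha⟩
  have hlie0 : ∀ S : Module.End ℂ J, ⁅(0 : Module.End ℂ J), S⁆ = 0 ∧ ⁅S, (0 : Module.End ℂ J)⁆ = 0 :=
    fun S => by simp [Ring.lie_def]
  rw [hu]
  refine hadd _ _ (hadd _ _ ?_ ?_) ?_
  · induction u.pos using T.induction_x with
    | hx l =>
      have := hlie 0 l _ hL _ (hpos l (T.x_mem l))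
      convert this using 1
      ext1
      · simp [TKK.lie_pos]
      · apply Subtype.ext
        simp [TKK.lie_op, tri_coe, instrlLie_coe, L_zero, hlie0]
      · simp [TKK.lie_neg, bar_coe]
    | h0 => exact h0
    | hadd a b ha hb => convert hadd _ _ ha hb using 1; ext1 <;> simp
    | hsmul c a ha => convert hsmul c _ ha using 1; ext1 <;> simp
  · have key (a b : J) : p ⟨0, tri a b, 0⟩ := by
      induction a using T.induction_x with
      | h0 => convert h0 using 1; ext1
              · rfl
              · apply Subtype.ext; simp [tri_coe, L_zero, hlie0]
              · rfl
      | hadd a b ha hb => convert hadd _ _ ha hb using 1; ext1 <;> simp [TKK.tri_add_left]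
      | hsmul c a ha => convert hsmul c _ ha using 1; ext1 <;> simp [TKK.tri_smul_left]
      | hx l =>
      induction b using T.induction_x with
      | h0 => convert h0 using 1; ext1
              · rfl
              · apply Subtype.ext; simp [tri_coe, L_zero, hlie0]
              · rfl
      | hadd a b ha hb => convert hadd _ _ ha hb using 1; ext1 <;> simp [TKK.tri_add_right]
      | hsmul c a ha => convert hsmul c _ ha using 1; ext1 <;> simp [TKK.tri_smul_right]
      | hx m =>
        have := hlie l m _ (hpos l (T.x_mem l)) _ (hneg m (T.x_mem m))
        convert this using 1
        ext1
        · simp [TKK.lie_pos]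
        · apply Subtype.ext
          simp [TKK.lie_op, tri_coe, instrlLie_coe, L_zero, hlie0]
        · simp [TKK.lie_neg, bar_coe, L_zero]
    induction u.op using tri_induction with
    | htri a b => exact key a b
    | h0 => exact h0
    | hadd a b ha hb => convert hadd _ _ ha hb using 1; ext1 <;> simp
    | hsmul c a ha => convert hsmul c _ ha using 1; ext1 <;> simp
  · induction u.neg using T.induction_x with
    | hx l =>
      have := hsmul (-1) _ (hlie 0 l _ hL _ (hneg l (T.x_mem l)))
      convert this using 1
      ext1
      · simp [TKK.lie_pos]
      · apply Subtype.ext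
        simp [TKK.lie_op, tri_coe, instrlLie_coe, L_zero, hlie0]
      · simp [TKK.lie_neg, bar_coe, two_smul]
    | h0 => exact h0
    | hadd a b ha hb => convert hadd _ _ ha hb using 1; ext1 <;> simp
    | hsmul c a ha => convert hsmul c _ ha using 1; ext1 <;> simp

theorem gr_induction {p : TKK J → Prop} (u : TKK J)
    (hgr : ∀ l, ∀ u ∈ T.gr l, p u) (h0 : p 0)
    (hadd : ∀ u v, p u → p v → p (u + v)) (hsmul : ∀ (c : ℂ) u, p u → p (c • u)) : p u :=
  T.tkk_induction u (fun _ _ _ hu _ hv => hgr _ _ (T.lie_mem_gr hu hv)) h0 hadd hsmul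

end Jordan

section Form

variable [IsCommJordan J]

theorem opForm_tri (E : instrl J) (a b : J) :
    T.opForm E (tri a b) = T.eps ((E : Module.End ℂ J) a * b) := by
  have h0 := inder_one (lie_L_mem_inder a b)
  have h1 : inderPart (tri a b) = ⟨⁅L a, L b⁆, lie_L_mem_inder a b⟩ := by
    apply Subtype.ext
    change (tri a b : Module.End ℂ J) - L ((tri a b : Module.End ℂ J) 1) = ⁅L a, L b⁆
    simp only [tri_coe, LinearMap.add_apply, h0, L_apply, mul_one, add_zero]
    abel
  rw [opForm_apply, h1, inderForm_lie]
  change _ + T.eps (((E : Module.End ℂ J) - L ((E : Module.End ℂ J) 1)) a * b) = _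
  simp only [tri_coe, LinearMap.add_apply, h0, L_apply, mul_one, add_zero, LinearMap.sub_apply,
    sub_mul, map_sub, T.eps_assoc]
  ring

theorem eps_op (E : instrl J) (a b : J) : T.eps ((E : Module.End ℂ J) a * b) =
    -T.eps (a * (bar E : Module.End ℂ J) b) := by
  obtain ⟨e, D, hD, hE, hb⟩ := exists_decomp E
  have h0 : T.eps (D (a * b)) = 0 := by
    clear hE hb
    induction hD using Submodule.span_induction with
    | mem x h =>
      obtain ⟨c, d, rfl⟩ := h
      have := T.eps_lie_swap c d (a * b) 1
      rw [mul_one] at this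
      rw [this]
      simp [Ring.lie_def]
    | zero => simp
    | add x y _ _ hx hy => simp [hx, hy]
    | smul k x _ hx => simp [hx]
  rw [inder_mul hD, map_add] at h0
  rw [hE, hb]
  simp only [LinearMap.add_apply, LinearMap.neg_apply, L_apply, add_mul, mul_add, map_add, mul_neg,
    map_neg, mul_comm e a, T.eps_assoc]
  linear_combination h0

theorem opForm_lie (S E F : instrl J) :
    T.opForm (instrlLie S E) F = T.opForm S (instrlLie E F) := by
  induction F using tri_induction with
  | htri a b =>
    rw [lie_tri, map_add, opForm_tri, opForm_tri, opForm_tri, instrlLie_coe]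
    have := T.eps_op E ((S : Module.End ℂ J) a) b
    simp only [Ring.lie_def, LinearMap.sub_apply, Module.End.mul_apply, sub_mul, map_sub]
    linear_combination -this
  | h0 =>
    have : instrlLie E 0 = 0 := by apply Subtype.ext; simp [instrlLie_coe, Ring.lie_def]
    rw [this]; simp
  | hadd a b ha hb => rw [TKK.instrlLie_add_right, map_add, map_add, ha, hb]
  | hsmul c a ha =>
    have : instrlLie E (c • a) = c • instrlLie E a := by
      apply Subtype.ext
      simp only [instrlLie_coe, Submodule.coe_smul, Ring.lie_def, smul_mul_assoc, mul_smul_comm,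
        smul_sub]
    rw [this, map_smul, map_smul, ha]

theorem form_lie (u v w : TKK J) : T.form ⁅u, v⁆ w = T.form u ⁅v, w⁆ := by
  have h1 := T.eps_op u.op v.pos w.neg
  have h2 := T.eps_op v.op u.pos w.neg
  have h3 := T.eps_op w.op u.pos v.neg
  have h4 := T.eps_op w.op v.pos u.neg
  have h5 := T.eps_op u.op w.pos v.neg
  have h6 := T.eps_op v.op w.pos u.neg
  have h7 := T.opForm_lie u.op v.op w.op
  simp only [form_apply, TKK.lie_pos, TKK.lie_op, TKK.lie_neg, map_add, map_sub, opForm_tri,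
    LinearMap.add_apply, LinearMap.sub_apply, T.opForm_comm (tri _ _) w.op, sub_mul, mul_sub]
  linear_combination h7 - h2 + h3 - h6 + h5

theorem form_gr {l m : Lat} (hlm : l + m ≠ 0) {u v : TKK J} (hu : u ∈ T.gr l) (hv : v ∈ T.gr m) :
    T.form u v = 0 := by
  have heps : ∀ {n : Lat} {a : J}, n ≠ 0 → a ∈ T.jgr n → T.eps a = 0 := by
    intro n a hn ha
    obtain ⟨c, rfl⟩ := Submodule.mem_span_singleton.1 ha
    simp [T.eps_x, hn]
  have hone : ∀ a : J, ⁅L a, L (1 : J)⁆ = 0 := by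
    intro a; ext; simp [Ring.lie_def]
  have hop : ∀ E F : instrl J, (E : Module.End ℂ J) ∈ T.opgr l → (F : Module.End ℂ J) ∈ T.opgr m →
      T.opForm E F = 0 := by
    rintro E ⟨F, hF'⟩ hE hF
    have h2 : ∀ hF' : F ∈ instrl J, T.opForm E ⟨F, hF'⟩ = 0 := by
      have htri : ∀ {p q : Lat} {a b : J}, a ∈ T.jgr p → b ∈ T.jgr q → p + q = m →
          T.opForm E (tri a b) = 0 := by
        intro p q a b ha hb hpq
        rw [opForm_tri]
        refine heps (n := l + p + q) ?_ (T.jgr_mul (T.opgr_apply hE ha) hb)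
        rwa [add_assoc, hpq]
      have hL : ∀ {a : J}, a ∈ T.jgr m → T.opForm E ⟨L a, L_mem a⟩ = 0 := by
        intro a ha
        rw [← htri ha T.one_mem_jgr (add_zero m)]
        congr 1
        apply Subtype.ext
        simp [tri_coe, hone]
      have hex : ∃ hF' : F ∈ instrl J, T.opForm E ⟨F, hF'⟩ = 0 := by
        refine T.opgr_induction (p := fun F => ∃ hF' : F ∈ instrl J, T.opForm E ⟨F, hF'⟩ = 0) hF
          ⟨L_mem _, hL (T.x_mem m)⟩ ?_ ⟨zero_mem _, ?_⟩ ?_ ?_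
        · intro p q hpq
          refine ⟨inder_le (lie_L_mem_inder _ _), ?_⟩
          have h1 := htri (T.x_mem p) (T.x_mem q) hpq
          have h2 := hL (a := T.x p * T.x q) (hpq ▸ T.jgr_mul (T.x_mem p) (T.x_mem q))
          have : tri (T.x p) (T.x q) = ⟨L (T.x p * T.x q), L_mem _⟩ +
              ⟨⁅L (T.x p), L (T.x q)⁆, inder_le (lie_L_mem_inder _ _)⟩ := rfl
          rwa [this, map_add, h2, zero_add] at h1
        · rw [show (⟨0, _⟩ : instrl J) = 0 from rfl]; simp
        · rintro S S' ⟨h1, h1'⟩ ⟨h2, h2'⟩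
          refine ⟨add_mem h1 h2, ?_⟩
          rw [show (⟨S + S', _⟩ : instrl J) = ⟨S, h1⟩ + ⟨S', h2⟩ from rfl, map_add, h1', h2',
            add_zero]
        · rintro c S ⟨h1, h1'⟩
          refine ⟨Submodule.smul_mem _ c h1, ?_⟩
          rw [show (⟨c • S, _⟩ : instrl J) = c • ⟨S, h1⟩ from rfl, map_smul, h1', smul_zero]
      exact fun _ => hex.2
    exact h2 hF'
  rw [form_apply, hop _ _ hu.2.1 hv.2.1, heps hlm (T.jgr_mul hu.1 hv.2.2),
    heps (n := m + l) (by rwa [add_comm]) (T.jgr_mul hv.1 hu.2.2)]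
  simp

end Form

section Derivations

variable [IsCommJordan J]

variable (J) in
/-- The centroid of `TKK(J)`. -/
def centroid : Submodule ℂ (Module.End ℂ (TKK J)) where
  carrier := {χ | ∀ u v, χ ⁅u, v⁆ = ⁅χ u, v⁆ ∧ χ ⁅u, v⁆ = ⁅u, χ v⁆}
  add_mem' h h' u v := by
    simp only [LinearMap.add_apply, add_lie, lie_add]
    exact ⟨by rw [(h u v).1, (h' u v).1], by rw [(h u v).2, (h' u v).2]⟩
  zero_mem' u v := by simp
  smul_mem' c _ h u v := by
    simp only [LinearMap.smul_apply, smul_lie, lie_smul]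
    exact ⟨by rw [(h u v).1], by rw [(h u v).2]⟩

/-- The endomorphisms of `TKK(J)` that are homogeneous of degree `m`. -/
def endgr (m : Lat) : Submodule ℂ (Module.End ℂ (TKK J)) where
  carrier := {χ | ∀ l, ∀ u ∈ T.gr l, χ u ∈ T.gr (l + m)}
  add_mem' h h' l u hu := add_mem (h l u hu) (h' l u hu)
  zero_mem' _ _ _ := zero_mem _
  smul_mem' c _ h l u hu := Submodule.smul_mem _ c (h l u hu)

/-- `δ` is the degree derivation `∂_θ`, which multiplies the elements of degree `l` by `θ l`. -/
def IsDegDer (θ : Lat →+ ℂ) (δ : Module.End ℂ (TKK J)) : Prop :=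
  ∀ l, ∀ u ∈ T.gr l, δ u = θ l • u

/-- The elements `χ ∂_θ` with `χ` in the centroid homogeneous of degree `m`. -/
def cderSet (m : Lat) : Set (Module.End ℂ (TKK J)) :=
  {d | ∃ χ δ, χ ∈ centroid J ∧ χ ∈ T.endgr m ∧ (∃ θ, T.IsDegDer θ δ) ∧ d = χ * δ}

/-- The centroidal derivations: the span of all `χ ∂_θ`, with `χ` a homogeneous element of the
centroid and `∂_θ` a degree derivation. -/
def cder : Submodule ℂ (Module.End ℂ (TKK J)) := Submodule.span ℂ (⋃ m, T.cderSet m)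

/-- The skew centroidal derivations. -/
def scder : Submodule ℂ (Module.End ℂ (TKK J)) where
  carrier := {d | d ∈ T.cder ∧ ∀ u, T.form (d u) u = 0}
  add_mem' h h' := ⟨add_mem h.1 h'.1, fun u => by
    rw [LinearMap.add_apply, map_add, LinearMap.add_apply, h.2, h'.2, add_zero]⟩
  zero_mem' := ⟨zero_mem _, fun u => by simp⟩
  smul_mem' c _ h := ⟨Submodule.smul_mem _ c h.1, fun u => by
    rw [LinearMap.smul_apply, map_smul, LinearMap.smul_apply, h.2, smul_zero]⟩

/-- The homogeneous space of degree `m` of the algebra of skew centroidal derivations. -/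
def scdergr (m : Lat) : Submodule ℂ T.scder := (T.endgr m).comap T.scder.subtype

variable {T}

theorem IsDegDer.lie {θ : Lat →+ ℂ} {δ : Module.End ℂ (TKK J)} (h : T.IsDegDer θ δ)
    (u v : TKK J) : δ ⁅u, v⁆ = ⁅δ u, v⁆ + ⁅u, δ v⁆ := by
  induction u using T.gr_induction with
  | h0 => simp
  | hadd a b ha hb => simp only [add_lie, map_add, ha, hb]; abel
  | hsmul c a ha => simp only [smul_lie, map_smul, ha, smul_add]
  | hgr l u hu =>
  induction v using T.gr_induction with
  | h0 => simp
  | hadd a b ha hb => simp only [lie_add, map_add, ha, hb]; abel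
  | hsmul c a ha => simp only [lie_smul, map_smul, ha, smul_add]
  | hgr m v hv =>
    rw [h _ _ hu, h _ _ hv, h _ _ (T.lie_mem_gr hu hv), map_add, add_smul, smul_lie, lie_smul]

theorem IsDegDer.comp_endgr {θ : Lat →+ ℂ} {δ χ : Module.End ℂ (TKK J)} (h : T.IsDegDer θ δ)
    {m : Lat} (hχ : χ ∈ T.endgr m) : δ * χ = χ * δ + θ m • χ := by
  ext1 u
  simp only [Module.End.mul_apply, LinearMap.add_apply, LinearMap.smul_apply]
  induction u using T.gr_induction with
  | h0 => simp
  | hadd a b ha hb => simp only [map_add, ha, hb, smul_add]; abel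
  | hsmul c a ha => simp only [map_smul, ha, smul_add, smul_comm c]
  | hgr l u hu =>
    rw [h _ _ hu, h _ _ (hχ _ _ hu), map_add, add_smul, map_smul]

theorem IsDegDer.comm {θ ψ : Lat →+ ℂ} {δ δ' : Module.End ℂ (TKK J)} (h : T.IsDegDer θ δ)
    (h' : T.IsDegDer ψ δ') : δ * δ' = δ' * δ := by
  ext1 u
  simp only [Module.End.mul_apply]
  induction u using T.gr_induction with
  | h0 => simp
  | hadd a b ha hb => simp only [map_add, ha, hb]
  | hsmul c a ha => simp only [map_smul, ha]
  | hgr l u hu =>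
    rw [h _ _ hu, h' _ _ hu, map_smul, map_smul, h _ _ hu, h' _ _ hu, smul_comm]

theorem centroid_comm (T : JordanTorus J) {χ χ' : Module.End ℂ (TKK J)} (h : χ ∈ centroid J) (h' : χ' ∈ centroid J) :
    χ * χ' = χ' * χ := by
  ext1 u
  simp only [Module.End.mul_apply]
  induction u using T.tkk_induction with
  | h0 => simp
  | hadd a b ha hb => simp only [map_add, ha, hb]
  | hsmul c a ha => simp only [map_smul, ha]
  | hlie l m u hu v hv =>
    rw [(h' u v).2, (h u _).1, (h u v).1, (h' _ v).2]

theorem centroid_mul {χ χ' : Module.End ℂ (TKK J)} (h : χ ∈ centroid J) (h' : χ' ∈ centroid J) :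
    χ * χ' ∈ centroid J := fun u v => by
  simp only [Module.End.mul_apply]
  exact ⟨by rw [(h' u v).1, (h _ v).1], by rw [(h' u v).2, (h u _).2]⟩

theorem endgr_mul {χ χ' : Module.End ℂ (TKK J)} {m n : Lat} (h : χ ∈ T.endgr m)
    (h' : χ' ∈ T.endgr n) : χ * χ' ∈ T.endgr (m + n) := fun l u hu => by
  rw [show l + (m + n) = l + n + m by abel]
  exact h _ _ (h' _ _ hu)

theorem endgr_lie {d d' : Module.End ℂ (TKK J)} {m n : Lat} (h : d ∈ T.endgr m)
    (h' : d' ∈ T.endgr n) : ⁅d, d'⁆ ∈ T.endgr (m + n) := by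
  rw [Ring.lie_def]
  refine sub_mem (endgr_mul h h') ?_
  rw [add_comm]; exact endgr_mul h' h

theorem cderSet_subset_endgr {m : Lat} {d : Module.End ℂ (TKK J)} (h : d ∈ T.cderSet m) :
    d ∈ T.endgr m := by
  obtain ⟨χ, δ, -, hχ, ⟨θ, hθ⟩, rfl⟩ := h
  intro l u hu
  rw [Module.End.mul_apply, hθ _ _ hu, map_smul]
  exact Submodule.smul_mem _ _ (hχ _ _ hu)

theorem cder_lie_deriv {d : Module.End ℂ (TKK J)} (hd : d ∈ T.cder) (u v : TKK J) :
    d ⁅u, v⁆ = ⁅d u, v⁆ + ⁅u, d v⁆ := by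
  induction hd using Submodule.span_induction with
  | mem x h =>
    obtain ⟨m, hm⟩ := Set.mem_iUnion.1 h
    obtain ⟨χ, δ, hc, -, ⟨θ, hθ⟩, rfl⟩ := hm
    simp only [Module.End.mul_apply]
    rw [hθ.lie, map_add, (hc _ v).1, (hc u _).2]
  | zero => simp
  | add x y _ _ hx hy => simp only [LinearMap.add_apply, hx, hy, add_lie, lie_add]; abel
  | smul c x _ hx => simp only [LinearMap.smul_apply, hx, smul_lie, lie_smul, smul_add]

theorem cder_lie_mem {d d' : Module.End ℂ (TKK J)} (hd : d ∈ T.cder) (hd' : d' ∈ T.cder) :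
    ⁅d, d'⁆ ∈ T.cder := by
  have hlin : ∀ {A B C : Module.End ℂ (TKK J)}, ⁅A, C⁆ ∈ T.cder → ⁅B, C⁆ ∈ T.cder →
      ⁅A + B, C⁆ ∈ T.cder := by
    intro A B C h h'
    have : ⁅A + B, C⁆ = ⁅A, C⁆ + ⁅B, C⁆ := by simp only [Ring.lie_def, add_mul, mul_add]; abel
    rw [this]; exact add_mem h h'
  have hsm : ∀ {A C : Module.End ℂ (TKK J)} (c : ℂ), ⁅A, C⁆ ∈ T.cder → ⁅c • A, C⁆ ∈ T.cder := by
    intro A C c h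
    have : ⁅c • A, C⁆ = c • ⁅A, C⁆ := by
      simp only [Ring.lie_def, smul_mul_assoc, mul_smul_comm, smul_sub]
    rw [this]; exact Submodule.smul_mem _ _ h
  have hsw : ∀ {A C : Module.End ℂ (TKK J)}, ⁅A, C⁆ ∈ T.cder → ⁅C, A⁆ ∈ T.cder := by
    intro A C h
    have : ⁅C, A⁆ = -⁅A, C⁆ := by simp only [Ring.lie_def]; abel
    rw [this]; exact neg_mem h
  induction hd using Submodule.span_induction with
  | zero => simp [Ring.lie_def]
  | add x y _ _ hx hy => exact hlin hx hy
  | smul c x _ hx => exact hsm c hx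
  | mem x h =>
  apply hsw
  induction hd' using Submodule.span_induction with
  | zero => simp [Ring.lie_def]
  | add x y _ _ hx hy => exact hlin hx hy
  | smul c x _ hx => exact hsm c hx
  | mem y h' =>
    obtain ⟨m, χ, δ, hc, hg, ⟨θ, hθ⟩, rfl⟩ := Set.mem_iUnion.1 h
    obtain ⟨n, χ', δ', hc', hg', ⟨ψ, hψ⟩, rfl⟩ := Set.mem_iUnion.1 h'
    refine Submodule.subset_span (Set.mem_iUnion.2 ⟨n + m, χ' * χ, ψ m • δ - θ n • δ',
      centroid_mul hc' hc, endgr_mul hg' hg, ⟨ψ m • θ - θ n • ψ, fun l u hu => ?_⟩, ?_⟩)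
    · simp [hθ _ _ hu, hψ _ _ hu, sub_smul, mul_smul]
    · have e1 := hψ.comp_endgr hg
      have e2 := hθ.comp_endgr hg'
      calc ⁅χ' * δ', χ * δ⁆ = χ' * (δ' * χ) * δ - χ * (δ * χ') * δ' := by
            rw [Ring.lie_def]; noncomm_ring
        _ = χ' * χ * (δ' * δ) + χ' * (ψ m • χ) * δ - (χ * χ' * (δ * δ') + χ * (θ n • χ') * δ') := by
            rw [e1, e2]; noncomm_ring
        _ = _ := by
            rw [centroid_comm T hc hc', hθ.comm hψ, mul_sub]
            simp only [mul_smul_comm, smul_mul_assoc, mul_assoc]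
            rw [← mul_assoc χ χ' δ', centroid_comm T hc hc', mul_assoc]
            abel

theorem scder_skew {d : Module.End ℂ (TKK J)} (hd : d ∈ T.scder) (u v : TKK J) :
    T.form (d u) v = -T.form u (d v) := by
  have h := hd.2 (u + v)
  simp only [map_add, LinearMap.add_apply, hd.2] at h
  rw [T.form_comm u (d v)]
  linear_combination h

theorem scder_lie_mem {d d' : Module.End ℂ (TKK J)} (hd : d ∈ T.scder) (hd' : d' ∈ T.scder) :
    ⁅d, d'⁆ ∈ T.scder := by
  refine ⟨cder_lie_mem hd.1 hd'.1, fun u => ?_⟩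
  simp only [Ring.lie_def, LinearMap.sub_apply, Module.End.mul_apply, map_sub]
  rw [scder_skew hd (d' u) u, scder_skew hd' (d u) u, T.form_comm (d' u) (d u)]
  ring

theorem mem_scder_of_skew {d : Module.End ℂ (TKK J)} (hd : d ∈ T.cder)
    (h : ∀ u v, T.form (d u) v + T.form u (d v) = 0) : d ∈ T.scder := by
  refine ⟨hd, fun u => ?_⟩
  have := h u u
  rw [T.form_comm u] at this
  linear_combination this / 2

variable (T) in
/-- The algebra of skew centroidal derivations is the sum of its homogeneous spaces. -/
theorem iSup_scdergr : ⨆ m, T.scdergr m = ⊤ := by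
  rw [eq_top_iff]
  rintro ⟨d, hd⟩ -
  have hdec : ∃ f : Lat →₀ Module.End ℂ (TKK J), (∀ m, f m ∈ T.cder ∧ f m ∈ T.endgr m) ∧
      f.sum (fun _ x => x) = d := by
    have h1 : d ∈ ⨆ m, (T.cder ⊓ T.endgr m) := by
      refine Submodule.span_le.2 ?_ hd.1
      intro x hx
      obtain ⟨m, hm⟩ := Set.mem_iUnion.1 hx
      exact Submodule.mem_iSup_of_mem m
        ⟨Submodule.subset_span (Set.mem_iUnion.2 ⟨m, hm⟩), cderSet_subset_endgr hm⟩
    obtain ⟨f, hf, hs⟩ := (Submodule.mem_iSup_iff_exists_finsupp _ _).1 h1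
    exact ⟨f, hf, hs⟩
  obtain ⟨f, hf, rfl⟩ := hdec
  have hskew : ∀ m, f m ∈ T.scder := by
    intro m
    refine mem_scder_of_skew (hf m).1 fun u v => ?_
    induction u using T.gr_induction with
    | h0 => simp
    | hadd a b ha hb =>
      simp only [map_add, LinearMap.add_apply]; linear_combination ha + hb
    | hsmul c a ha =>
      simp only [map_smul, LinearMap.smul_apply, smul_eq_mul]; linear_combination c * ha
    | hgr l u hu =>
    induction v using T.gr_induction with
    | h0 => simp
    | hadd a b ha hb =>
      simp only [map_add]; linear_combination ha + hb
    | hsmul c a ha =>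
      simp only [map_smul, smul_eq_mul]; linear_combination c * ha
    | hgr n v hv =>
      by_cases hm : l + m + n = 0
      · have h := scder_skew hd u v
        have e1 : T.form ((f.sum fun _ x => x) u) v = T.form (f m u) v := by
          simp only [Finsupp.sum, LinearMap.sum_apply, map_sum]
          refine Finset.sum_eq_single m (fun k _ hk => ?_) (fun h => ?_)
          · refine T.form_gr ?_ ((hf k).2 _ _ hu) hv
            intro h; apply hk
            have : l + k + n = l + m + n := by rw [h, hm]
            simpa using this
          · simp [Finsupp.notMem_support_iff.1 h]
        have e2 : T.form u ((f.sum fun _ x => x) v) = T.form u (f m v) := by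
          simp only [Finsupp.sum, LinearMap.sum_apply, map_sum]
          refine Finset.sum_eq_single m (fun k _ hk => ?_) (fun h => ?_)
          · refine T.form_gr ?_ hu ((hf k).2 _ _ hv)
            intro h; apply hk
            have : l + (n + k) = l + m + n := by rw [h, hm]
            rw [show l + (n + k) = l + k + n by abel] at this
            simpa using this
          · simp [Finsupp.notMem_support_iff.1 h]
        rw [e1, e2] at h
        rw [h]; ring
      · rw [T.form_gr hm ((hf m).2 _ _ hu) hv, T.form_gr ?_ hu ((hf m).2 _ _ hv), add_zero]
        rwa [show l + (n + m) = l + m + n by abel]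
  have : (⟨f.sum fun _ x => x, hd⟩ : T.scder) = ∑ m ∈ f.support, ⟨f m, hskew m⟩ := by
    apply Subtype.ext
    simp [Finsupp.sum]
  rw [this]
  exact sum_mem fun m _ => Submodule.mem_iSup_of_mem m (hf m).2

end Derivations

section Extension

variable [IsCommJordan J]

/-- The dual `(D^m)^*` of the homogeneous space of degree `m` of `D = SCDer`: the functionals on
`D` that vanish on all other homogeneous spaces. -/
def dualgr (m : Lat) : Submodule ℂ (Module.Dual ℂ T.scder) where
  carrier := {φ | ∀ n, n ≠ m → ∀ d ∈ T.scdergr n, φ d = 0}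
  add_mem' h h' n hn d hd := by rw [LinearMap.add_apply, h n hn d hd, h' n hn d hd, add_zero]
  zero_mem' _ _ _ _ := rfl
  smul_mem' c _ h n hn d hd := by rw [LinearMap.smul_apply, h n hn d hd, smul_zero]

/-- The graded dual of `D = SCDer`. -/
def grDual : Submodule ℂ (Module.Dual ℂ T.scder) := ⨆ m, T.dualgr m

/-- The commutator on `D = SCDer`. -/
def scderLie (d d' : T.scder) : T.scder :=
  ⟨⁅(d : Module.End ℂ (TKK J)), (d' : Module.End ℂ (TKK J))⁆, scder_lie_mem d.2 d'.2⟩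

theorem scderLie_coe (d d' : T.scder) : (T.scderLie d d' : Module.End ℂ (TKK J)) =
    ⁅(d : Module.End ℂ (TKK J)), (d' : Module.End ℂ (TKK J))⁆ := rfl

theorem scderLie_add_left (a b c : T.scder) :
    T.scderLie (a + b) c = T.scderLie a c + T.scderLie b c := by
  apply Subtype.ext
  simp only [scderLie_coe, Submodule.coe_add, Ring.lie_def, add_mul, mul_add]; abel

theorem scderLie_add_right (a b c : T.scder) :
    T.scderLie a (b + c) = T.scderLie a b + T.scderLie a c := by
  apply Subtype.ext
  simp only [scderLie_coe, Submodule.coe_add, Ring.lie_def, add_mul, mul_add]; abel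

theorem scderLie_smul_left (k : ℂ) (a b : T.scder) :
    T.scderLie (k • a) b = k • T.scderLie a b := by
  apply Subtype.ext
  simp only [scderLie_coe, Submodule.coe_smul, Ring.lie_def, smul_mul_assoc, mul_smul_comm, smul_sub]

theorem scderLie_smul_right (k : ℂ) (a b : T.scder) :
    T.scderLie a (k • b) = k • T.scderLie a b := by
  apply Subtype.ext
  simp only [scderLie_coe, Submodule.coe_smul, Ring.lie_def, smul_mul_assoc, mul_smul_comm, smul_sub]

theorem scderLie_self (a : T.scder) : T.scderLie a a = 0 := by
  apply Subtype.ext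
  simp [scderLie_coe, Ring.lie_def]

theorem scderLie_jacobi (a b c : T.scder) : T.scderLie a (T.scderLie b c) =
    T.scderLie (T.scderLie a b) c + T.scderLie b (T.scderLie a c) := by
  apply Subtype.ext
  simp only [scderLie_coe, Submodule.coe_add, Ring.lie_def]; noncomm_ring

/-- The action of `D` on functionals, `(d.φ)(d') = φ([d', d])`. -/
def coact (d : T.scder) (φ : Module.Dual ℂ T.scder) : Module.Dual ℂ T.scder where
  toFun d' := φ (T.scderLie d' d)
  map_add' a b := by rw [scderLie_add_left, map_add]
  map_smul' k a := by rw [scderLie_smul_left, map_smul]; rfl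

/-- The functional `c_D(u, v)(d) = (d u, v)`. -/
noncomputable def cocyc (u v : TKK J) : Module.Dual ℂ T.scder where
  toFun d := T.form ((d : Module.End ℂ (TKK J)) u) v
  map_add' a b := by simp
  map_smul' k a := by simp

theorem coact_apply (d d' : T.scder) (φ : Module.Dual ℂ T.scder) :
    T.coact d φ d' = φ (T.scderLie d' d) := rfl

theorem cocyc_apply (u v : TKK J) (d : T.scder) :
    T.cocyc u v d = T.form ((d : Module.End ℂ (TKK J)) u) v := rfl

theorem coact_mem (d : T.scder) {φ : Module.Dual ℂ T.scder} (hφ : φ ∈ T.grDual) :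
    T.coact d φ ∈ T.grDual := by
  have hd : d ∈ ⨆ m, T.scdergr m := by rw [T.iSup_scdergr]; trivial
  induction hd using Submodule.iSup_induction' with
  | zero =>
    have : T.coact 0 φ = 0 := by
      ext d'; rw [coact_apply, ← zero_smul ℂ (0 : T.scder), scderLie_smul_right]; simp
    rw [this]; exact zero_mem _
  | add x y _ _ hx hy =>
    have : T.coact (x + y) φ = T.coact x φ + T.coact y φ := by
      ext d'; simp only [coact_apply, scderLie_add_right, map_add, LinearMap.add_apply]
    rw [this]; exact add_mem hx hy
  | mem n d hn =>
  induction hφ using Submodule.iSup_induction' with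
  | zero =>
    have : T.coact d 0 = 0 := by ext d'; simp [coact_apply]
    rw [this]; exact zero_mem _
  | add x y _ _ hx hy =>
    have : T.coact d (x + y) = T.coact d x + T.coact d y := by
      ext d'; simp only [coact_apply, LinearMap.add_apply]
    rw [this]; exact add_mem hx hy
  | mem m φ hm =>
    refine Submodule.mem_iSup_of_mem (m - n) fun k hk d' hd' => ?_
    rw [coact_apply]
    refine hm (k + n) (fun h => hk (by rw [← h]; abel)) _ ?_
    exact endgr_lie (T := T) hd' hn

theorem cocyc_add_left (u u' v : TKK J) : T.cocyc (u + u') v = T.cocyc u v + T.cocyc u' v := by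
  ext d; simp [cocyc_apply]
theorem cocyc_add_right (u v v' : TKK J) : T.cocyc u (v + v') = T.cocyc u v + T.cocyc u v' := by
  ext d; simp [cocyc_apply]
theorem cocyc_smul_left (k : ℂ) (u v : TKK J) : T.cocyc (k • u) v = k • T.cocyc u v := by
  ext d; simp [cocyc_apply]
theorem cocyc_smul_right (k : ℂ) (u v : TKK J) : T.cocyc u (k • v) = k • T.cocyc u v := by
  ext d; simp [cocyc_apply]

theorem cocyc_mem (u v : TKK J) : T.cocyc u v ∈ T.grDual := by
  induction u using T.gr_induction with
  | h0 =>
    have : T.cocyc 0 v = 0 := by ext d; simp [cocyc_apply]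
    rw [this]; exact zero_mem _
  | hadd a b ha hb => rw [cocyc_add_left]; exact add_mem ha hb
  | hsmul c a ha => rw [cocyc_smul_left]; exact Submodule.smul_mem _ _ ha
  | hgr l u hu =>
  induction v using T.gr_induction with
  | h0 =>
    have : T.cocyc u 0 = 0 := by ext d; simp [cocyc_apply]
    rw [this]; exact zero_mem _
  | hadd a b ha hb => rw [cocyc_add_right]; exact add_mem ha hb
  | hsmul c a ha => rw [cocyc_smul_right]; exact Submodule.smul_mem _ _ ha
  | hgr m v hv =>
    refine Submodule.mem_iSup_of_mem (-(l + m)) fun n hn d hd => ?_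
    rw [cocyc_apply]
    refine T.form_gr (fun h => hn ?_) (hd l u hu) hv
    rw [eq_neg_iff_add_eq_zero, ← h]; abel

end Extension

end JordanTorus

/-- The space `E = TKK(J) ⊕ D^{gr*} ⊕ D` for `D = SCDer(TKK(J))`. -/
@[ext]
structure EALA {J : Type} [NonAssocCommRing J] [Module ℂ J] [IsScalarTower ℂ J J]
    [SMulCommClass ℂ J J] [IsCommJordan J] (T : JordanTorus J) where
  core : TKK J
  cent : T.grDual
  der : T.scder

namespace EALA

variable {J : Type} [NonAssocCommRing J] [Module ℂ J] [IsScalarTower ℂ J J] [SMulCommClass ℂ J J]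
  [IsCommJordan J] {T : JordanTorus J}

instance : Zero (EALA T) := ⟨⟨0, 0, 0⟩⟩
instance : Add (EALA T) := ⟨fun u v => ⟨u.core + v.core, u.cent + v.cent, u.der + v.der⟩⟩
instance : Neg (EALA T) := ⟨fun u => ⟨-u.core, -u.cent, -u.der⟩⟩
instance : SMul ℂ (EALA T) := ⟨fun c u => ⟨c • u.core, c • u.cent, c • u.der⟩⟩

@[simp] theorem zero_core : (0 : EALA T).core = 0 := rfl
@[simp] theorem zero_cent : (0 : EALA T).cent = 0 := rfl
@[simp] theorem zero_der : (0 : EALA T).der = 0 := rfl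
@[simp] theorem add_core (u v : EALA T) : (u + v).core = u.core + v.core := rfl
@[simp] theorem add_cent (u v : EALA T) : (u + v).cent = u.cent + v.cent := rfl
@[simp] theorem add_der (u v : EALA T) : (u + v).der = u.der + v.der := rfl
@[simp] theorem neg_core (u : EALA T) : (-u).core = -u.core := rfl
@[simp] theorem neg_cent (u : EALA T) : (-u).cent = -u.cent := rfl
@[simp] theorem neg_der (u : EALA T) : (-u).der = -u.der := rfl
@[simp] theorem smul_core (c : ℂ) (u : EALA T) : (c • u).core = c • u.core := rfl
@[simp] theorem smul_cent (c : ℂ) (u : EALA T) : (c • u).cent = c • u.cent := rfl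
@[simp] theorem smul_der (c : ℂ) (u : EALA T) : (c • u).der = c • u.der := rfl

instance : AddCommGroup (EALA T) where
  add_assoc _ _ _ := EALA.ext (add_assoc _ _ _) (add_assoc _ _ _) (add_assoc _ _ _)
  zero_add _ := EALA.ext (zero_add _) (zero_add _) (zero_add _)
  add_zero _ := EALA.ext (add_zero _) (add_zero _) (add_zero _)
  add_comm _ _ := EALA.ext (add_comm _ _) (add_comm _ _) (add_comm _ _)
  neg_add_cancel _ := EALA.ext (neg_add_cancel _) (neg_add_cancel _) (neg_add_cancel _)
  nsmul := nsmulRec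
  zsmul := zsmulRec

instance : Module ℂ (EALA T) where
  one_smul _ := EALA.ext (one_smul _ _) (one_smul _ _) (one_smul _ _)
  mul_smul _ _ _ := EALA.ext (mul_smul _ _ _) (mul_smul _ _ _) (mul_smul _ _ _)
  smul_zero _ := EALA.ext (smul_zero _) (smul_zero _) (smul_zero _)
  smul_add _ _ _ := EALA.ext (smul_add _ _ _) (smul_add _ _ _) (smul_add _ _ _)
  add_smul _ _ _ := EALA.ext (add_smul _ _ _) (add_smul _ _ _) (add_smul _ _ _)
  zero_smul _ := EALA.ext (zero_smul _ _) (zero_smul _ _) (zero_smul _ _)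

/-- The bracket of `E(TKK(J), D, κ)` for `κ = 0`. -/
noncomputable instance : Bracket (EALA T) (EALA T) where
  bracket u v :=
    { core := ⁅u.core, v.core⁆ + (u.der : Module.End ℂ (TKK J)) v.core
        - (v.der : Module.End ℂ (TKK J)) u.core
      cent := ⟨T.cocyc u.core v.core + T.coact u.der v.cent - T.coact v.der u.cent,
        sub_mem (add_mem (T.cocyc_mem _ _) (T.coact_mem _ v.cent.2)) (T.coact_mem _ u.cent.2)⟩
      der := T.scderLie u.der v.der }

theorem lie_core (u v : EALA T) : ⁅u, v⁆.core = ⁅u.core, v.core⁆ +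
    (u.der : Module.End ℂ (TKK J)) v.core - (v.der : Module.End ℂ (TKK J)) u.core := rfl
theorem lie_cent (u v : EALA T) (d : T.scder) : (⁅u, v⁆.cent : Module.Dual ℂ T.scder) d =
    T.form ((d : Module.End ℂ (TKK J)) u.core) v.core
      + (v.cent : Module.Dual ℂ T.scder) (T.scderLie d u.der)
      - (u.cent : Module.Dual ℂ T.scder) (T.scderLie d v.der) := rfl
theorem lie_der (u v : EALA T) : ⁅u, v⁆.der = T.scderLie u.der v.der := rfl

noncomputable instance : LieRing (EALA T) where
  add_lie u v w := by
    ext1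
    · simp only [lie_core, add_core, add_der, add_lie, Submodule.coe_add, LinearMap.add_apply,
        map_add]; abel
    · ext d
      simp only [lie_cent, add_core, add_cent, add_der, Submodule.coe_add, LinearMap.add_apply,
        map_add, T.scderLie_add_right]; ring
    · simp only [lie_der, add_der, T.scderLie_add_left]
  lie_add u v w := by
    ext1
    · simp only [lie_core, add_core, add_der, lie_add, Submodule.coe_add, LinearMap.add_apply,
        map_add]; abel
    · ext d
      simp only [lie_cent, add_core, add_cent, add_der, Submodule.coe_add, LinearMap.add_apply,
        map_add, T.scderLie_add_right]; ring
    · simp only [lie_der, add_der, T.scderLie_add_right]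
  lie_self u := by
    ext1
    · simp [lie_core]
    · ext d
      simp [lie_cent, d.2.2]
    · simp [lie_der, T.scderLie_self]
  leibniz_lie u v w := by
    have hder (d : T.scder) (a b : TKK J) := JordanTorus.cder_lie_deriv d.2.1 a b
    ext1
    · simp only [lie_core, lie_der, add_core, lie_add, add_lie, lie_sub, sub_lie, map_add, map_sub,
        hder, T.scderLie_coe, Ring.lie_def, LinearMap.sub_apply, Module.End.mul_apply]
      rw [leibniz_lie u.core v.core w.core,
        ← lie_skew v.core ((w.der : Module.End ℂ (TKK J)) u.core)]
      abel
    · ext d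
      have hj (a b : T.scder) : T.scderLie d (T.scderLie a b) =
          T.scderLie (T.scderLie d a) b - T.scderLie (T.scderLie d b) a := by
        apply Subtype.ext
        simp only [T.scderLie_coe, Submodule.coe_sub, Ring.lie_def]; noncomm_ring
      have hs (e : T.scder) (a b : TKK J) := JordanTorus.scder_skew e.2 a b
      have h1 := T.form_lie ((d : Module.End ℂ (TKK J)) u.core) v.core w.core
      have h2 := T.form_lie ((d : Module.End ℂ (TKK J)) v.core) u.core w.core
      rw [← lie_skew, map_neg, LinearMap.neg_apply] at h2
      have h3 := hs v.der ((d : Module.End ℂ (TKK J)) u.core) w.core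
      have h4 := hs w.der ((d : Module.End ℂ (TKK J)) u.core) v.core
      have h5 := hs u.der ((d : Module.End ℂ (TKK J)) v.core) w.core
      have h6 := hs d ((w.der : Module.End ℂ (TKK J)) u.core) v.core
      rw [T.form_comm ((w.der : Module.End ℂ (TKK J)) u.core)] at h6
      simp only [lie_cent, lie_core, lie_der, add_cent, Submodule.coe_add, LinearMap.add_apply, hj,
        map_add, map_sub, hder, T.scderLie_coe, Ring.lie_def, LinearMap.sub_apply,
        Module.End.mul_apply]
      linear_combination -h1 + h2 + h3 - h4 - h5 + h6
    · simp only [lie_der, add_der]; exact T.scderLie_jacobi _ _ _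

noncomputable instance : LieAlgebra ℂ (EALA T) where
  lie_smul k u v := by
    ext1
    · simp only [lie_core, smul_core, smul_der, Submodule.coe_smul, LinearMap.smul_apply, map_smul,
        lie_smul, smul_sub, smul_add]
    · ext d
      simp only [lie_cent, smul_core, smul_cent, smul_der, Submodule.coe_smul, LinearMap.smul_apply,
        map_smul, T.scderLie_smul_right, smul_eq_mul]
      ring
    · simp only [lie_der, smul_der, T.scderLie_smul_right]

end EALA

section Semilattices

/-- A semilattice in `Λ` that contains `0` and generates `Λ`. -/
structure Semilat where
  carrier : Set Lat
  zero_mem : (0 : Lat) ∈ carrier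
  add_two_mem : ∀ s ∈ carrier, ∀ l : Lat, s + 2 • l ∈ carrier
  gen : AddSubgroup.closure carrier = ⊤

/-- The coset `t + 2Λ`. -/
def coset (t : Lat) : Set Lat := {l | ∃ m : Lat, l = t + 2 • m}

/-- The degree `σ₁`. -/
def sig1 : Lat := (1, 0)

/-- The degree `σ₂`. -/
def sig2 : Lat := (0, 1)

theorem closure_eq_top_of_sig {S : Set Lat} (h1 : sig1 ∈ S) (h2 : sig2 ∈ S) :
    AddSubgroup.closure S = ⊤ := by
  rw [eq_top_iff]
  rintro ⟨a, b⟩ -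
  have : ((a, b) : Lat) = a • sig1 + b • sig2 := by simp [sig1, sig2]
  rw [this]
  exact add_mem (zsmul_mem (AddSubgroup.subset_closure h1) a)
    (zsmul_mem (AddSubgroup.subset_closure h2) b)

/-- The semilattice `S₀ ∪ S₁ ∪ S₂`, where `S₀ = 2Λ`, `S₁ = σ₁ + 2Λ`, `S₂ = σ₂ + 2Λ`. -/
def semilatThree : Semilat where
  carrier := coset 0 ∪ coset sig1 ∪ coset sig2
  zero_mem := Or.inl (Or.inl ⟨0, by simp⟩)
  add_two_mem := by
    rintro s ((⟨m, rfl⟩ | ⟨m, rfl⟩) | ⟨m, rfl⟩) l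
    · exact Or.inl (Or.inl ⟨m + l, by rw [smul_add, add_assoc]⟩)
    · exact Or.inl (Or.inr ⟨m + l, by rw [smul_add, add_assoc]⟩)
    · exact Or.inr ⟨m + l, by rw [smul_add, add_assoc]⟩
  gen := closure_eq_top_of_sig (Or.inl (Or.inr ⟨0, by simp⟩)) (Or.inr ⟨0, by simp⟩)

/-- The semilattice `Λ`. -/
def semilatFull : Semilat where
  carrier := Set.univ
  zero_mem := trivial
  add_two_mem := fun _ _ _ => trivial
  gen := closure_eq_top_of_sig trivial trivial

end Semilattices

section JS

/-- The coset of `2Λ` that contains a degree, as an element of `Λ / 2Λ`. -/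
def parity (l : Lat) : ZMod 2 × ZMod 2 := (l.1, l.2)

theorem parity_add (l m : Lat) : parity (l + m) = parity l + parity m := by
  simp [parity]

/-- The function `Γ` on pairs of cosets of `2Λ`: it is `1` if both are contained in `S₀ ∪ Sᵢ` for
some `i`, and `0` otherwise. -/
def gam (p q : ZMod 2 × ZMod 2) : ℤ := if p = 0 ∨ q = 0 ∨ p = q then 1 else 0

/-- The underlying space of the Jordan algebra `J_S` of a semilattice `S`: it has the basis
`x^s`, `s ∈ S`. -/
def JS (S : Semilat) : Type := S.carrier →₀ ℂ

namespace JS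

variable (S : Semilat)

noncomputable instance : AddCommGroup (JS S) := inferInstanceAs (AddCommGroup (S.carrier →₀ ℂ))
noncomputable instance : Module ℂ (JS S) := inferInstanceAs (Module ℂ (S.carrier →₀ ℂ))

open Classical in
/-- The basis element `x^l`, which is `0` for `l ∉ S`. -/
noncomputable def x (l : Lat) : JS S :=
  if h : l ∈ S.carrier then (Finsupp.single ⟨l, h⟩ 1 : S.carrier →₀ ℂ) else 0

/-- The product `x^s x^t = Γ(s, t) x^{s+t}` for `s, t ∈ S`. -/
noncomputable def mulLin : JS S →ₗ[ℂ] JS S →ₗ[ℂ] JS S :=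
  Finsupp.linearCombination ℂ fun s : S.carrier =>
    (Finsupp.linearCombination ℂ fun t : S.carrier =>
      (gam (parity s) (parity t) : ℂ) • x S (s + t) : JS S →ₗ[ℂ] JS S)

variable {S}

theorem x_of_mem {l : Lat} (h : l ∈ S.carrier) :
    x S l = (Finsupp.single ⟨l, h⟩ 1 : S.carrier →₀ ℂ) := dif_pos h

theorem x_of_not_mem {l : Lat} (h : l ∉ S.carrier) : x S l = 0 := dif_neg h

theorem x_ne_zero_iff {l : Lat} : x S l ≠ 0 ↔ l ∈ S.carrier := by
  constructor
  · intro h; by_contra h'; exact h (x_of_not_mem h')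
  · intro h h'
    rw [x_of_mem h] at h'
    exact one_ne_zero (Finsupp.single_eq_zero.1 h')

theorem induction {p : JS S → Prop} (a : JS S) (hx : ∀ l ∈ S.carrier, p (x S l)) (h0 : p 0)
    (hadd : ∀ a b, p a → p b → p (a + b)) (hsmul : ∀ (c : ℂ) a, p a → p (c • a)) : p a := by
  induction a using Finsupp.induction_linear with
  | zero => exact h0
  | add a b ha hb => exact hadd a b ha hb
  | single l c =>
    have : (Finsupp.single l c : S.carrier →₀ ℂ) = (c • x S l : JS S) := by
      rw [x_of_mem l.2]; exact (Finsupp.smul_single_one l c).symm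
    rw [this]; exact hsmul c _ (hx l l.2)

theorem mulLin_x {l m : Lat} (hl : l ∈ S.carrier) (hm : m ∈ S.carrier) :
    mulLin S (x S l) (x S m) = (gam (parity l) (parity m) : ℂ) • x S (l + m) := by
  rw [x_of_mem hl, x_of_mem hm]
  have h1 : mulLin S (Finsupp.single ⟨l, hl⟩ 1 : S.carrier →₀ ℂ) =
      (Finsupp.linearCombination ℂ fun t : S.carrier =>
      (gam (parity l) (parity t) : ℂ) • x S (l + t) : JS S →ₗ[ℂ] JS S) :=
    (Finsupp.linearCombination_single ℂ (1 : ℂ) (⟨l, hl⟩ : S.carrier)).trans (one_smul _ _)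
  rw [h1]
  exact (Finsupp.linearCombination_single ℂ (1 : ℂ) (⟨m, hm⟩ : S.carrier)).trans (one_smul _ _)

theorem gam_comm : ∀ p q, gam p q = gam q p := by decide

theorem mulLin_comm (a b : JS S) : mulLin S a b = mulLin S b a := by
  induction a using JS.induction with
  | h0 => simp
  | hadd a b ha hb => simp only [map_add, LinearMap.add_apply, ha, hb]
  | hsmul c a ha => simp only [map_smul, LinearMap.smul_apply, ha]
  | hx l hl =>
  induction b using JS.induction with
  | h0 => simp
  | hadd a b ha hb => simp only [map_add, LinearMap.add_apply, ha, hb]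
  | hsmul c a ha => simp only [map_smul, LinearMap.smul_apply, ha]
  | hx m hm => rw [mulLin_x hl hm, mulLin_x hm hl, gam_comm, add_comm]

theorem mulLin_one (a : JS S) : mulLin S (x S 0) a = a := by
  induction a using JS.induction with
  | h0 => simp
  | hadd a b ha hb => simp only [map_add, ha, hb]
  | hsmul c a ha => simp only [map_smul, ha]
  | hx l hl => rw [mulLin_x S.zero_mem hl]; simp [gam, parity]

noncomputable instance : NonAssocCommRing (JS S) :=
  { (inferInstance : AddCommGroup (JS S)) with
    mul := fun a b => mulLin S a b
    one := x S 0
    left_distrib := fun a b c => map_add (mulLin S a) b c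
    right_distrib := fun a b c => by
      change mulLin S (a + b) c = mulLin S a c + mulLin S b c
      rw [map_add, LinearMap.add_apply]
    zero_mul := fun a => by
      change mulLin S 0 a = 0
      rw [map_zero, LinearMap.zero_apply]
    mul_zero := fun a => map_zero (mulLin S a)
    one_mul := mulLin_one
    mul_one := fun a => (mulLin_comm a (x S 0)).trans (mulLin_one a)
    mul_comm := mulLin_comm }

theorem mul_eq (a b : JS S) : a * b = mulLin S a b := rfl

instance : IsScalarTower ℂ (JS S) (JS S) := ⟨fun c a b => by
  change mulLin S (c • a) b = c • mulLin S a b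
  rw [map_smul, LinearMap.smul_apply]⟩

instance : SMulCommClass ℂ (JS S) (JS S) := ⟨fun c a b => (map_smul (mulLin S a) c b).symm⟩

theorem add_mem {l m : Lat} (hl : l ∈ S.carrier) (hm : m ∈ S.carrier) :
    gam (parity l) (parity m) = 0 ∨ l + m ∈ S.carrier := by
  have key : ∀ k : Lat, parity k = 0 → ∃ n : Lat, k = 2 • n := by
    rintro ⟨k1, k2⟩ hk
    simp only [parity, Prod.mk_eq_zero, ZMod.intCast_zmod_eq_zero_iff_dvd] at hk
    obtain ⟨⟨a, ha⟩, ⟨b, hb⟩⟩ := hk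
    exact ⟨(a, b), by ext <;> simp_all⟩
  by_cases h : parity l = 0 ∨ parity m = 0 ∨ parity l = parity m
  · right
    rcases h with h | h | h
    · obtain ⟨n, rfl⟩ := key _ h
      rw [add_comm]; exact S.add_two_mem _ hm n
    · obtain ⟨n, rfl⟩ := key _ h
      exact S.add_two_mem _ hl n
    · have : parity (l + m) = 0 := by
        rw [parity_add, h]; exact CharTwo.add_self_eq_zero _
      obtain ⟨n, hn⟩ := key _ this
      rw [hn, ← zero_add (2 • n)]; exact S.add_two_mem _ S.zero_mem n
  · left; simp [gam, h]

theorem x_mul {l m : Lat} (hl : l ∈ S.carrier) (hm : m ∈ S.carrier) :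
    x S l * x S m = (gam (parity l) (parity m) : ℂ) • x S (l + m) := mulLin_x hl hm

theorem x_mul' {l m n : Lat} (hl : l ∈ S.carrier) (hm : m ∈ S.carrier) (hn : n ∈ S.carrier) :
    x S l * (x S m * x S n) = ((gam (parity m) (parity n) * gam (parity l)
      (parity m + parity n) : ℤ) : ℂ) • x S (l + (m + n)) := by
  rw [x_mul hm hn, mul_smul_comm]
  rcases add_mem hm hn with h | h
  · simp [h]
  · rw [x_mul hl h, smul_smul, parity_add]; push_cast; rfl

theorem x_mul4 {l m n k : Lat} (hl : l ∈ S.carrier) (hm : m ∈ S.carrier) (hn : n ∈ S.carrier)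
    (hk : k ∈ S.carrier) :
    x S l * x S m * (x S n * x S k) = ((gam (parity l) (parity m) * gam (parity n) (parity k) *
      gam (parity l + parity m) (parity n + parity k) : ℤ) : ℂ) • x S (l + m + n + k) := by
  rw [x_mul hl hm, x_mul hn hk, mul_smul_comm, smul_mul_assoc]
  rcases add_mem hl hm with h | h
  · simp [h]
  rcases add_mem hn hk with h' | h'
  · simp [h']
  · rw [x_mul h h', smul_smul, smul_smul, parity_add, parity_add, ← add_assoc]
    congr 1
    push_cast; ring

theorem x_mul4' {l m n k : Lat} (hl : l ∈ S.carrier) (hm : m ∈ S.carrier) (hn : n ∈ S.carrier)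
    (hk : k ∈ S.carrier) :
    x S l * (x S m * (x S n * x S k)) = ((gam (parity n) (parity k) *
      gam (parity m) (parity n + parity k) *
      gam (parity l) (parity m + (parity n + parity k)) : ℤ) : ℂ) • x S (l + m + n + k) := by
  rw [x_mul' hm hn hk, mul_smul_comm]
  rcases add_mem hn hk with h | h
  · simp [h]
  rcases add_mem hm h with h' | h'
  · rw [parity_add] at h'; simp [h']
  · rw [x_mul hl h', smul_smul, parity_add, parity_add]
    simp only [← add_assoc]
    congr 1
    push_cast; ring

theorem gam_jordan : ∀ a b c d : ZMod 2 × ZMod 2,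
    (gam a d * gam b c * gam (a + d) (b + c) - gam b c * gam d (b + c) * gam a (d + (b + c)))
    + (gam b d * gam c a * gam (b + d) (c + a) - gam c a * gam d (c + a) * gam b (d + (c + a)))
    + (gam c d * gam a b * gam (c + d) (a + b) - gam a b * gam d (a + b) * gam c (d + (a + b)))
    = 0 := by decide

theorem jordan_aux (a b c d : JS S) :
    (a * d * (b * c) - a * (d * (b * c))) + (b * d * (c * a) - b * (d * (c * a)))
      + (c * d * (a * b) - c * (d * (a * b))) = 0 := by
  induction a using JS.induction with
  | h0 => simp
  | hadd p q hp hq =>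
    rw [← add_zero (0 : JS S)]; nth_rw 1 [← hp]; rw [← hq]
    simp only [add_mul, mul_add]; abel
  | hsmul k p hp =>
    rw [← smul_zero k, ← hp]
    simp only [smul_mul_assoc, mul_smul_comm, smul_add, smul_sub]
  | hx l hl =>
  induction b using JS.induction with
  | h0 => simp
  | hadd p q hp hq =>
    rw [← add_zero (0 : JS S)]; nth_rw 1 [← hp]; rw [← hq]
    simp only [add_mul, mul_add]; abel
  | hsmul k p hp =>
    rw [← smul_zero k, ← hp]
    simp only [smul_mul_assoc, mul_smul_comm, smul_add, smul_sub]
  | hx m hm =>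
  induction c using JS.induction with
  | h0 => simp
  | hadd p q hp hq =>
    rw [← add_zero (0 : JS S)]; nth_rw 1 [← hp]; rw [← hq]
    simp only [add_mul, mul_add]; abel
  | hsmul k p hp =>
    rw [← smul_zero k, ← hp]
    simp only [smul_mul_assoc, mul_smul_comm, smul_add, smul_sub]
  | hx n hn =>
  induction d using JS.induction with
  | h0 => simp
  | hadd p q hp hq =>
    rw [← add_zero (0 : JS S)]; nth_rw 1 [← hp]; rw [← hq]
    simp only [add_mul, mul_add]; abel
  | hsmul k p hp =>
    rw [← smul_zero k, ← hp]
    simp only [smul_mul_assoc, mul_smul_comm, smul_add, smul_sub]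
  | hx k hk =>
    have h := gam_jordan (parity l) (parity m) (parity n) (parity k)
    rw [x_mul4 hl hk hm hn, x_mul4' hl hk hm hn, x_mul4 hm hk hn hl, x_mul4' hm hk hn hl,
      x_mul4 hn hk hl hm, x_mul4' hn hk hl hm, show m + k + n + l = l + k + m + n by abel,
      show n + k + l + m = l + k + m + n by abel, ← sub_smul, ← sub_smul, ← sub_smul, ← add_smul,
      ← add_smul]
    have h' := congrArg (fun z : ℤ => (z : ℂ)) h
    push_cast at h' ⊢
    rw [h', zero_smul]

instance : IsCommJordan (JS S) where
  lmul_comm_rmul_rmul a b := by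
    have h := jordan_aux a a a b
    have h3 : (3 : ℂ) • (a * b * (a * a) - a * (b * (a * a))) = 0 := by
      rw [← h]; module
    exact sub_eq_zero.1 ((smul_eq_zero.1 h3).resolve_left (by norm_num))

/-- The functional `eps` on `J_S`. -/
noncomputable def eps : JS S →ₗ[ℂ] ℂ :=
  Finsupp.lapply (⟨0, S.zero_mem⟩ : S.carrier)

theorem eps_x (l : Lat) : eps (x S l) = if l = 0 then 1 else 0 := by
  by_cases h : l ∈ S.carrier
  · rw [x_of_mem h]
    by_cases h0 : l = 0
    · subst h0; simp only [if_true]; exact Finsupp.single_eq_same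
    · rw [if_neg h0]
      exact Finsupp.single_eq_of_ne (fun h' => h0 (congrArg Subtype.val h').symm)
  · rw [x_of_not_mem h, map_zero, if_neg]
    rintro rfl; exact h S.zero_mem

theorem gam_assoc : ∀ l m n : ZMod 2 × ZMod 2, l + (m + n) = 0 →
    gam l m * gam n (l + m) = gam m n * gam l (m + n) := by decide

variable (S) in
/-- `J_S` as a Jordan torus. -/
noncomputable def torus : JordanTorus (JS S) where
  x := x S
  linInd := by
    have h : LinearIndependent ℂ (fun l : S.carrier => (Finsupp.single l 1 : S.carrier →₀ ℂ)) :=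
      Finsupp.linearIndependent_single_one ℂ _
    have h2 := h.comp (fun l : {l : Lat // x S l ≠ 0} => (⟨l, x_ne_zero_iff.1 l.2⟩ : S.carrier))
      (fun a b hab => Subtype.ext (congrArg (fun s : S.carrier => (s : Lat)) hab))
    have e : (fun l : {l : Lat // x S l ≠ 0} => x S (l : Lat)) =
        fun (l : {l : Lat // x S l ≠ 0}) =>
          (Finsupp.single ⟨(l : Lat), x_ne_zero_iff.1 l.2⟩ 1 : S.carrier →₀ ℂ) :=
      funext fun l => x_of_mem _
    rw [e]
    exact h2
  span_x := by
    rw [eq_top_iff]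
    rintro a -
    induction a using JS.induction with
    | hx l _ => exact Submodule.subset_span ⟨l, rfl⟩
    | h0 => exact zero_mem _
    | hadd a b ha hb => exact Submodule.add_mem _ ha hb
    | hsmul c a ha => exact Submodule.smul_mem _ c ha
  x_zero := rfl
  x_mul l m := by
    by_cases hl : l ∈ S.carrier
    · by_cases hm : m ∈ S.carrier
      · rw [x_mul hl hm]; exact Submodule.smul_mem _ _ (Submodule.subset_span rfl)
      · rw [x_of_not_mem hm, mul_zero]; exact zero_mem _
    · rw [x_of_not_mem hl, zero_mul]; exact zero_mem _
  gen := by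
    have : {l | x S l ≠ 0} = S.carrier := by ext l; exact x_ne_zero_iff
    rw [this, S.gen]
  eps := eps
  eps_x := eps_x
  eps_assoc_x l m n := by
    by_cases hl : l ∈ S.carrier
    swap; · rw [x_of_not_mem hl]; simp
    by_cases hm : m ∈ S.carrier
    swap; · rw [x_of_not_mem hm]; simp
    by_cases hn : n ∈ S.carrier
    swap; · rw [x_of_not_mem hn]; simp
    rw [mul_comm (x S l * x S m), x_mul' hn hl hm, x_mul' hl hm hn, map_smul, map_smul, eps_x, eps_x,
      show n + (l + m) = l + (m + n) by abel]
    by_cases h0 : l + (m + n) = 0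
    · have := gam_assoc (parity l) (parity m) (parity n) (by
        rw [← parity_add, ← parity_add, h0]; rfl)
      rw [this]
    · simp [h0]

end JS

end JS

section QuantumTorus

/-- The underlying space of the quantum torus `K_e` of the elementary quantum matrix with
off-diagonal entries `e = ±1`: it has the basis `x^l = x₁^{l₁} x₂^{l₂}`, `l ∈ Λ`. -/
def QTorus (_e : ℤˣ) : Type := Lat →₀ ℂ

/-- The structure constants of `K_e`: `x^l x^m = η(l, m) x^{l+m}`, as `x₂ x₁ = e x₁ x₂`. -/
def eta (e : ℤˣ) (l m : Lat) : ℤ := (e ^ (l.2 * m.1) : ℤˣ)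

theorem eta_add_left (e : ℤˣ) (l l' m : Lat) : eta e (l + l') m = eta e l m * eta e l' m := by
  simp only [eta, Prod.snd_add, add_mul, zpow_add, Units.val_mul]

theorem eta_add_right (e : ℤˣ) (l m m' : Lat) : eta e l (m + m') = eta e l m * eta e l m' := by
  simp only [eta, Prod.fst_add, mul_add, zpow_add, Units.val_mul]

namespace QTorus

variable {e : ℤˣ}

noncomputable instance : AddCommGroup (QTorus e) := inferInstanceAs (AddCommGroup (Lat →₀ ℂ))
noncomputable instance : Module ℂ (QTorus e) := inferInstanceAs (Module ℂ (Lat →₀ ℂ))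

variable (e) in
/-- The basis element `x^l`. -/
noncomputable def x (l : Lat) : QTorus e := (Finsupp.single l 1 : Lat →₀ ℂ)

variable (e) in
/-- The linear map on `K_e` with prescribed values on the basis. -/
noncomputable def lin {M : Type} [AddCommGroup M] [Module ℂ M] (f : Lat → M) : QTorus e →ₗ[ℂ] M :=
  Finsupp.linearCombination ℂ f

theorem lin_x {M : Type} [AddCommGroup M] [Module ℂ M] (f : Lat → M) (l : Lat) :
    lin e f (x e l) = f l :=
  (Finsupp.linearCombination_single ℂ (1 : ℂ) l).trans (one_smul _ _)

theorem induction {p : QTorus e → Prop} (a : QTorus e) (hx : ∀ l, p (x e l)) (h0 : p 0)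
    (hadd : ∀ a b, p a → p b → p (a + b)) (hsmul : ∀ (c : ℂ) a, p a → p (c • a)) : p a := by
  induction a using Finsupp.induction_linear with
  | zero => exact h0
  | add a b ha hb => exact hadd a b ha hb
  | single l c =>
    have : (Finsupp.single l c : Lat →₀ ℂ) = (c • x e l : QTorus e) :=
      (Finsupp.smul_single_one l c).symm
    rw [this]; exact hsmul c _ (hx l)

variable (e) in
/-- The product of `K_e`. -/
noncomputable def mulLin : QTorus e →ₗ[ℂ] QTorus e →ₗ[ℂ] QTorus e :=
  lin e fun l => lin e fun m => (eta e l m : ℂ) • x e (l + m)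

theorem mulLin_x (l m : Lat) : mulLin e (x e l) (x e m) = (eta e l m : ℂ) • x e (l + m) := by
  rw [mulLin, lin_x, lin_x]

theorem mulLin_assoc (a b c : QTorus e) :
    mulLin e (mulLin e a b) c = mulLin e a (mulLin e b c) := by
  induction a using QTorus.induction with
  | h0 => simp
  | hadd a a' h h' => simp only [map_add, LinearMap.add_apply, h, h']
  | hsmul k a h => simp only [map_smul, LinearMap.smul_apply, h]
  | hx l =>
  induction b using QTorus.induction with
  | h0 => simp
  | hadd a a' h h' => simp only [map_add, LinearMap.add_apply, h, h']
  | hsmul k a h => simp only [map_smul, LinearMap.smul_apply, h]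
  | hx m =>
  induction c using QTorus.induction with
  | h0 => simp
  | hadd a a' h h' => simp only [map_add, h, h']
  | hsmul k a h => simp only [map_smul, h]
  | hx n =>
    simp only [mulLin_x, map_smul, LinearMap.smul_apply, smul_smul, eta_add_left, eta_add_right,
      add_assoc]
    congr 1
    push_cast; ring

theorem one_mulLin (a : QTorus e) : mulLin e (x e 0) a = a := by
  induction a using QTorus.induction with
  | h0 => simp
  | hadd a a' h h' => simp only [map_add, h, h']
  | hsmul k a h => simp only [map_smul, h]
  | hx l => rw [mulLin_x]; simp [eta]

theorem mulLin_one (a : QTorus e) : mulLin e a (x e 0) = a := by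
  induction a using QTorus.induction with
  | h0 => simp
  | hadd a a' h h' => simp only [map_add, LinearMap.add_apply, h, h']
  | hsmul k a h => simp only [map_smul, LinearMap.smul_apply, h]
  | hx l => rw [mulLin_x]; simp [eta]

noncomputable instance : Ring (QTorus e) :=
  { (inferInstance : AddCommGroup (QTorus e)) with
    mul := fun a b => mulLin e a b
    one := x e 0
    left_distrib := fun a b c => map_add (mulLin e a) b c
    right_distrib := fun a b c => by
      change mulLin e (a + b) c = mulLin e a c + mulLin e b c
      rw [map_add, LinearMap.add_apply]
    zero_mul := fun a => by
      change mulLin e 0 a = 0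
      rw [map_zero, LinearMap.zero_apply]
    mul_zero := fun a => map_zero (mulLin e a)
    one_mul := one_mulLin
    mul_one := mulLin_one
    mul_assoc := mulLin_assoc }

noncomputable instance : Algebra ℂ (QTorus e) := Algebra.ofModule
  (fun c a b => by
    change mulLin e (c • a) b = c • mulLin e a b
    rw [map_smul, LinearMap.smul_apply])
  (fun c a b => map_smul (mulLin e a) c b)

theorem x_mul (l m : Lat) : x e l * x e m = (eta e l m : ℂ) • x e (l + m) := mulLin_x l m

noncomputable instance : Invertible (2 : QTorus e) where
  invOf := algebraMap ℂ _ (1 / 2)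
  invOf_mul_self := by
    rw [← map_ofNat (algebraMap ℂ (QTorus e)) 2, ← map_mul]; norm_num
  mul_invOf_self := by
    rw [← map_ofNat (algebraMap ℂ (QTorus e)) 2, ← map_mul]; norm_num

variable (e) in
/-- The coefficient of `x^0`. -/
noncomputable def tr : QTorus e →ₗ[ℂ] ℂ := lin e fun l => if l = 0 then 1 else 0

theorem tr_mul_comm (a b : QTorus e) : tr e (a * b) = tr e (b * a) := by
  induction a using QTorus.induction with
  | h0 => simp
  | hadd a a' h h' => simp only [add_mul, mul_add, map_add, h, h']
  | hsmul k a h => simp only [smul_mul_assoc, mul_smul_comm, map_smul, h]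
  | hx l =>
  induction b using QTorus.induction with
  | h0 => simp
  | hadd a a' h h' => simp only [add_mul, mul_add, map_add, h, h']
  | hsmul k a h => simp only [smul_mul_assoc, mul_smul_comm, map_smul, h]
  | hx m =>
    rw [x_mul, x_mul, map_smul, map_smul, tr, lin_x, lin_x, add_comm m l]
    by_cases h : l + m = 0
    · obtain rfl : m = -l := by rw [eq_neg_iff_add_eq_zero, add_comm, h]
      simp only [eta, Prod.fst_neg, Prod.snd_neg, mul_neg, neg_mul]
    · simp [h]

variable (e) in
/-- The involution of `K_e` with `x₁ ↦ x₁`, `x₂ ↦ x₂`: it maps `x^l = x₁^{l₁} x₂^{l₂}` to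
`x₂^{l₂} x₁^{l₁} = e^{l₁ l₂} x^l`. -/
noncomputable def inv : QTorus e →ₗ[ℂ] QTorus e := lin e fun l => (eta e l l : ℂ) • x e l

theorem inv_x (l : Lat) : inv e (x e l) = (eta e l l : ℂ) • x e l := lin_x _ _

theorem eta_sq (l m : Lat) : eta e l m * eta e l m = 1 := by
  simp only [eta, ← Units.val_mul, ← mul_zpow, Int.units_mul_self, one_zpow, Units.val_one]

theorem inv_mul (a b : QTorus e) : inv e (a * b) = inv e b * inv e a := by
  induction a using QTorus.induction with
  | h0 => simp
  | hadd a a' h h' => simp only [add_mul, mul_add, map_add, h, h']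
  | hsmul k a h => simp only [smul_mul_assoc, mul_smul_comm, map_smul, h]
  | hx l =>
  induction b using QTorus.induction with
  | h0 => simp
  | hadd a a' h h' => simp only [add_mul, mul_add, map_add, h, h']
  | hsmul k a h => simp only [smul_mul_assoc, mul_smul_comm, map_smul, h]
  | hx m =>
    simp only [x_mul, map_smul, inv_x, smul_mul_assoc, mul_smul_comm, smul_smul, eta_add_left,
      eta_add_right, add_comm m l]
    congr 1
    have := eta_sq (e := e) l m
    have h : ((eta e l m : ℂ)) * eta e l m = 1 := by exact_mod_cast this
    push_cast
    linear_combination (eta e l l * eta e m m * eta e m l : ℂ) * h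

/-- The involution of `K_e` is anti-multiplicative, fixes the generators and has order two. -/
theorem inv_spec : inv e (x e (1, 0)) = x e (1, 0) ∧ inv e (x e (0, 1)) = x e (0, 1) ∧
    ∀ a, inv e (inv e a) = a := by
  refine ⟨by rw [inv_x]; simp [eta], by rw [inv_x]; simp [eta], fun a => ?_⟩
  induction a using QTorus.induction with
  | h0 => simp
  | hadd a a' h h' => simp only [map_add, h, h']
  | hsmul k a h => simp only [map_smul, h]
  | hx l =>
    have h : ((eta e l l : ℂ)) * eta e l l = 1 := by exact_mod_cast eta_sq (e := e) l l
    rw [inv_x, map_smul, inv_x, smul_smul, h, one_smul]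

end QTorus

open SymAlg

/-- The plus algebra `K_e^+`, with product `a · b = (ab + ba) / 2`. -/
abbrev KPlus (e : ℤˣ) : Type := (QTorus e)ˢʸᵐ

namespace KPlus

variable {e : ℤˣ}

noncomputable instance : NonAssocCommRing (KPlus e) :=
  { (inferInstance : NonAssocRing (KPlus e)) with mul_comm := SymAlg.mul_comm }

instance : IsCommJordan (KPlus e) where
  lmul_comm_rmul_rmul a b := IsCommJordan.lmul_comm_rmul_rmul (A := (QTorus e)ˢʸᵐ) a b

theorem unsym_mul' (a b : KPlus e) :
    unsym (a * b) = (1 / 2 : ℂ) • (unsym a * unsym b + unsym b * unsym a) := by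
  rw [Algebra.smul_def]; rfl

instance : IsScalarTower ℂ (KPlus e) (KPlus e) := ⟨fun c a b => by
  apply unsym_injective
  simp only [smul_eq_mul, unsym_mul', unsym_smul, smul_mul_assoc, mul_smul_comm, ← smul_add]
  rw [smul_comm]⟩

instance : SMulCommClass ℂ (KPlus e) (KPlus e) := ⟨fun c a b => by
  apply unsym_injective
  simp only [smul_eq_mul, unsym_mul', unsym_smul, smul_mul_assoc, mul_smul_comm, ← smul_add]
  rw [smul_comm]⟩

variable (e) in
/-- The basis element `x^l`. -/
noncomputable def x (l : Lat) : KPlus e := sym (QTorus.x e l)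

theorem x_mul (l m : Lat) : x e l * x e m =
    ((1 / 2 : ℂ) * (eta e l m + eta e m l)) • x e (l + m) := by
  apply unsym_injective
  rw [unsym_mul', unsym_smul]
  simp only [x, unsym_sym, QTorus.x_mul, add_comm m l, ← add_smul, smul_smul]

variable (e) in
/-- The functional `eps` on `K_e^+`. -/
noncomputable def eps : KPlus e →ₗ[ℂ] ℂ where
  toFun a := QTorus.tr e (unsym a)
  map_add' a b := map_add (QTorus.tr e) (unsym a) (unsym b)
  map_smul' c a := map_smul (QTorus.tr e) c (unsym a)

theorem eps_assoc (a b c : KPlus e) : eps e (a * b * c) = eps e (a * (b * c)) := by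
  change QTorus.tr e (unsym (a * b * c)) = QTorus.tr e (unsym (a * (b * c)))
  simp only [unsym_mul', smul_mul_assoc, mul_smul_comm, add_mul, mul_add, map_add, map_smul]
  have h1 := QTorus.tr_mul_comm (unsym c) (unsym a * unsym b)
  have h2 := QTorus.tr_mul_comm (unsym c) (unsym b * unsym a)
  have h3 := QTorus.tr_mul_comm (unsym b * unsym c) (unsym a)
  have h4 := QTorus.tr_mul_comm (unsym c * unsym b) (unsym a)
  simp only [mul_assoc, smul_eq_mul] at *
  linear_combination (1 / 4 : ℂ) * (h1 - h2 - h3 + h4)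

theorem induction {p : KPlus e → Prop} (a : KPlus e) (hx : ∀ l, p (x e l)) (h0 : p 0)
    (hadd : ∀ a b, p a → p b → p (a + b)) (hsmul : ∀ (c : ℂ) a, p a → p (c • a)) : p a :=
  QTorus.induction (p := fun a => p (sym a)) (unsym a) hx h0 (fun a b => hadd (sym a) (sym b))
    (fun c a => hsmul c (sym a))

theorem x_ne_zero (l : Lat) : x e l ≠ 0 := fun h =>
  one_ne_zero (α := ℂ) (Finsupp.single_eq_zero.1 (h : (Finsupp.single l 1 : Lat →₀ ℂ) = 0))

theorem linearIndependent_x : LinearIndependent ℂ (x e) :=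
  (Finsupp.linearIndependent_single_one ℂ Lat :)

variable (e) in
/-- `K_e^+` as a Jordan torus. -/
noncomputable def torus : JordanTorus (KPlus e) where
  x := x e
  linInd := linearIndependent_x.comp _ Subtype.val_injective
  span_x := by
    rw [eq_top_iff]
    rintro a -
    induction a using KPlus.induction with
    | hx l => exact Submodule.subset_span ⟨l, rfl⟩
    | h0 => exact zero_mem _
    | hadd a b ha hb => exact Submodule.add_mem _ ha hb
    | hsmul c a ha => exact Submodule.smul_mem _ c ha
  x_zero := rfl
  x_mul l m := by rw [x_mul]; exact Submodule.smul_mem _ _ (Submodule.subset_span rfl)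
  gen := closure_eq_top_of_sig (x_ne_zero _) (x_ne_zero _)
  eps := eps e
  eps_x l := QTorus.lin_x _ l
  eps_assoc_x l m n := eps_assoc _ _ _

end KPlus

/-- The Jordan algebra `H(K_e, -)` of the elements of `K_e^+` that are fixed by the involution. -/
noncomputable def Herm (e : ℤˣ) : NonUnitalSubalgebra ℂ (KPlus e) where
  carrier := {a | QTorus.inv e (unsym a) = unsym a}
  add_mem' {a b} ha hb := by
    change QTorus.inv e (unsym a + unsym b) = unsym a + unsym b
    rw [map_add, ha, hb]
  zero_mem' := map_zero (QTorus.inv e)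
  mul_mem' {a b} ha hb := by
    change QTorus.inv e (unsym (a * b)) = unsym (a * b)
    rw [KPlus.unsym_mul', map_smul, map_add, QTorus.inv_mul, QTorus.inv_mul, ha, hb, add_comm]
  smul_mem' c a ha := by
    change QTorus.inv e (c • unsym a) = c • unsym a
    rw [map_smul, ha]

namespace Herm

variable {e : ℤˣ}

theorem mem_iff (a : KPlus e) : a ∈ Herm e ↔ QTorus.inv e (unsym a) = unsym a := Iff.rfl

theorem one_mem : (1 : KPlus e) ∈ Herm e := by
  rw [mem_iff]
  change QTorus.inv e (QTorus.x e 0) = QTorus.x e 0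
  rw [QTorus.inv_x]; simp [eta]

noncomputable instance : One (Herm e) := ⟨⟨1, one_mem⟩⟩

noncomputable instance : NonAssocCommRing (Herm e) :=
  { (inferInstance : AddCommGroup (Herm e)) with
    mul := fun a b => a * b
    one := 1
    left_distrib := fun a b c => Subtype.ext (mul_add (a : KPlus e) b c)
    right_distrib := fun a b c => Subtype.ext (add_mul (a : KPlus e) b c)
    zero_mul := fun a => Subtype.ext (zero_mul (a : KPlus e))
    mul_zero := fun a => Subtype.ext (mul_zero (a : KPlus e))
    one_mul := fun a => Subtype.ext (one_mul (a : KPlus e))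
    mul_one := fun a => Subtype.ext (mul_one (a : KPlus e))
    mul_comm := fun a b => Subtype.ext (SymAlg.mul_comm (a : KPlus e) (b : KPlus e)) }

theorem coe_mul (a b : Herm e) : ((a * b : Herm e) : KPlus e) = (a : KPlus e) * (b : KPlus e) := rfl

instance : IsCommJordan (Herm e) where
  lmul_comm_rmul_rmul a b := Subtype.ext
    (IsCommJordan.lmul_comm_rmul_rmul (A := KPlus e) (a : KPlus e) (b : KPlus e))

instance : IsScalarTower ℂ (Herm e) (Herm e) := ⟨fun c a b =>
  Subtype.ext (smul_mul_assoc c (a : KPlus e) (b : KPlus e))⟩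

instance : SMulCommClass ℂ (Herm e) (Herm e) := ⟨fun c a b =>
  Subtype.ext (mul_smul_comm c (a : KPlus e) (b : KPlus e)).symm⟩

theorem x_mem_iff (l : Lat) : KPlus.x e l ∈ Herm e ↔ eta e l l = 1 := by
  have hx : QTorus.x e l ≠ 0 := KPlus.x_ne_zero l
  rw [mem_iff]
  change QTorus.inv e (QTorus.x e l) = QTorus.x e l ↔ _
  rw [QTorus.inv_x]
  constructor
  · intro h
    have h' : ((eta e l l : ℂ) - 1) • QTorus.x e l = 0 := by rw [sub_smul, h, one_smul, sub_self]
    have := (smul_eq_zero.1 h').resolve_right hx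
    exact_mod_cast sub_eq_zero.1 this
  · intro h; rw [h]; simp

open Classical in
variable (e) in
/-- The element `x^l` if it belongs to `H(K_e, -)`, and `0` otherwise. -/
noncomputable def x (l : Lat) : Herm e :=
  if h : KPlus.x e l ∈ Herm e then ⟨KPlus.x e l, h⟩ else 0

theorem x_of_mem {l : Lat} (h : KPlus.x e l ∈ Herm e) : x e l = ⟨KPlus.x e l, h⟩ := dif_pos h

theorem x_of_not_mem {l : Lat} (h : KPlus.x e l ∉ Herm e) : x e l = 0 := dif_neg h

theorem x_ne_zero_iff (l : Lat) : x e l ≠ 0 ↔ KPlus.x e l ∈ Herm e := by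
  constructor
  · intro h; by_contra h'; exact h (x_of_not_mem h')
  · intro h h'
    rw [x_of_mem h] at h'
    exact KPlus.x_ne_zero l (congrArg Subtype.val h')

variable (e) in
/-- `H(K_e, -)` as a Jordan torus. -/
noncomputable def torus : JordanTorus (Herm e) where
  x := x e
  linInd := by
    have h : LinearIndependent ℂ (fun l : {l : Lat // x e l ≠ 0} => KPlus.x e l) :=
      KPlus.linearIndependent_x.comp _ Subtype.val_injective
    have h' : (fun l : {l : Lat // x e l ≠ 0} => ((x e l : Herm e) : KPlus e)) =
        fun l : {l : Lat // x e l ≠ 0} => KPlus.x e l := by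
      funext l
      rw [x_of_mem ((x_ne_zero_iff _).1 l.2)]
    refine LinearIndependent.of_comp (Submodule.subtype (Herm e).toSubmodule) ?_
    change LinearIndependent ℂ (fun l : {l : Lat // x e l ≠ 0} => ((x e l : Herm e) : KPlus e))
    rw [h']
    exact h
  span_x := by
    rw [eq_top_iff]
    rintro ⟨a, ha⟩ -
    have key : ∀ a : KPlus e, ∀ h : (1 / 2 : ℂ) • (a + sym (QTorus.inv e (unsym a))) ∈ Herm e,
        (⟨_, h⟩ : Herm e) ∈ Submodule.span ℂ (Set.range (x e)) := by
      have hmem : ∀ a : KPlus e, (1 / 2 : ℂ) • (a + sym (QTorus.inv e (unsym a))) ∈ Herm e := by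
        intro a
        rw [mem_iff]
        simp only [unsym_smul, unsym_add, unsym_sym, map_smul, map_add, QTorus.inv_spec.2.2]
        rw [add_comm]
      intro a _
      induction a using KPlus.induction with
      | hx l =>
        by_cases hl : KPlus.x e l ∈ Herm e
        · refine Submodule.subset_span ⟨l, ?_⟩
          rw [x_of_mem hl]
          apply Subtype.ext
          change KPlus.x e l = (1 / 2 : ℂ) • (KPlus.x e l + sym (QTorus.inv e (unsym (KPlus.x e l))))
          rw [(mem_iff _).1 hl]
          change KPlus.x e l = (1 / 2 : ℂ) • (KPlus.x e l + KPlus.x e l)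
          module
        · have hη : eta e l l = -1 := by
            rw [x_mem_iff] at hl
            have := QTorus.eta_sq (e := e) l l
            rcases mul_self_eq_one_iff.1 this with h | h
            · exact absurd h hl
            · exact h
          convert Submodule.zero_mem (Submodule.span ℂ (Set.range (x e))) using 1
          apply Subtype.ext
          change (1 / 2 : ℂ) • (KPlus.x e l + sym (QTorus.inv e (QTorus.x e l))) = 0
          rw [QTorus.inv_x, hη]
          change (1 / 2 : ℂ) • (KPlus.x e l + ((-1 : ℤ) : ℂ) • KPlus.x e l) = 0
          push_cast; module
      | h0 =>
        convert Submodule.zero_mem (Submodule.span ℂ (Set.range (x e))) using 1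
        apply Subtype.ext
        simp
      | hadd a b ha hb =>
        convert add_mem (ha (hmem a)) (hb (hmem b)) using 1
        apply Subtype.ext
        simp only [unsym_add, map_add, sym_add, AddMemClass.mk_add_mk]; module
      | hsmul c a ha =>
        convert Submodule.smul_mem _ c (ha (hmem a)) using 1
        apply Subtype.ext
        simp only [unsym_smul, map_smul, sym_smul, SetLike.mk_smul_mk]; module
    have hh : (1 / 2 : ℂ) • (a + sym (QTorus.inv e (unsym a))) = a := by
      rw [(mem_iff _).1 ha]
      change (1 / 2 : ℂ) • (a + a) = a
      module
    have := key a (by rw [hh]; exact ha)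
    convert this using 1
    exact Subtype.ext hh.symm
  x_zero := x_of_mem one_mem
  x_mul l m := by
    by_cases hl : KPlus.x e l ∈ Herm e
    swap; · rw [x_of_not_mem hl, zero_mul]; exact zero_mem _
    by_cases hm : KPlus.x e m ∈ Herm e
    swap; · rw [x_of_not_mem hm, mul_zero]; exact zero_mem _
    rw [x_of_mem hl, x_of_mem hm]
    have hlm := KPlus.x_mul (e := e) l m
    by_cases h : KPlus.x e (l + m) ∈ Herm e
    · rw [x_of_mem h]
      exact Submodule.mem_span_singleton.2
        ⟨(1 / 2 : ℂ) * (eta e l m + eta e m l), Subtype.ext hlm.symm⟩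
    · convert Submodule.zero_mem (Submodule.span ℂ {x e (l + m)}) using 1
      apply Subtype.ext
      have hmem : KPlus.x e l * KPlus.x e m ∈ Herm e := mul_mem hl hm
      change KPlus.x e l * KPlus.x e m = 0
      rw [hlm] at hmem ⊢
      by_cases hc : ((1 / 2 : ℂ) * (eta e l m + eta e m l)) = 0
      · rw [hc, zero_smul]
      · have := (Herm e).smul_mem ((1 / 2 : ℂ) * (eta e l m + eta e m l))⁻¹ hmem
        rw [smul_smul, inv_mul_cancel₀ hc, one_smul] at this
        exact absurd this h
  gen := by
    refine closure_eq_top_of_sig ?_ ?_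
    · exact (x_ne_zero_iff _).2 ((x_mem_iff _).2 (by simp [eta, sig1]))
    · exact (x_ne_zero_iff _).2 ((x_mem_iff _).2 (by simp [eta, sig2]))
  eps := KPlus.eps e ∘ₗ (Herm e).toSubmodule.subtype
  eps_x l := by
    by_cases hl : KPlus.x e l ∈ Herm e
    · rw [x_of_mem hl]; exact QTorus.lin_x (e := e) _ l
    · rw [x_of_not_mem hl, map_zero, if_neg]
      rintro rfl; exact hl one_mem
  eps_assoc_x l m n := KPlus.eps_assoc _ _ _

end Herm

end QuantumTorus

/-- `B` is a Chevalley basis of the complex Lie algebra `E`: it is a `ℂ`-basis, and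
`[B, B] ⊆ ℤ B`. -/
def IsChevalleyBasis {E : Type} [LieRing E] [LieAlgebra ℂ E] (B : Set E) : Prop :=
  LinearIndependent ℂ (fun b : B => (b : E)) ∧ Submodule.span ℂ B = ⊤ ∧
    ∀ u ∈ B, ∀ v ∈ B, ⁅u, v⁆ ∈ AddSubgroup.closure B

/-- The homomorphism `θ₁` with `θ₁(k₁σ₁ + k₂σ₂) = k₁`. -/
def theta1 : Lat →+ ℂ := (Int.castAddHom ℂ).comp (AddMonoidHom.fst ℤ ℤ)

/-- The homomorphism `θ₂` with `θ₂(k₁σ₁ + k₂σ₂) = k₂`. -/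
def theta2 : Lat →+ ℂ := (Int.castAddHom ℂ).comp (AddMonoidHom.snd ℤ ℤ)

/-- `θ_σ = k₂ θ₁ - k₁ θ₂` for `σ = k₁σ₁ + k₂σ₂`. -/
def thetaOf (σ : Lat) : Lat →+ ℂ := σ.2 • theta1 - σ.1 • theta2

section Basis

variable {J : Type} [NonAssocCommRing J] [Module ℂ J] [IsScalarTower ℂ J J] [SMulCommClass ℂ J J]
  [IsCommJordan J]

namespace EALA

variable {T : JordanTorus J}

variable (T) in
/-- The element `a` of `J ⊆ TKK(J)`. -/
def ofPos (a : J) : EALA T := ⟨⟨a, 0, 0⟩, 0, 0⟩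

variable (T) in
/-- The element `ā` of `J̄ ⊆ TKK(J)`. -/
def ofNeg (a : J) : EALA T := ⟨⟨0, 0, a⟩, 0, 0⟩

variable (T) in
/-- An element of the inner structure algebra, contained in `TKK(J)`. -/
def ofOp (S : instrl J) : EALA T := ⟨⟨0, S, 0⟩, 0, 0⟩

/-- An element of the graded dual of `D`. -/
def ofCent (c : T.grDual) : EALA T := ⟨0, c, 0⟩

/-- An element of `D`. -/
def ofDer (d : T.scder) : EALA T := ⟨0, 0, d⟩

end EALA

namespace JordanTorus

variable (T : JordanTorus J)

/-- `χ` is the element `χ^m` of the centroid: it is homogeneous of degree `m`, and it is normalized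
by `χ(x^l) = x^{m+l}`. -/
def IsChi (m : Lat) (χ : Module.End ℂ (TKK J)) : Prop :=
  χ ∈ centroid J ∧ χ ∈ T.endgr m ∧ ∀ l, χ ⟨T.x l, 0, 0⟩ = ⟨T.x (m + l), 0, 0⟩

/-- `d` is the derivation `χ^m ∂_θ`. -/
def IsChiDer (m : Lat) (θ : Lat →+ ℂ) (d : Module.End ℂ (TKK J)) : Prop :=
  ∃ χ δ, T.IsChi m χ ∧ T.IsDegDer θ δ ∧ d = χ * δ

/-- `c` is the element `c^m` of the dual of the homogeneous space `D^{-m}` with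
`c^m(χ^{-m} ∂_{θ_{-m}}) = 1`. -/
def IsDualChi (m : Lat) (c : Module.Dual ℂ T.scder) : Prop :=
  c ∈ T.dualgr (-m) ∧ ∃ d : T.scder, T.IsChiDer (-m) (thetaOf (-m)) d ∧ c d = 1

/-- `c` is the element of the dual of `D^0` with `c(∂_{θ₁}) = k₁` and `c(∂_{θ₂}) = k₂`. -/
def IsDualDeg (k₁ k₂ : ℂ) (c : Module.Dual ℂ T.scder) : Prop :=
  c ∈ T.dualgr 0 ∧ ∃ d₁ d₂ : T.scder, T.IsDegDer theta1 d₁ ∧ T.IsDegDer theta2 d₂ ∧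
    c d₁ = k₁ ∧ c d₂ = k₂

/-- The part of the basis in the root spaces of `±α + λ`: the elements `√2 x^λ` and `√2 x̄^λ` for
`λ` in the support of `J`. -/
noncomputable def basisReal : Set (EALA T) :=
  {z | ∃ l, T.x l ≠ 0 ∧ (z = EALA.ofPos T (((√2 : ℝ) : ℂ) • T.x l) ∨
    z = EALA.ofNeg T (((√2 : ℝ) : ℂ) • T.x l))}

/-- The elements `χ^λ ∂_{θ_λ}` and `c^λ`, for `λ ≠ 0`. -/
def basisDer : Set (EALA T) :=
  {z | ∃ l : Lat, l ≠ 0 ∧ ((∃ d : T.scder, T.IsChiDer l (thetaOf l) d ∧ z = EALA.ofDer d) ∨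
    ∃ c : T.grDual, T.IsDualChi l c ∧ z = EALA.ofCent c)}

/-- The elements `h_α = 2 L_1`, `∂_{θ₁}`, `∂_{θ₂}`, `c¹`, `c²` of the zero root space. -/
def basisZero : Set (EALA T) :=
  {z | z = EALA.ofOp T ((2 : ℂ) • ⟨L 1, L_mem 1⟩) ∨
    (∃ d : T.scder, (T.IsDegDer theta1 d ∨ T.IsDegDer theta2 d) ∧ z = EALA.ofDer d) ∨
    ∃ c : T.grDual, (T.IsDualDeg 1 0 c ∨ T.IsDualDeg 0 1 c) ∧ z = EALA.ofCent c}

/-- The set `B` with prescribed elements `R` of the inner structure algebra in the root spaces of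
the nonzero isotropic roots. -/
noncomputable def basis (R : Set (Module.End ℂ J)) : Set (EALA T) :=
  T.basisReal ∪ {z | ∃ S : instrl J, (S : Module.End ℂ J) ∈ R ∧ z = EALA.ofOp T S} ∪
    T.basisDer ∪ T.basisZero

/-- The operator `[L_{x^{λ+τ}}, L_{x^{-τ}}]`. -/
def lieL (l t : Lat) : Module.End ℂ J := ⁅L (T.x (l + t)), L (T.x (-t))⁆

end JordanTorus

end Basis

section Tables

/-- The set `B` for `J = J_S`, `S = S₀ ∪ S₁ ∪ S₂`: the operators are `L_{x^λ}` for
`0 ≠ λ ∈ S₀ ∪ S₁ ∪ S₂`, and `[L_{x^{λ+σ₂}}, L_{x^{-σ₂}}]` for `λ ∈ S₃ = σ₁ + σ₂ + 2Λ`. -/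
noncomputable def basisThree : Set (EALA (JS.torus semilatThree)) :=
  (JS.torus semilatThree).basis
    ({T | ∃ l : Lat, l ≠ 0 ∧ l ∈ coset 0 ∪ coset sig1 ∪ coset sig2 ∧ T = L (JS.x semilatThree l)} ∪
      {T | ∃ l ∈ coset (sig1 + sig2), T = (JS.torus semilatThree).lieL l sig2})

/-- The set `B` for `J = J_Λ`: the operators are `L_{x^λ}` and `[L_{x^{λ+σ₂}}, L_{x^{-σ₂}}]` for
`λ ∈ S₁ ∪ S₃`, `L_{x^λ}` and `[L_{x^{λ+σ₁}}, L_{x^{-σ₁}}]` for `λ ∈ S₂`, and `L_{x^λ}` for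
`0 ≠ λ ∈ S₀`. -/
noncomputable def basisFull : Set (EALA (JS.torus semilatFull)) :=
  (JS.torus semilatFull).basis
    ({T | ∃ l ∈ coset sig1 ∪ coset (sig1 + sig2),
        T = L (JS.x semilatFull l) ∨ T = (JS.torus semilatFull).lieL l sig2} ∪
      {T | ∃ l ∈ coset sig2,
        T = L (JS.x semilatFull l) ∨ T = (JS.torus semilatFull).lieL l sig1} ∪
      {T | ∃ l ∈ coset 0, l ≠ 0 ∧ T = L (JS.x semilatFull l)})

/-- The radical of `f(λ, μ) = η(λ, μ) η(μ, λ)⁻¹`. -/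
def rad (e : ℤˣ) : Set Lat := {l | ∀ m : Lat, eta e l m = eta e m l}

/-- The operator `r_λ` on `K_e^+`, with `r_λ(x^γ) = η(λ, γ) x^{λ+γ}`. -/
noncomputable def KPlus.r (e : ℤˣ) (l : Lat) : Module.End ℂ (KPlus e) where
  toFun a := QTorus.lin e (fun m => (eta e l m : ℂ) • KPlus.x e (l + m)) (SymAlg.unsym a)
  map_add' a b := map_add (QTorus.lin e _) (SymAlg.unsym a) (SymAlg.unsym b)
  map_smul' c a := map_smul (QTorus.lin e _) c (SymAlg.unsym a)

theorem KPlus.r_x (e : ℤˣ) (l m : Lat) :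
    KPlus.r e l (KPlus.x e m) = (eta e l m : ℂ) • KPlus.x e (l + m) := QTorus.lin_x _ m

/-- The set `B` for `J = K_e^+`: the operators are `L_{x^λ}` and `L_{x^λ} - r_λ` for `λ ∉ rad(f)`,
and `L_{x^λ}` for `0 ≠ λ ∈ rad(f)`. -/
noncomputable def basisKPlus (e : ℤˣ) : Set (EALA (KPlus.torus e)) :=
  (KPlus.torus e).basis
    ({T | ∃ l ∉ rad e, T = L (KPlus.x e l) ∨ T = L (KPlus.x e l) - KPlus.r e l} ∪
      {T | ∃ l ∈ rad e, l ≠ 0 ∧ T = L (KPlus.x e l)})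

/-- The operator `r_λ` on `H(K_e, -)`, with `r_λ(x^γ) = η(λ, γ) x^{λ+γ}`, where `x^{λ+γ}` stands
for `0` if it does not belong to `H(K_e, -)`. -/
noncomputable def Herm.r (e : ℤˣ) (l : Lat) : Module.End ℂ (Herm e) where
  toFun a := QTorus.lin e (fun m => (eta e l m : ℂ) • Herm.x e (l + m))
    (SymAlg.unsym (a : KPlus e))
  map_add' a b := map_add (QTorus.lin e _) (SymAlg.unsym (a : KPlus e)) (SymAlg.unsym (b : KPlus e))
  map_smul' c a := map_smul (QTorus.lin e _) c (SymAlg.unsym (a : KPlus e))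

theorem Herm.r_x (e : ℤˣ) (l m : Lat) (hm : KPlus.x e m ∈ Herm e) :
    Herm.r e l (Herm.x e m) = (eta e l m : ℂ) • Herm.x e (l + m) := by
  rw [Herm.x_of_mem hm]; exact QTorus.lin_x (e := e) _ m

/-- The set `B` for `J = H(K_e, -)`: the operators are `L_{x^λ}` for `0 ≠ λ ∉ S₃`, and `r_λ` for
`λ ∈ S₃`. -/
noncomputable def basisHerm (e : ℤˣ) : Set (EALA (Herm.torus e)) :=
  (Herm.torus e).basis
    ({T | ∃ l ∉ coset (sig1 + sig2), l ≠ 0 ∧ T = L (Herm.x e l)} ∪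
      {T | ∃ l ∈ coset (sig1 + sig2), T = Herm.r e l})

end Tables

end Elliptic

/-!
The four cases share one argument, which needs only that the Jordan torus `J` has integral structure
constants (`JordanTorus.IsIntegral`): products `x^l x^m` are integral multiples of `x^{l+m}`; in every
degree `l` of a set `X` there is one nonzero inner derivation `D l`, an integral multiple of some
`[L_{x^a}, L_{x^b}]` with `a + b = l`; each `[L_{x^a}, L_{x^b}]` is zero or an integral multiple of
`D (a + b)`; and for central `x^m` the product `x^m x^l` is exactly `x^{m+l}`.

*The centroid.* An element of the centroid of `TKK(J)` commutes with `ad L_a`, so it is determined by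
its value at `1 ∈ J`, which lies in `J` and is central; conversely, central elements of `J` act on
`TKK(J)` by multiplication (`IsCentral.toEnd`). Hence `χ^m` is multiplication by `x^m`, and `Γ` is the
set of degrees of nonzero central `x^m`. For a sum `d` of elements `χ^m ∂_θ`, the number
`(d(1), x^{-n}) + (1, d(x^{-n}))`, with `x^{-n}` in the second copy of `J`, is `-θ(n)` for the summand
of degree `n`, so skewness means `θ(m) = 0` for all summands. Thus `SCDer` has the basis
`χ^m ∂_{θ_m}`, `m ≠ 0`, and `∂_{θ₁}`, `∂_{θ₂}` (`derVec`), whose dual basis consists of the `c^m` and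
`c^i` (`centVec`).

*Basis.* `Instrl(J)` has the basis of the nonzero `L_{x^l}` and the `D l`: evaluation at `1` separates
the former from the latter, and the `D l` have different degrees.

*Integrality.* All of `θ_m(l)`, the structure constants of `SCDer`, and the values of the form on
`χ^n(u)` and `v` for basis elements `u`, `v` of `TKK(J)` are integers; for operators, the last claim
follows from `(S, a △ b) = ε(S(a) b)`. What needs care is degree `0`, where the integral span
contains `2 L_1` but not `L_1`. Brackets of `√2 x^l` and `√2 x^{-l}` carry the factor `2`; `D l` maps
`x^{-l}` to `0`, as it kills `1` and is skew for the form `ε(ab)`; and `χ^m ∂_{θ_m}` kills degree `-m`, as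
`θ_m(m) = 0` (`IsIntegral.isChevalleyBasis`).

*The four families.* For `J_S` the structure constants depend on degrees modulo `2Λ` only, so that
the identities for `[L_{x^a}, L_{x^b}]` are a finite check. In `K_e^+` one has
`[L_{x^a}, L_{x^b}] = (η(b, a) - η(a, b))/2 (L_{x^{a+b}} - r_{a+b})`, and in `H(K_e, -)` the commutator
`[L_{x^a}, L_{x^b}]` is `η(a, b) r_{a+b}` if `x^{a+b}` is not fixed by the involution, and `0`
otherwise. For `e = 1` every `x^l` is fixed, and the `r_l`, `l ∈ S₃`, of the table are just the
operators `L_{x^l}`.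
-/

namespace Elliptic

section

variable {J : Type} [NonAssocCommRing J] [Module ℂ J] [IsScalarTower ℂ J J] [SMulCommClass ℂ J J]

/-! ### The centroid of `TKK(J)` -/

/-- `z` belongs to the center of the commutative algebra `J`, that is, multiplication by `z` commutes
with every multiplication operator. -/
def IsCentral (z : J) : Prop := ∀ a b : J, z * (a * b) = a * (z * b)

namespace IsCentral

variable {z : J}

theorem mul_left (hz : IsCentral z) (a b : J) : z * (a * b) = (z * a) * b := by
  rw [mul_comm a b, hz b a, mul_comm]

theorem L_mul (hz : IsCentral z) (a : J) : L (z * a) = L z * L a := by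
  ext b
  rw [Module.End.mul_apply, L_apply, L_apply, L_apply, hz.mul_left]

theorem L_comm (hz : IsCentral z) (a : J) : L z * L a = L a * L z := by
  ext b
  simp only [Module.End.mul_apply, L_apply]
  exact hz a b

theorem L_mul_lie (hz : IsCentral z) (a b : J) : L z * ⁅L a, L b⁆ = ⁅L (z * a), L b⁆ := by
  rw [Ring.lie_def, Ring.lie_def, hz.L_mul, mul_sub, mul_assoc, ← mul_assoc (L b), ← hz.L_comm,
    mul_assoc]

theorem L_mul_lie' (hz : IsCentral z) (a b : J) : L z * ⁅L a, L b⁆ = ⁅L a, L (z * b)⁆ := by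
  rw [Ring.lie_def, Ring.lie_def, hz.L_mul, mul_sub, mul_assoc, ← mul_assoc (L a), ← hz.L_comm,
    mul_assoc]

theorem L_mul_mem (hz : IsCentral z) {S : Module.End ℂ J} (hS : S ∈ instrl J) :
    L z * S ∈ instrl J := by
  obtain ⟨A, hA, B, hB, rfl⟩ := Submodule.mem_sup.1 hS
  rw [mul_add]
  refine add_mem ?_ ?_
  · clear hS
    induction hA using Submodule.span_induction with
    | mem x h => obtain ⟨a, rfl⟩ := h; rw [← hz.L_mul]; exact L_mem _
    | zero => rw [mul_zero]; exact zero_mem _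
    | add x y _ _ hx hy => rw [mul_add]; exact add_mem hx hy
    | smul c x _ hx => rw [mul_smul_comm]; exact Submodule.smul_mem _ _ hx
  · clear hS
    induction hB using Submodule.span_induction with
    | mem x h =>
      obtain ⟨a, b, rfl⟩ := h; rw [hz.L_mul_lie]; exact inder_le (lie_L_mem_inder _ _)
    | zero => rw [mul_zero]; exact zero_mem _
    | add x y _ _ hx hy => rw [mul_add]; exact add_mem hx hy
    | smul c x _ hx => rw [mul_smul_comm]; exact Submodule.smul_mem _ _ hx

theorem L_comm_instrl (hz : IsCentral z) {S : Module.End ℂ J} (hS : S ∈ instrl J) :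
    L z * S = S * L z := by
  obtain ⟨A, hA, B, hB, rfl⟩ := Submodule.mem_sup.1 hS
  rw [mul_add, add_mul]
  clear hS
  congr 1
  · induction hA using Submodule.span_induction with
    | mem x h => obtain ⟨a, rfl⟩ := h; exact hz.L_comm a
    | zero => rw [mul_zero, zero_mul]
    | add x y _ _ hx hy => rw [mul_add, add_mul, hx, hy]
    | smul c x _ hx => rw [mul_smul_comm, smul_mul_assoc, hx]
  · induction hB using Submodule.span_induction with
    | mem x h =>
      obtain ⟨a, b, rfl⟩ := h
      rw [Ring.lie_def, mul_sub, sub_mul, ← mul_assoc, ← mul_assoc, hz.L_comm a, hz.L_comm b,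
        mul_assoc, mul_assoc, hz.L_comm a, hz.L_comm b, mul_assoc, mul_assoc]
    | zero => rw [mul_zero, zero_mul]
    | add x y _ _ hx hy => rw [mul_add, add_mul, hx, hy]
    | smul c x _ hx => rw [mul_smul_comm, smul_mul_assoc, hx]

/-- The endomorphism of `TKK(J)` given by multiplication by a central element of `J`. -/
def toEnd (hz : IsCentral z) : Module.End ℂ (TKK J) where
  toFun u := ⟨z * u.pos, ⟨L z * (u.op : Module.End ℂ J), hz.L_mul_mem u.op.2⟩, z * u.neg⟩
  map_add' u v := by
    ext1
    · simp [mul_add]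
    · apply Subtype.ext; simp [mul_add]
    · simp [mul_add]
  map_smul' c u := by
    ext1
    · simp [mul_smul_comm]
    · apply Subtype.ext; simp
    · simp [mul_smul_comm]

theorem toEnd_pos (hz : IsCentral z) (u : TKK J) : (hz.toEnd u).pos = z * u.pos := rfl
theorem toEnd_op (hz : IsCentral z) (u : TKK J) :
    ((hz.toEnd u).op : Module.End ℂ J) = L z * (u.op : Module.End ℂ J) := rfl
theorem toEnd_neg (hz : IsCentral z) (u : TKK J) : (hz.toEnd u).neg = z * u.neg := rfl

variable [IsCommJordan J]

theorem toEnd_lie (hz : IsCentral z) (u v : TKK J) : hz.toEnd ⁅u, v⁆ = ⁅hz.toEnd u, v⁆ := by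
  have comm (S : instrl J) (a : J) :
      z * (S : Module.End ℂ J) a = (S : Module.End ℂ J) (z * a) :=
    LinearMap.congr_fun (hz.L_comm_instrl S.2) a
  ext1
  · simp only [toEnd_pos, toEnd_op, TKK.lie_pos, mul_sub, Module.End.mul_apply, L_apply, comm]
  · apply Subtype.ext
    simp only [toEnd_op, TKK.lie_op, Submodule.coe_add, Submodule.coe_sub, tri_coe, instrlLie_coe,
      toEnd_pos, toEnd_neg, mul_add, mul_sub, ← hz.L_mul, ← hz.mul_left, ← hz v.pos]
    rw [hz.L_mul_lie, hz.L_mul_lie']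
    congr 1
    rw [Ring.lie_def, Ring.lie_def, mul_sub, ← mul_assoc, ← mul_assoc (L z) (v.op : Module.End ℂ J),
      hz.L_comm_instrl v.op.2, mul_assoc (v.op : Module.End ℂ J)]
  · have hb (S : instrl J) (T : instrl J) (hT : (T : Module.End ℂ J) = L z * (S : Module.End ℂ J))
        (a : J) : (bar T : Module.End ℂ J) a = z * (bar S : Module.End ℂ J) a := by
      simp only [bar_coe, hT, LinearMap.sub_apply, LinearMap.smul_apply, Module.End.mul_apply,
        L_apply, mul_sub, mul_smul_comm, hz.mul_left]
    rw [toEnd_neg, TKK.lie_neg, TKK.lie_neg, hb u.op _ (hz.toEnd_op u), mul_sub, toEnd_neg,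
      comm (bar v.op)]

theorem toEnd_mem_centroid (hz : IsCentral z) : hz.toEnd ∈ JordanTorus.centroid J := fun u v =>
  ⟨hz.toEnd_lie u v, by rw [← lie_skew, map_neg, hz.toEnd_lie, lie_skew]⟩

end IsCentral

section

variable [IsCommJordan J]

/-! ### Brackets of the components of `TKK(J)` -/

namespace TKK

theorem lie_op_pos (S : instrl J) (a : J) :
    (⁅(⟨0, S, 0⟩ : TKK J), ⟨a, 0, 0⟩⁆ : TKK J) = ⟨(S : Module.End ℂ J) a, 0, 0⟩ := by
  ext1
  · simp [TKK.lie_pos]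
  · apply Subtype.ext; simp [TKK.lie_op, tri_coe, instrlLie_coe, Ring.lie_def, L_zero]
  · simp [TKK.lie_neg, bar_coe]

theorem lie_op_neg (S : instrl J) (a : J) :
    (⁅(⟨0, S, 0⟩ : TKK J), ⟨0, 0, a⟩⁆ : TKK J) = ⟨0, 0, (bar S : Module.End ℂ J) a⟩ := by
  ext1
  · simp [TKK.lie_pos]
  · apply Subtype.ext; simp [TKK.lie_op, tri_coe, instrlLie_coe, Ring.lie_def, L_zero]
  · simp [TKK.lie_neg, bar_coe]

theorem lie_pos_neg (a b : J) :
    (⁅(⟨a, 0, 0⟩ : TKK J), ⟨0, 0, b⟩⁆ : TKK J) = ⟨0, tri a b, 0⟩ := by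
  ext1
  · simp [TKK.lie_pos]
  · apply Subtype.ext; simp [TKK.lie_op, tri_coe, instrlLie_coe, Ring.lie_def, L_zero]
  · simp [TKK.lie_neg, bar_coe]

theorem lie_pos_pos (a b : J) : (⁅(⟨a, 0, 0⟩ : TKK J), ⟨b, 0, 0⟩⁆ : TKK J) = 0 := by
  ext1
  · simp [TKK.lie_pos]
  · apply Subtype.ext; simp [TKK.lie_op, tri_coe, instrlLie_coe, Ring.lie_def, L_zero]
  · simp [TKK.lie_neg, bar_coe]

theorem lie_neg_neg (a b : J) : (⁅(⟨0, 0, a⟩ : TKK J), ⟨0, 0, b⟩⁆ : TKK J) = 0 := by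
  ext1
  · simp [TKK.lie_pos]
  · apply Subtype.ext; simp [TKK.lie_op, tri_coe, instrlLie_coe, Ring.lie_def, L_zero]
  · simp [TKK.lie_neg, bar_coe]

theorem lie_op_op (S S' : instrl J) :
    (⁅(⟨0, S, 0⟩ : TKK J), ⟨0, S', 0⟩⁆ : TKK J) = ⟨0, instrlLie S S', 0⟩ := by
  ext1
  · simp [TKK.lie_pos]
  · apply Subtype.ext; simp [TKK.lie_op, instrlLie_coe, Ring.lie_def]
  · simp [TKK.lie_neg, bar_coe]

end TKK

/-! ### Homogeneous elements of the centroid -/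

/-- An element of the centroid is determined by its value on `1`, since `TKK(J)` is generated by
`1 ∈ J` as an ideal. -/
theorem centroid_eq_zero {χ : Module.End ℂ (TKK J)} (hχ : χ ∈ JordanTorus.centroid J)
    (h : χ ⟨1, 0, 0⟩ = 0) : χ = 0 := by
  have hpos (a : J) : χ ⟨a, 0, 0⟩ = 0 := by
    have := (hχ ⟨0, ⟨L a, L_mem a⟩, 0⟩ ⟨1, 0, 0⟩).2
    rwa [h, lie_zero, TKK.lie_op_pos, L_apply, mul_one] at this
  have hop (S : instrl J) : χ ⟨0, S, 0⟩ = 0 := by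
    induction S using JordanTorus.tri_induction with
    | htri a b =>
      have := (hχ ⟨a, 0, 0⟩ ⟨0, 0, b⟩).1
      rwa [hpos, zero_lie, TKK.lie_pos_neg] at this
    | h0 => exact map_zero χ
    | hadd S S' h h' =>
      have : (⟨0, S + S', 0⟩ : TKK J) = ⟨0, S, 0⟩ + ⟨0, S', 0⟩ := by ext1 <;> simp
      rw [this, map_add, h, h', add_zero]
    | hsmul c S h =>
      have : (⟨0, c • S, 0⟩ : TKK J) = c • ⟨0, S, 0⟩ := by ext1 <;> simp
      rw [this, map_smul, h, smul_zero]
  have hneg (b : J) : χ ⟨0, 0, b⟩ = 0 := by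
    have := (hχ ⟨0, ⟨L 1, L_mem 1⟩, 0⟩ ⟨0, 0, b⟩).1
    rw [hop, zero_lie, TKK.lie_op_neg] at this
    rw [← neg_eq_zero, ← map_neg, ← this]
    congr 1
    ext1 <;> simp [bar_coe, two_smul]
  ext1 u
  have hu : u = ⟨u.pos, 0, 0⟩ + ⟨0, u.op, 0⟩ + ⟨0, 0, u.neg⟩ := by ext1 <;> simp
  rw [hu, map_add, map_add, hpos, hop, hneg]
  simp

theorem centroid_ext {χ χ' : Module.End ℂ (TKK J)} (hχ : χ ∈ JordanTorus.centroid J)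
    (hχ' : χ' ∈ JordanTorus.centroid J) (h : χ ⟨1, 0, 0⟩ = χ' ⟨1, 0, 0⟩) : χ = χ' :=
  sub_eq_zero.1 (centroid_eq_zero (sub_mem hχ hχ') (by rw [LinearMap.sub_apply, h, sub_self]))

/-- The centroid preserves `J`, the eigenspace of `ad L_1` for the eigenvalue `1`. -/
theorem centroid_apply_pos {χ : Module.End ℂ (TKK J)} (hχ : χ ∈ JordanTorus.centroid J) (a : J) :
    χ ⟨a, 0, 0⟩ = ⟨(χ ⟨a, 0, 0⟩).pos, 0, 0⟩ := by
  have h := (hχ ⟨0, ⟨L 1, L_mem 1⟩, 0⟩ ⟨a, 0, 0⟩).2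
  rw [TKK.lie_op_pos, L_apply, one_mul] at h
  have hL1 : (L 1 : Module.End ℂ J) = 1 := by ext; simp
  ext1
  · rfl
  · apply Subtype.ext
    have := congrArg (fun u : TKK J => (u.op : Module.End ℂ J)) h
    simp only [TKK.lie_op, Submodule.coe_add, Submodule.coe_sub, tri_coe, instrlLie_coe,
      Ring.lie_def, hL1, L_zero, zero_mul, mul_zero, one_mul, mul_one, sub_self, add_zero] at this
    simpa using this
  · have h2 := congrArg TKK.neg h
    simp [TKK.lie_neg, bar_coe, two_smul] at h2
    have h3 : (2 : ℂ) • (χ ⟨a, 0, 0⟩).neg = 0 := by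
      rw [two_smul]; nth_rw 1 [h2]; exact neg_add_cancel _
    exact (smul_eq_zero.1 h3).resolve_left two_ne_zero

theorem centroid_apply_pos_eq_mul {χ : Module.End ℂ (TKK J)} (hχ : χ ∈ JordanTorus.centroid J)
    (a : J) : (χ ⟨a, 0, 0⟩).pos = a * (χ ⟨1, 0, 0⟩).pos := by
  have h := (hχ ⟨0, ⟨L a, L_mem a⟩, 0⟩ ⟨1, 0, 0⟩).2
  rw [centroid_apply_pos hχ 1, TKK.lie_op_pos, TKK.lie_op_pos, L_apply, mul_one] at h
  rw [h, L_apply]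

theorem isCentral_of_centroid {χ : Module.End ℂ (TKK J)} (hχ : χ ∈ JordanTorus.centroid J) :
    IsCentral (χ ⟨1, 0, 0⟩).pos := fun a b => by
  have h := (hχ ⟨0, ⟨L a, L_mem a⟩, 0⟩ ⟨b, 0, 0⟩).2
  rw [centroid_apply_pos hχ b, TKK.lie_op_pos, TKK.lie_op_pos, L_apply] at h
  have h2 := congrArg TKK.pos h
  simp only [centroid_apply_pos_eq_mul hχ (a * b), centroid_apply_pos_eq_mul hχ b, L_apply] at h2
  rw [mul_comm, h2, mul_comm b]

end

namespace JordanTorus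

variable (T : JordanTorus J)

/-- The degrees of the nonzero homogeneous central elements of `J`: the support of the centroid. -/
def ctr : Set Lat := {m | T.x m ≠ 0 ∧ IsCentral (T.x m)}

variable {T}

theorem zero_mem_ctr : (0 : Lat) ∈ T.ctr :=
  ⟨fun h => by simpa [h] using T.eps_x 0, fun a b => by rw [T.x_zero]; simp⟩

variable [IsCommJordan J]

theorem toEnd_mem_endgr {m : Lat} (hm : IsCentral (T.x m)) : hm.toEnd ∈ T.endgr m := by
  intro l u hu
  refine ⟨?_, ?_, ?_⟩
  · rw [hm.toEnd_pos, add_comm]; exact T.jgr_mul (T.x_mem m) hu.1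
  · rw [hm.toEnd_op]
    refine T.opgr_induction (p := fun S => L (T.x m) * S ∈ T.opgr (l + m)) hu.2.1 ?_ ?_ ?_ ?_ ?_
    · rw [← hm.L_mul, add_comm]
      exact T.L_mem_opgr (T.jgr_mul (T.x_mem m) (T.x_mem l))
    · rintro p q rfl
      rw [hm.L_mul_lie, add_comm, ← add_assoc]
      exact T.lie_L_mem_opgr (T.jgr_mul (T.x_mem m) (T.x_mem p)) (T.x_mem q)
    · rw [mul_zero]; exact zero_mem _
    · intro S S' h h'; rw [mul_add]; exact add_mem h h'
    · intro c S h; rw [mul_smul_comm]; exact Submodule.smul_mem _ _ h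
  · rw [hm.toEnd_neg, add_comm]; exact T.jgr_mul (T.x_mem m) hu.2.2

/-- A homogeneous element of the centroid is a multiple of `χ^m`. -/
theorem centroid_homogeneous {m : Lat} {χ : Module.End ℂ (TKK J)} (hχ : χ ∈ centroid J)
    (hm : χ ∈ T.endgr m) : χ = 0 ∨ ∃ (h : m ∈ T.ctr) (k : ℂ), χ = k • h.2.toEnd := by
  have h1 : (⟨1, 0, 0⟩ : TKK J) ∈ T.gr 0 := ⟨T.one_mem_jgr, zero_mem (T.opgr 0), zero_mem _⟩
  have h2 := (hm _ _ h1).1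
  rw [zero_add] at h2
  obtain ⟨k, hk⟩ := Submodule.mem_span_singleton.1 h2
  by_cases h0 : k • T.x m = 0
  · left
    refine centroid_eq_zero hχ ?_
    rw [centroid_apply_pos hχ, ← hk, h0]; rfl
  · right
    have hk0 : k ≠ 0 := fun h => h0 (by rw [h, zero_smul])
    have hc : IsCentral (T.x m) := by
      intro a b
      have := isCentral_of_centroid hχ a b
      rw [← hk, smul_mul_assoc, smul_mul_assoc, mul_smul_comm] at this
      exact smul_right_injective J hk0 this
    refine ⟨⟨fun h => h0 (by rw [h, smul_zero]), hc⟩, k, ?_⟩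
    refine centroid_ext hχ (Submodule.smul_mem _ _ hc.toEnd_mem_centroid) ?_
    rw [centroid_apply_pos hχ 1, ← hk]
    ext1
    · simp [IsCentral.toEnd_pos]
    · apply Subtype.ext; simp [IsCentral.toEnd_op]
    · simp [IsCentral.toEnd_neg]

end JordanTorus

end

section

variable {J : Type} [NonAssocCommRing J] [Module ℂ J] [IsScalarTower ℂ J J] [SMulCommClass ℂ J J]

/-! ### Commutators of endomorphisms -/

section EndLie

variable {V : Type} [AddCommGroup V] [Module ℂ V]

theorem end_lie_add (A B C : Module.End ℂ V) : ⁅A, B + C⁆ = ⁅A, B⁆ + ⁅A, C⁆ := by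
  simp only [Ring.lie_def, mul_add, add_mul]; abel

theorem end_lie_smul (c : ℂ) (A B : Module.End ℂ V) : ⁅A, c • B⁆ = c • ⁅A, B⁆ := by
  simp only [Ring.lie_def, mul_smul_comm, smul_mul_assoc, smul_sub]

theorem end_smul_lie (c : ℂ) (A B : Module.End ℂ V) : ⁅c • A, B⁆ = c • ⁅A, B⁆ := by
  simp only [Ring.lie_def, mul_smul_comm, smul_mul_assoc, smul_sub]

theorem end_lie_zero (A : Module.End ℂ V) : ⁅A, (0 : Module.End ℂ V)⁆ = 0 := by
  simp [Ring.lie_def]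

theorem end_lie_swap (A B : Module.End ℂ V) : ⁅A, B⁆ = -⁅B, A⁆ := by
  simp only [Ring.lie_def]; abel

end EndLie

namespace JordanTorus

variable (T : JordanTorus J)

/-! ### Coefficients and degree derivations -/

/-- The nonzero elements `x^l` as a basis of `J`. -/
noncomputable def xBasis : Module.Basis {l : Lat // T.x l ≠ 0} ℂ J :=
  Module.Basis.mk T.linInd (by
    rw [← T.span_x, Submodule.span_le]
    rintro _ ⟨l, rfl⟩
    by_cases h : T.x l = 0
    · rw [h]; exact zero_mem _
    · exact Submodule.subset_span ⟨⟨l, h⟩, rfl⟩)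

theorem xBasis_apply (l : {l : Lat // T.x l ≠ 0}) : T.xBasis l = T.x l := by
  rw [xBasis, Module.Basis.mk_apply]

/-- The coefficient of `x^l`; it is zero if `x^l = 0`. -/
noncomputable def coef (l : Lat) : J →ₗ[ℂ] ℂ :=
  T.xBasis.constr ℂ fun m => if m.1 = l then (1 : ℂ) else 0

theorem coef_x {m : Lat} (hm : T.x m ≠ 0) (l : Lat) :
    T.coef l (T.x m) = if m = l then 1 else 0 := by
  have := T.xBasis.constr_basis ℂ (fun m => if m.1 = l then (1 : ℂ) else 0) ⟨m, hm⟩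
  rwa [xBasis_apply] at this

theorem coef_eq_zero {l m : Lat} (h : m ≠ l) {a : J} (ha : a ∈ T.jgr m) : T.coef l a = 0 := by
  obtain ⟨k, rfl⟩ := Submodule.mem_span_singleton.1 ha
  by_cases hm : T.x m = 0
  · simp [hm]
  · rw [map_smul, T.coef_x hm, if_neg h, smul_zero]

/-- The derivation of `J` that multiplies `x^l` by `θ l`. -/
noncomputable def jder (θ : Lat →+ ℂ) : Module.End ℂ J :=
  T.xBasis.constr ℂ fun m => θ m.1 • T.x m.1

theorem jder_x (θ : Lat →+ ℂ) (l : Lat) : T.jder θ (T.x l) = θ l • T.x l := by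
  by_cases h : T.x l = 0
  · simp [h]
  · have := T.xBasis.constr_basis ℂ (fun m => θ m.1 • T.x m.1) ⟨l, h⟩
    rwa [xBasis_apply] at this

theorem jder_mul (θ : Lat →+ ℂ) (a b : J) : T.jder θ (a * b) = T.jder θ a * b + a * T.jder θ b := by
  induction a using T.induction_x with
  | h0 => simp
  | hadd a a' h h' => simp only [add_mul, map_add, h, h']; abel
  | hsmul k a h => simp only [smul_mul_assoc, map_smul, h, smul_add]
  | hx l =>
  induction b using T.induction_x with
  | h0 => simp
  | hadd a a' h h' => simp only [mul_add, map_add, h, h']; abel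
  | hsmul k a h => simp only [mul_smul_comm, map_smul, h, smul_add]
  | hx m =>
    obtain ⟨k, hk⟩ := Submodule.mem_span_singleton.1 (T.x_mul l m)
    rw [jder_x, jder_x, smul_mul_assoc, mul_smul_comm, ← add_smul, ← map_add, ← hk, map_smul, jder_x,
      smul_comm]

theorem jder_lie_L (θ : Lat →+ ℂ) (a : J) : ⁅T.jder θ, L a⁆ = L (T.jder θ a) := by
  ext b
  simp only [Ring.lie_def, LinearMap.sub_apply, Module.End.mul_apply, L_apply, jder_mul]
  abel

theorem jder_lie_lie (θ : Lat →+ ℂ) (a b : J) :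
    ⁅T.jder θ, ⁅L a, L b⁆⁆ = ⁅L (T.jder θ a), L b⁆ + ⁅L a, L (T.jder θ b)⁆ := by
  rw [← jder_lie_L, ← jder_lie_L]
  simp only [Ring.lie_def]
  noncomm_ring

theorem jder_lie_mem (θ : Lat →+ ℂ) {S : Module.End ℂ J} (hS : S ∈ instrl J) :
    ⁅T.jder θ, S⁆ ∈ instrl J := by
  obtain ⟨A, hA, B, hB, rfl⟩ := Submodule.mem_sup.1 hS
  rw [end_lie_add]
  refine add_mem ?_ ?_
  · clear hS
    induction hA using Submodule.span_induction with
    | mem x h => obtain ⟨a, rfl⟩ := h; rw [jder_lie_L]; exact L_mem _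
    | zero => rw [end_lie_zero]; exact zero_mem _
    | add x y _ _ hx hy => rw [end_lie_add]; exact add_mem hx hy
    | smul c x _ hx => rw [end_lie_smul]; exact Submodule.smul_mem _ _ hx
  · clear hS
    induction hB using Submodule.span_induction with
    | mem x h =>
      obtain ⟨a, b, rfl⟩ := h
      rw [jder_lie_lie]
      exact add_mem (inder_le (lie_L_mem_inder _ _)) (inder_le (lie_L_mem_inder _ _))
    | zero => rw [end_lie_zero]; exact zero_mem _
    | add x y _ _ hx hy => rw [end_lie_add]; exact add_mem hx hy
    | smul c x _ hx => rw [end_lie_smul]; exact Submodule.smul_mem _ _ hx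

/-- The degree derivation `∂_θ` of `TKK(J)`. -/
noncomputable def degDer (θ : Lat →+ ℂ) : Module.End ℂ (TKK J) where
  toFun u := ⟨T.jder θ u.pos, ⟨⁅T.jder θ, (u.op : Module.End ℂ J)⁆, T.jder_lie_mem θ u.op.2⟩,
    T.jder θ u.neg⟩
  map_add' u v := by
    ext1
    · simp
    · apply Subtype.ext; simp [end_lie_add]
    · simp
  map_smul' c u := by
    ext1
    · simp
    · apply Subtype.ext; simp [end_lie_smul]
    · simp

theorem isDegDer_degDer (θ : Lat →+ ℂ) : T.IsDegDer θ (T.degDer θ) := by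
  have hj {l : Lat} {a : J} (ha : a ∈ T.jgr l) : T.jder θ a = θ l • a := by
    obtain ⟨c, rfl⟩ := Submodule.mem_span_singleton.1 ha
    rw [map_smul, jder_x, smul_comm]
  intro l u hu
  ext1
  · exact hj hu.1
  · apply Subtype.ext
    change ⁅T.jder θ, (u.op : Module.End ℂ J)⁆ = θ l • (u.op : Module.End ℂ J)
    refine T.opgr_induction (p := fun S => ⁅T.jder θ, S⁆ = θ l • S) hu.2.1 ?_ ?_ ?_ ?_ ?_
    · rw [jder_lie_L, jder_x, L_smul]
    · rintro m n rfl
      rw [jder_lie_lie, jder_x, jder_x, L_smul, L_smul, end_smul_lie, end_lie_smul, map_add, add_smul]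
    · simp [end_lie_zero]
    · intro S S' h h'; rw [end_lie_add, h, h', smul_add]
    · intro c S h; rw [end_lie_smul, h, smul_comm]
  · exact hj hu.2.2

variable [IsCommJordan J]

variable {T}

theorem IsDegDer.eq {θ : Lat →+ ℂ} {δ δ' : Module.End ℂ (TKK J)} (h : T.IsDegDer θ δ)
    (h' : T.IsDegDer θ δ') : δ = δ' := by
  ext1 u
  induction u using T.gr_induction with
  | h0 => simp
  | hadd a b ha hb => simp only [map_add, ha, hb]
  | hsmul c a ha => simp only [map_smul, ha]
  | hgr l u hu => rw [h _ _ hu, h' _ _ hu]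

theorem isDegDer_iff {θ : Lat →+ ℂ} {δ : Module.End ℂ (TKK J)} :
    T.IsDegDer θ δ ↔ δ = T.degDer θ :=
  ⟨fun h => h.eq (T.isDegDer_degDer θ), fun h => h ▸ T.isDegDer_degDer θ⟩

variable (T)

theorem degDer_add (θ ψ : Lat →+ ℂ) : T.degDer (θ + ψ) = T.degDer θ + T.degDer ψ :=
  (T.isDegDer_degDer _).eq fun l u hu => by
    rw [LinearMap.add_apply, T.isDegDer_degDer θ l u hu, T.isDegDer_degDer ψ l u hu, ← add_smul]; rfl

theorem degDer_smul (k : ℂ) (θ : Lat →+ ℂ) : T.degDer (k • θ) = k • T.degDer θ :=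
  (T.isDegDer_degDer _).eq fun l u hu => by
    rw [LinearMap.smul_apply, T.isDegDer_degDer θ l u hu, smul_smul]; rfl

theorem degDer_zero : T.degDer 0 = 0 :=
  (T.isDegDer_degDer _).eq fun l u _ => by simp

theorem x_pos_mem_gr (l : Lat) : (⟨T.x l, 0, 0⟩ : TKK J) ∈ T.gr l :=
  ⟨T.x_mem l, zero_mem (T.opgr l), zero_mem _⟩

theorem x_neg_mem_gr (l : Lat) : (⟨0, 0, T.x l⟩ : TKK J) ∈ T.gr l :=
  ⟨zero_mem _, zero_mem (T.opgr l), T.x_mem l⟩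

/-! ### Centroidal derivations -/

/-- The elements `χ^m` are normalized by `χ^m(x^l) = x^{m+l}` when multiplication by the central
element `x^m` sends `x^l` to `x^{m+l}`; the degrees `σ₁`, `σ₂` belong to the support. -/
structure IsNormalized : Prop where
  sig1_ne : T.x sig1 ≠ 0
  sig2_ne : T.x sig2 ≠ 0
  ctr_mul : ∀ m ∈ T.ctr, ∀ l, T.x m * T.x l = T.x (m + l)

variable {T}

/-- A nonzero homogeneous central element `x^m` is invertible, with inverse `x^{-m}`. -/
theorem IsNormalized.x_add_ne_zero (hT : T.IsNormalized) {m l : Lat} (hm : m ∈ T.ctr)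
    (hl : T.x l ≠ 0) : T.x (m + l) ≠ 0 := fun h => by
  have h1 : T.x (-m) * (T.x m * T.x l) = T.x l := by
    rw [← hm.2, hm.2.mul_left, hT.ctr_mul m hm, add_neg_cancel, T.x_zero, one_mul]
  rw [hT.ctr_mul m hm, h, mul_zero] at h1
  exact hl h1.symm

theorem IsNormalized.add_mem_ctr (hT : T.IsNormalized) {m n : Lat} (hm : m ∈ T.ctr)
    (hn : n ∈ T.ctr) : m + n ∈ T.ctr := by
  refine ⟨hT.x_add_ne_zero hm hn.1, fun a b => ?_⟩
  rw [← hT.ctr_mul m hm, ← hm.2.mul_left, hn.2 a b, hm.2 a, hm.2.mul_left]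

theorem IsNormalized.toEnd_mul (hT : T.IsNormalized) {m n : Lat} (hm : m ∈ T.ctr)
    (hn : n ∈ T.ctr) : hm.2.toEnd * hn.2.toEnd = (hT.add_mem_ctr hm hn).2.toEnd := by
  refine centroid_ext (centroid_mul hm.2.toEnd_mem_centroid hn.2.toEnd_mem_centroid)
    (hT.add_mem_ctr hm hn).2.toEnd_mem_centroid ?_
  ext1
  · simp [IsCentral.toEnd_pos, hT.ctr_mul m hm]
  · apply Subtype.ext; simp [IsCentral.toEnd_op]
  · simp [IsCentral.toEnd_neg]

variable (T) in
/-- The centroidal derivation `χ^m ∂_θ`. -/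
noncomputable def chiDer (m : T.ctr) (θ : Lat →+ ℂ) : Module.End ℂ (TKK J) :=
  m.2.2.toEnd * T.degDer θ

theorem IsNormalized.isChi_iff (hT : T.IsNormalized) {m : Lat} {χ : Module.End ℂ (TKK J)} :
    T.IsChi m χ ↔ ∃ h : m ∈ T.ctr, χ = h.2.toEnd := by
  constructor
  · rintro ⟨hc, hg, hx⟩
    rcases centroid_homogeneous hc hg with rfl | ⟨h, k, rfl⟩
    · exfalso
      have h1 := congrArg TKK.pos (hx (-m))
      rw [add_neg_cancel] at h1
      exact zero_mem_ctr.1 h1.symm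
    · refine ⟨h, ?_⟩
      have h1 := congrArg TKK.pos (hx 0)
      simp only [LinearMap.smul_apply, TKK.smul_pos, IsCentral.toEnd_pos, T.x_zero, mul_one,
        add_zero] at h1
      have h2 : (k - 1) • T.x m = 0 := by rw [sub_smul, h1, one_smul, sub_self]
      rw [sub_eq_zero.1 ((smul_eq_zero.1 h2).resolve_right h.1), one_smul]
  · rintro ⟨h, rfl⟩
    refine ⟨h.2.toEnd_mem_centroid, toEnd_mem_endgr h.2, fun l => ?_⟩
    ext1
    · exact hT.ctr_mul m h l
    · apply Subtype.ext; simp [IsCentral.toEnd_op]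
    · simp [IsCentral.toEnd_neg]

theorem IsNormalized.isChiDer_iff (hT : T.IsNormalized) {m : Lat} {θ : Lat →+ ℂ}
    {d : Module.End ℂ (TKK J)} :
    T.IsChiDer m θ d ↔ ∃ h : m ∈ T.ctr, d = T.chiDer ⟨m, h⟩ θ := by
  constructor
  · rintro ⟨χ, δ, hχ, hδ, rfl⟩
    obtain ⟨h, rfl⟩ := hT.isChi_iff.1 hχ
    obtain rfl := isDegDer_iff.1 hδ
    exact ⟨h, rfl⟩
  · rintro ⟨h, rfl⟩
    exact ⟨_, _, hT.isChi_iff.2 ⟨h, rfl⟩, T.isDegDer_degDer θ, rfl⟩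

theorem chiDer_mem_cder (m : T.ctr) (θ : Lat →+ ℂ) : T.chiDer m θ ∈ T.cder :=
  Submodule.subset_span (Set.mem_iUnion.2 ⟨m, _, _, m.2.2.toEnd_mem_centroid,
    toEnd_mem_endgr m.2.2, ⟨θ, T.isDegDer_degDer θ⟩, rfl⟩)

theorem chiDer_mem_endgr (m : T.ctr) (θ : Lat →+ ℂ) : T.chiDer m θ ∈ T.endgr m :=
  cderSet_subset_endgr ⟨_, _, m.2.2.toEnd_mem_centroid,
    toEnd_mem_endgr m.2.2, ⟨θ, T.isDegDer_degDer θ⟩, rfl⟩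

theorem chiDer_add (m : T.ctr) (θ ψ : Lat →+ ℂ) :
    T.chiDer m (θ + ψ) = T.chiDer m θ + T.chiDer m ψ := by
  rw [chiDer, degDer_add, mul_add]; rfl

theorem chiDer_smul (m : T.ctr) (k : ℂ) (θ : Lat →+ ℂ) :
    T.chiDer m (k • θ) = k • T.chiDer m θ := by
  rw [chiDer, degDer_smul, mul_smul_comm]; rfl

theorem chiDer_zero (m : T.ctr) : T.chiDer m 0 = 0 := by
  rw [chiDer, degDer_zero, mul_zero]

theorem chiDer_apply {m : T.ctr} {θ : Lat →+ ℂ} {l : Lat} {u : TKK J} (hu : u ∈ T.gr l) :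
    T.chiDer m θ u = θ l • m.2.2.toEnd u := by
  rw [chiDer, Module.End.mul_apply, T.isDegDer_degDer θ l u hu, map_smul]

theorem IsNormalized.chiDer_pos (hT : T.IsNormalized) (m : T.ctr) (θ : Lat →+ ℂ) (l : Lat) :
    (T.chiDer m θ ⟨T.x l, 0, 0⟩).pos = θ l • T.x (m + l) := by
  rw [chiDer_apply (T.x_pos_mem_gr l), TKK.smul_pos, IsCentral.toEnd_pos, hT.ctr_mul m m.2]

theorem IsNormalized.chiDer_neg (hT : T.IsNormalized) (m : T.ctr) (θ : Lat →+ ℂ) (l : Lat) :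
    (T.chiDer m θ ⟨0, 0, T.x l⟩).neg = θ l • T.x (m + l) := by
  rw [chiDer_apply (T.x_neg_mem_gr l), TKK.smul_neg', IsCentral.toEnd_neg, hT.ctr_mul m m.2]

theorem exists_sum_chiDer {d : Module.End ℂ (TKK J)} (hd : d ∈ T.cder) :
    ∃ f : T.ctr →₀ (Lat →+ ℂ), d = f.sum fun m θ => T.chiDer m θ := by
  induction hd using Submodule.span_induction with
  | mem x h =>
    obtain ⟨m, χ, δ, hc, hg, ⟨θ, hθ⟩, rfl⟩ := Set.mem_iUnion.1 h
    obtain rfl := isDegDer_iff.1 hθ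
    rcases centroid_homogeneous hc hg with rfl | ⟨hm, k, rfl⟩
    · exact ⟨0, by simp⟩
    · refine ⟨Finsupp.single ⟨m, hm⟩ (k • θ), ?_⟩
      rw [Finsupp.sum_single_index (chiDer_zero _), chiDer_smul, smul_mul_assoc]; rfl
  | zero => exact ⟨0, by simp⟩
  | add x y _ _ hx hy =>
    obtain ⟨f, rfl⟩ := hx
    obtain ⟨g, rfl⟩ := hy
    exact ⟨f + g, (Finsupp.sum_add_index' chiDer_zero chiDer_add).symm⟩
  | smul c x _ hx =>
    obtain ⟨f, rfl⟩ := hx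
    refine ⟨f.mapRange (fun θ => c • θ) (smul_zero c), ?_⟩
    rw [Finsupp.sum_mapRange_index chiDer_zero, Finsupp.smul_sum]
    simp only [chiDer_smul]

theorem form_centroid {χ : Module.End ℂ (TKK J)} (hχ : χ ∈ centroid J) (u v : TKK J) :
    T.form (χ u) v = T.form u (χ v) := by
  induction u using T.tkk_induction with
  | h0 => simp
  | hadd a b ha hb => simp only [map_add, LinearMap.add_apply, ha, hb]
  | hsmul c a ha => simp only [map_smul, LinearMap.smul_apply, ha]
  | hlie l m u _ w _ =>
    rw [(hχ u w).2, form_lie, form_lie, ← (hχ w v).1, (hχ w v).2]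

theorem form_degDer (θ : Lat →+ ℂ) (u v : TKK J) :
    T.form (T.degDer θ u) v = -T.form u (T.degDer θ v) := by
  induction u using T.gr_induction with
  | h0 => simp
  | hadd a b ha hb => simp only [map_add, LinearMap.add_apply, ha, hb]; ring
  | hsmul c a ha => simp only [map_smul, LinearMap.smul_apply, ha, smul_neg]
  | hgr l u hu =>
  induction v using T.gr_induction with
  | h0 => simp
  | hadd a b ha hb => simp only [map_add, ha, hb]; ring
  | hsmul c a ha => simp only [map_smul, ha, smul_neg]
  | hgr m v hv =>
    rw [T.isDegDer_degDer θ l u hu, T.isDegDer_degDer θ m v hv, map_smul, map_smul,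
      LinearMap.smul_apply]
    by_cases h : l + m = 0
    · have h1 : θ l + θ m = 0 := by rw [← map_add, h, map_zero]
      simp only [smul_eq_mul]
      linear_combination (T.form u v) * h1
    · rw [T.form_gr h hu hv]; simp

theorem chiDer_mem_scder (m : T.ctr) {θ : Lat →+ ℂ} (hθ : θ m = 0) : T.chiDer m θ ∈ T.scder := by
  refine mem_scder_of_skew (chiDer_mem_cder m θ) fun u v => ?_
  have h := (T.isDegDer_degDer θ).comp_endgr (toEnd_mem_endgr m.2.2)
  rw [hθ, zero_smul, add_zero] at h
  rw [chiDer, ← h, Module.End.mul_apply, form_degDer, form_centroid m.2.2.toEnd_mem_centroid, h]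
  simp

/-- A skew centroidal derivation is a sum of elements `χ^m ∂_θ` with `θ m = 0`: pair its values with
those of `1 ∈ J` and of `x^{-n}` in the second copy of `J`. -/
theorem IsNormalized.sum_chiDer_skew (hT : T.IsNormalized) {f : T.ctr →₀ (Lat →+ ℂ)}
    (hd : (f.sum fun m θ => T.chiDer m θ) ∈ T.scder) (n : T.ctr) : f n n = 0 := by
  have h := scder_skew hd ⟨T.x 0, 0, 0⟩ ⟨0, 0, T.x (-n)⟩
  have hform (a b : J) (S S' : instrl J) (b' : J) (hS' : S' = 0) :
      T.form ⟨a, S, b'⟩ ⟨0, S', b⟩ = T.eps (a * b) := by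
    subst hS'; simp [form_apply]
  have h1 : (f.sum fun m θ => T.chiDer m θ) ⟨T.x 0, 0, 0⟩ = 0 := by
    simp only [Finsupp.sum, LinearMap.sum_apply]
    refine Finset.sum_eq_zero fun m _ => ?_
    rw [chiDer_apply (T.x_pos_mem_gr 0), map_zero, zero_smul]
  rw [h1] at h
  have h2 : T.form ⟨T.x 0, 0, 0⟩ ((f.sum fun m θ => T.chiDer m θ) ⟨0, 0, T.x (-n)⟩) =
      f.sum fun m θ => θ (-n) * if m = n then 1 else 0 := by
    simp only [Finsupp.sum, LinearMap.sum_apply, map_sum]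
    refine Finset.sum_congr rfl fun m _ => ?_
    rw [form_apply]
    simp only [T.x_zero, one_mul, hT.chiDer_neg, mul_zero, map_zero, LinearMap.zero_apply,
      add_zero, map_smul, T.eps_x]
    have : (m : Lat) + -n = 0 ↔ m = n := by
      rw [← sub_eq_add_neg, sub_eq_zero]; exact ⟨Subtype.ext, congrArg _⟩
    simp [this]
  rw [h2, map_zero, LinearMap.zero_apply, Finsupp.sum, Finset.sum_eq_single n] at h
  · simpa using h.symm
  · intro m _ hm; simp [hm]
  · intro hn; simp [Finsupp.notMem_support_iff.1 hn]

end JordanTorus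

end

section

/-! ### Bases of `SCDer` and of its graded dual -/

theorem thetaOf_apply (m l : Lat) : thetaOf m l = (m.2 : ℂ) * l.1 - m.1 * l.2 := by
  simp [thetaOf, theta1, theta2]

theorem thetaOf_self (m : Lat) : thetaOf m m = 0 := by rw [thetaOf_apply]; ring

theorem thetaOf_add (m n : Lat) : thetaOf (m + n) = thetaOf m + thetaOf n := by
  refine AddMonoidHom.ext fun l => ?_
  simp only [thetaOf_apply, AddMonoidHom.add_apply, Prod.fst_add, Prod.snd_add]
  push_cast; ring

theorem addHom_apply (θ : Lat →+ ℂ) (l : Lat) : θ l = θ sig1 * l.1 + θ sig2 * l.2 := by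
  have h : l = l.1 • sig1 + l.2 • sig2 := by ext <;> simp [sig1, sig2]
  conv_lhs => rw [h]
  rw [map_add, map_zsmul, map_zsmul, zsmul_eq_mul, zsmul_eq_mul, mul_comm, mul_comm (l.2 : ℂ)]

theorem addHom_eq (θ : Lat →+ ℂ) : θ = θ sig1 • theta1 + θ sig2 • theta2 :=
  AddMonoidHom.ext fun l => addHom_apply θ l

theorem eq_smul_thetaOf {m : Lat} (hm : m ≠ 0) {θ : Lat →+ ℂ} (h : θ m = 0) :
    ∃ k : ℂ, θ = k • thetaOf m := by
  rw [addHom_apply] at h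
  by_cases h2 : m.2 = 0
  · have h1 : (m.1 : ℂ) ≠ 0 := by
      intro h1; exact hm (Prod.ext (by exact_mod_cast h1) h2)
    rw [h2, Int.cast_zero, mul_zero, add_zero] at h
    refine ⟨-θ sig2 / m.1, AddMonoidHom.ext fun l => ?_⟩
    rw [addHom_apply, AddMonoidHom.smul_apply, thetaOf_apply, h2,
      (mul_eq_zero.1 h).resolve_right h1, smul_eq_mul]
    field_simp
    push_cast
    ring
  · have h2' : (m.2 : ℂ) ≠ 0 := by exact_mod_cast h2
    refine ⟨θ sig1 / m.2, AddMonoidHom.ext fun l => ?_⟩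
    rw [addHom_apply, AddMonoidHom.smul_apply, thetaOf_apply, smul_eq_mul]
    field_simp
    linear_combination (l.2 : ℂ) * h

theorem intCast_smul_mem {V : Type*} [AddCommGroup V] [Module ℂ V] (H : AddSubgroup V) {v : V}
    (hv : v ∈ H) (k : ℤ) : (k : ℂ) • v ∈ H := by
  rw [Int.cast_smul_eq_zsmul]; exact zsmul_mem hv k

variable {J : Type} [NonAssocCommRing J] [Module ℂ J] [IsScalarTower ℂ J J] [SMulCommClass ℂ J J]
  [IsCommJordan J]

namespace JordanTorus

variable (T : JordanTorus J)

/-- The index set of a basis of `SCDer`: a nonzero central degree `m` stands for `χ^m ∂_{θ_m}`, and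
`i : Fin 2` for one of the two degree derivations `∂_{θ₁}`, `∂_{θ₂}`. -/
abbrev DerIdx : Type := {m : T.ctr // (m : Lat) ≠ 0} ⊕ Fin 2

variable {T}

/-- The degree of a basis element of `SCDer`. -/
def derDeg : T.DerIdx → Lat
  | .inl m => (m : T.ctr)
  | .inr _ => 0

/-- The degree of a basis element of `SCDer`, as a degree of the centroid. -/
def derCtr : T.DerIdx → T.ctr
  | .inl m => m
  | .inr _ => ⟨0, zero_mem_ctr⟩

/-- The linear form `θ` for the basis element `χ^m ∂_θ` of `SCDer`. -/
def derTheta : T.DerIdx → (Lat →+ ℂ)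
  | .inl m => thetaOf (m : T.ctr)
  | .inr 0 => theta1
  | .inr 1 => theta2

theorem derCtr_coe (i : T.DerIdx) : (derCtr i : Lat) = derDeg i := by
  cases i <;> rfl

theorem derTheta_self (i : T.DerIdx) : derTheta i (derCtr i) = 0 := by
  rcases i with m | i
  · exact thetaOf_self _
  · exact map_zero _

theorem derTheta_int (i : T.DerIdx) (l : Lat) : ∃ k : ℤ, derTheta i l = k := by
  rcases i with m | i
  · exact ⟨((m : T.ctr) : Lat).2 * l.1 - ((m : T.ctr) : Lat).1 * l.2, by
      simp [derTheta, thetaOf_apply]⟩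
  · fin_cases i
    · exact ⟨l.1, by simp [derTheta, theta1]⟩
    · exact ⟨l.2, by simp [derTheta, theta2]⟩

/-- The basis of `SCDer`. -/
noncomputable def derVec (i : T.DerIdx) : T.scder :=
  ⟨T.chiDer (derCtr i) (derTheta i), chiDer_mem_scder _ (derTheta_self i)⟩

theorem derVec_coe (i : T.DerIdx) :
    (derVec i : Module.End ℂ (TKK J)) = T.chiDer (derCtr i) (derTheta i) := rfl

theorem derVec_mem (i : T.DerIdx) : derVec i ∈ T.scdergr (derDeg i) := by
  rw [← derCtr_coe]; exact chiDer_mem_endgr _ _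

theorem chiDer_zero_eq (θ : Lat →+ ℂ) : T.chiDer ⟨0, zero_mem_ctr⟩ θ = T.degDer θ := by
  have h : (zero_mem_ctr (T := T)).2.toEnd = 1 := by
    refine centroid_ext (IsCentral.toEnd_mem_centroid _) (fun u v => by simp) ?_
    ext1
    · simp [IsCentral.toEnd_pos, T.x_zero]
    · apply Subtype.ext; simp [IsCentral.toEnd_op]
    · simp [IsCentral.toEnd_neg]
  rw [chiDer, h, one_mul]

theorem chiDer_mem_span (m : T.ctr) {θ : Lat →+ ℂ} (hθ : θ m = 0) (hd : T.chiDer m θ ∈ T.scder) :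
    (⟨T.chiDer m θ, hd⟩ : T.scder) ∈ Submodule.span ℂ (Set.range (derVec (T := T))) := by
  by_cases hm : (m : Lat) = 0
  · have h1 : (⟨T.chiDer m θ, hd⟩ : T.scder) =
        θ sig1 • derVec (.inr 0) + θ sig2 • derVec (.inr 1) := by
      apply Subtype.ext
      obtain ⟨m, hm'⟩ := m
      obtain rfl : m = 0 := hm
      change T.chiDer ⟨0, zero_mem_ctr⟩ θ = θ sig1 • T.chiDer ⟨0, zero_mem_ctr⟩ theta1 +
        θ sig2 • T.chiDer ⟨0, zero_mem_ctr⟩ theta2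
      rw [← chiDer_smul, ← chiDer_smul, ← chiDer_add, ← addHom_eq]
    rw [h1]
    exact add_mem (Submodule.smul_mem _ _ (Submodule.subset_span ⟨_, rfl⟩))
      (Submodule.smul_mem _ _ (Submodule.subset_span ⟨_, rfl⟩))
  · obtain ⟨k, rfl⟩ := eq_smul_thetaOf hm hθ
    have h1 : (⟨T.chiDer m (k • thetaOf m), hd⟩ : T.scder) = k • derVec (.inl ⟨m, hm⟩) :=
      Subtype.ext (chiDer_smul m k _)
    rw [h1]
    exact Submodule.smul_mem _ _ (Submodule.subset_span ⟨_, rfl⟩)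

theorem IsNormalized.span_derVec (hT : T.IsNormalized) :
    Submodule.span ℂ (Set.range (derVec (T := T))) = ⊤ := by
  rw [eq_top_iff]
  rintro ⟨d, hd⟩ -
  obtain ⟨f, rfl⟩ := exists_sum_chiDer hd.1
  have h1 := hT.sum_chiDer_skew hd
  have h2 : (⟨f.sum fun m θ => T.chiDer m θ, hd⟩ : T.scder) =
      ∑ m ∈ f.support, ⟨T.chiDer m (f m), chiDer_mem_scder m (h1 m)⟩ := by
    apply Subtype.ext; simp [Finsupp.sum]
  rw [h2]
  exact sum_mem fun m _ => chiDer_mem_span m (h1 m) _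

variable (T) in
/-- The functional on `SCDer` that maps `d` to the coefficient of `x^{m+l}` in `d(x^l)`. -/
noncomputable def symb (m l : Lat) : Module.Dual ℂ T.scder where
  toFun d := T.coef (m + l) ((d : Module.End ℂ (TKK J)) ⟨T.x l, 0, 0⟩).pos
  map_add' a b := by simp
  map_smul' k a := by simp

theorem symb_mem (m l : Lat) : T.symb m l ∈ T.dualgr m := by
  intro n hn d hd
  exact T.coef_eq_zero (fun h => hn (by rw [add_comm m] at h; exact add_left_cancel h))
    (hd l _ (T.x_pos_mem_gr l)).1

theorem IsNormalized.symb_derVec (hT : T.IsNormalized) {m l : Lat} (hl : T.x l ≠ 0)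
    (i : T.DerIdx) : T.symb m l (derVec i) = if derDeg i = m then derTheta i l else 0 := by
  change T.coef (m + l) (T.chiDer _ _ ⟨T.x l, 0, 0⟩).pos = _
  rw [hT.chiDer_pos, map_smul, T.coef_x (hT.x_add_ne_zero (derCtr i).2 hl), derCtr_coe]
  simp

/-- The functionals dual to the basis of `SCDer`. As `θ_m(σ₁) = m₂` and `θ_m(σ₂) = -m₁`, the
coefficient of `χ^m ∂_{θ_m}` is read off from the action on `x^{σ₁}` if `m₂ ≠ 0`, and on `x^{σ₂}`
otherwise. -/
noncomputable def derDual : T.DerIdx → Module.Dual ℂ T.scder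
  | .inl m => if ((m : T.ctr) : Lat).2 ≠ 0
      then (((m : T.ctr) : Lat).2 : ℂ)⁻¹ • T.symb (m : T.ctr) sig1
      else (-(((m : T.ctr) : Lat).1 : ℂ))⁻¹ • T.symb (m : T.ctr) sig2
  | .inr 0 => T.symb 0 sig1
  | .inr 1 => T.symb 0 sig2

theorem derDual_mem (i : T.DerIdx) : derDual i ∈ T.dualgr (derDeg i) := by
  rcases i with m | i
  · simp only [derDual]
    split_ifs
    · exact Submodule.smul_mem _ _ (symb_mem _ _)
    · exact Submodule.smul_mem _ _ (symb_mem _ _)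
  · fin_cases i
    · exact symb_mem _ _
    · exact symb_mem _ _

theorem dualgr_derVec {m : Lat} {φ : Module.Dual ℂ T.scder} (hφ : φ ∈ T.dualgr m) {i : T.DerIdx}
    (hi : derDeg i ≠ m) : φ (derVec i) = 0 := hφ _ hi _ (derVec_mem i)

open Classical in
theorem IsNormalized.derDual_derVec (hT : T.IsNormalized) (i j : T.DerIdx) :
    derDual i (derVec j) = if i = j then 1 else 0 := by
  by_cases hd : derDeg j = derDeg i
  swap
  · rw [dualgr_derVec (derDual_mem i) hd, if_neg]
    rintro rfl; exact hd rfl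
  rcases i with m | i <;> rcases j with n | j
  · obtain rfl : n = m := Subtype.ext (Subtype.ext hd)
    rw [if_pos rfl]
    simp only [derDual]
    split_ifs with h2
    · have h2' : (((n : T.ctr) : Lat).2 : ℂ) ≠ 0 := by exact_mod_cast h2
      rw [LinearMap.smul_apply, hT.symb_derVec hT.sig1_ne]
      simp [derDeg, derTheta, thetaOf_apply, sig1, h2']
    · have h1 : (((n : T.ctr) : Lat).1 : ℂ) ≠ 0 := by
        intro h1; exact n.2 (Prod.ext (by exact_mod_cast h1) (not_not.1 h2))
      rw [LinearMap.smul_apply, hT.symb_derVec hT.sig2_ne]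
      simp only [derDeg, derTheta, thetaOf_apply, sig2]
      simp
      field_simp
  · exact absurd hd.symm m.2
  · exact absurd hd n.2
  · have h1 := hT.symb_derVec (m := 0) hT.sig1_ne (.inr j)
    have h2 := hT.symb_derVec (m := 0) hT.sig2_ne (.inr j)
    fin_cases i <;> fin_cases j <;>
      simp_all [derDual, derTheta, derDeg, theta1, theta2, sig1, sig2]

theorem IsNormalized.linearIndependent_derVec (hT : T.IsNormalized) :
    LinearIndependent ℂ (derVec (T := T)) := by
  classical
  refine linearIndependent_iff'.2 fun s g hg i hi => ?_
  have h := congrArg (derDual i) hg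
  simpa [hT.derDual_derVec, hi] using h

theorem IsNormalized.linearIndependent_derDual (hT : T.IsNormalized) :
    LinearIndependent ℂ (derDual (T := T)) := by
  classical
  refine linearIndependent_iff'.2 fun s g hg i hi => ?_
  have h := LinearMap.congr_fun hg (derVec i)
  simpa [LinearMap.sum_apply, hT.derDual_derVec, hi] using h

theorem IsNormalized.dual_ext (hT : T.IsNormalized) {φ ψ : Module.Dual ℂ T.scder}
    (h : ∀ i, φ (derVec i) = ψ (derVec i)) : φ = ψ :=
  LinearMap.ext_on_range hT.span_derVec h

theorem finite_derDeg (m : Lat) : {i : T.DerIdx | derDeg i = m}.Finite := by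
  have : {i : T.DerIdx | derDeg i = m} ⊆
      Sum.inl '' {n : {m : T.ctr // (m : Lat) ≠ 0} | ((n : T.ctr) : Lat) = m} ∪
        Sum.inr '' Set.univ := by
    rintro (n | i) h
    · exact Or.inl ⟨n, h, rfl⟩
    · exact Or.inr ⟨i, trivial, rfl⟩
  refine Set.Finite.subset (Set.Finite.union (Set.Finite.image _ ?_) (Set.finite_univ.image _)) this
  exact Set.Subsingleton.finite fun a ha b hb => Subtype.ext (Subtype.ext (ha.trans hb.symm))

theorem IsNormalized.dual_eq_sum (hT : T.IsNormalized) {m : Lat} {φ : Module.Dual ℂ T.scder}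
    (hφ : φ ∈ T.dualgr m) :
    φ = ∑ i ∈ (finite_derDeg (T := T) m).toFinset, φ (derVec i) • derDual i := by
  classical
  refine hT.dual_ext fun j => ?_
  simp only [LinearMap.sum_apply, LinearMap.smul_apply, hT.derDual_derVec, smul_eq_mul, mul_ite,
    mul_one, mul_zero, Finset.sum_ite_eq', Set.Finite.mem_toFinset, Set.mem_ofPred_eq]
  split_ifs with h
  · rfl
  · exact dualgr_derVec hφ h

theorem derDual_mem_grDual (i : T.DerIdx) : derDual i ∈ T.grDual :=
  Submodule.mem_iSup_of_mem _ (derDual_mem i)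

/-- The basis of the graded dual of `SCDer`. -/
noncomputable def centVec (i : T.DerIdx) : T.grDual := ⟨derDual i, derDual_mem_grDual i⟩

theorem IsNormalized.linearIndependent_centVec (hT : T.IsNormalized) :
    LinearIndependent ℂ (centVec (T := T)) :=
  LinearIndependent.of_comp T.grDual.subtype hT.linearIndependent_derDual

theorem IsNormalized.centVec_sum (hT : T.IsNormalized) {m : Lat} {φ : T.grDual}
    (hφ : (φ : Module.Dual ℂ T.scder) ∈ T.dualgr m) :
    φ = ∑ i ∈ (finite_derDeg (T := T) m).toFinset,
      (φ : Module.Dual ℂ T.scder) (derVec i) • centVec i := by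
  apply Subtype.ext
  rw [AddSubmonoidClass.coe_finsetSum]
  exact hT.dual_eq_sum hφ

theorem IsNormalized.span_centVec (hT : T.IsNormalized) :
    Submodule.span ℂ (Set.range (centVec (T := T))) = ⊤ := by
  rw [eq_top_iff]
  rintro ⟨φ, hφ⟩ -
  have h : ∀ φ ∈ T.grDual, φ ∈ (Submodule.span ℂ (Set.range (centVec (T := T)))).map
      T.grDual.subtype := by
    intro φ hφ
    refine (iSup_le fun m ψ hψ => ?_ : T.grDual ≤ _) hφ
    have hψ' : ψ ∈ T.grDual := Submodule.mem_iSup_of_mem m hψ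
    refine ⟨⟨ψ, hψ'⟩, ?_, rfl⟩
    rw [hT.centVec_sum (φ := ⟨ψ, hψ'⟩) hψ]
    exact sum_mem fun i _ => Submodule.smul_mem _ _ (Submodule.subset_span ⟨i, rfl⟩)
  obtain ⟨ψ, h1, h2⟩ := h φ hφ
  have : ψ = ⟨φ, hφ⟩ := Subtype.ext h2
  rwa [← this]

/-- A homogeneous functional on `SCDer` with integral values on the basis is an integral combination
of the dual basis. -/
theorem IsNormalized.mem_closure_centVec (hT : T.IsNormalized) {m : Lat} {φ : T.grDual}
    (hφ : (φ : Module.Dual ℂ T.scder) ∈ T.dualgr m)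
    (hi : ∀ i, ∃ k : ℤ, (φ : Module.Dual ℂ T.scder) (derVec i) = k) :
    φ ∈ AddSubgroup.closure (Set.range (centVec (T := T))) := by
  rw [hT.centVec_sum hφ]
  refine sum_mem fun i _ => ?_
  obtain ⟨k, hk⟩ := hi i
  rw [hk]
  exact intCast_smul_mem _ (AddSubgroup.subset_closure (Set.mem_range_self i)) k

theorem IsNormalized.scder_basis_iff (hT : T.IsNormalized) (d : T.scder) :
    ((∃ l : Lat, l ≠ 0 ∧ T.IsChiDer l (thetaOf l) d) ∨ T.IsDegDer theta1 d ∨ T.IsDegDer theta2 d) ↔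
      d ∈ Set.range (derVec (T := T)) := by
  constructor
  · rintro (⟨l, hl, h⟩ | h | h)
    · obtain ⟨hm, h⟩ := hT.isChiDer_iff.1 h
      exact ⟨.inl ⟨⟨l, hm⟩, hl⟩, Subtype.ext h.symm⟩
    · exact ⟨.inr 0, Subtype.ext ((chiDer_zero_eq _).trans (isDegDer_iff.1 h).symm)⟩
    · exact ⟨.inr 1, Subtype.ext ((chiDer_zero_eq _).trans (isDegDer_iff.1 h).symm)⟩
  · rintro ⟨m | i, rfl⟩
    · exact Or.inl ⟨_, m.2, hT.isChiDer_iff.2 ⟨m.1.2, rfl⟩⟩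
    · fin_cases i
      · exact Or.inr (Or.inl (isDegDer_iff.2 (chiDer_zero_eq _)))
      · exact Or.inr (Or.inr (isDegDer_iff.2 (chiDer_zero_eq _)))

theorem IsNormalized.isDualChi_iff (hT : T.IsNormalized) {l : Lat} (hl : l ≠ 0)
    (c : Module.Dual ℂ T.scder) :
    T.IsDualChi l c ↔ ∃ h : -l ∈ T.ctr, c = derDual (.inl ⟨⟨-l, h⟩, neg_ne_zero.2 hl⟩) := by
  classical
  constructor
  · rintro ⟨hc, d, hd, h1⟩
    obtain ⟨hm, hd⟩ := hT.isChiDer_iff.1 hd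
    refine ⟨hm, hT.dual_ext fun j => ?_⟩
    have hd' : d = derVec (.inl ⟨⟨-l, hm⟩, neg_ne_zero.2 hl⟩) := Subtype.ext hd
    rw [hT.derDual_derVec]
    split_ifs with hj
    · rw [← hj, ← hd', h1]
    · refine dualgr_derVec hc fun h => hj ?_
      rcases j with n | j
      · exact congrArg Sum.inl (Subtype.ext (Subtype.ext h.symm))
      · exact absurd h.symm (neg_ne_zero.2 hl)
  · rintro ⟨hm, rfl⟩
    exact ⟨derDual_mem (.inl ⟨⟨-l, hm⟩, neg_ne_zero.2 hl⟩), derVec (.inl ⟨⟨-l, hm⟩, neg_ne_zero.2 hl⟩),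
      hT.isChiDer_iff.2 ⟨hm, rfl⟩, by rw [hT.derDual_derVec, if_pos rfl]⟩

theorem IsNormalized.isDualDeg_iff (hT : T.IsNormalized) (i : Fin 2) (c : Module.Dual ℂ T.scder) :
    T.IsDualDeg (if i = 0 then 1 else 0) (if i = 1 then 1 else 0) c ↔ c = derDual (.inr i) := by
  classical
  have hdeg : ∀ {θ} {d : T.scder}, T.IsDegDer θ d →
      (d : Module.End ℂ (TKK J)) = T.chiDer ⟨0, zero_mem_ctr⟩ θ := fun h =>
    (isDegDer_iff.1 h).trans (chiDer_zero_eq _).symm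
  constructor
  · rintro ⟨hc, d₁, d₂, hd1, hd2, h1, h2⟩
    have hd1' : d₁ = derVec (.inr 0) := Subtype.ext (hdeg hd1)
    have hd2' : d₂ = derVec (.inr 1) := Subtype.ext (hdeg hd2)
    refine hT.dual_ext fun j => ?_
    rw [hT.derDual_derVec]
    rcases j with n | j
    · rw [dualgr_derVec hc (i := .inl n) n.2, if_neg (by simp)]
    · fin_cases j
      · change c (derVec (.inr 0)) = if Sum.inr i = Sum.inr 0 then 1 else 0
        rw [← hd1', h1]; simp
      · change c (derVec (.inr 1)) = if Sum.inr i = Sum.inr 1 then 1 else 0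
        rw [← hd2', h2]; simp
  · rintro rfl
    refine ⟨derDual_mem (.inr i), derVec (.inr 0), derVec (.inr 1), isDegDer_iff.2 (chiDer_zero_eq _),
      isDegDer_iff.2 (chiDer_zero_eq _), ?_, ?_⟩
    · rw [hT.derDual_derVec]; simp
    · rw [hT.derDual_derVec]; simp

theorem IsNormalized.cent_basis_iff (hT : T.IsNormalized) (c : T.grDual) :
    ((∃ l : Lat, l ≠ 0 ∧ T.IsDualChi l c) ∨ T.IsDualDeg 1 0 c ∨ T.IsDualDeg 0 1 c) ↔
      c ∈ Set.range (centVec (T := T)) := by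
  have h0 := hT.isDualDeg_iff 0 c
  have h1 := hT.isDualDeg_iff 1 c
  simp only [if_true, Fin.isValue, zero_ne_one, one_ne_zero, if_false] at h0 h1
  rw [h0, h1]
  constructor
  · rintro (⟨l, hl, h⟩ | h | h)
    · obtain ⟨hm, h⟩ := (hT.isDualChi_iff hl c).1 h
      exact ⟨.inl ⟨⟨-l, hm⟩, neg_ne_zero.2 hl⟩, Subtype.ext h.symm⟩
    · exact ⟨.inr 0, Subtype.ext h.symm⟩
    · exact ⟨.inr 1, Subtype.ext h.symm⟩
  · rintro ⟨m | i, rfl⟩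
    · refine Or.inl ⟨-(m : T.ctr), neg_ne_zero.2 m.2, (hT.isDualChi_iff (neg_ne_zero.2 m.2) _).2 ?_⟩
      obtain ⟨⟨m, hm⟩, hm0⟩ := m
      have : - -m = m := neg_neg m
      refine ⟨by simpa using hm, ?_⟩
      simp only [neg_neg]
      rfl
    · fin_cases i
      · exact Or.inr (Or.inl rfl)
      · exact Or.inr (Or.inr rfl)

end JordanTorus

end

section

/-! ### Jordan tori with integral structure constants -/

theorem linearIndependent_sumElim {V W ι κ : Type*} [AddCommGroup V] [Module ℂ V] [AddCommGroup W]
    [Module ℂ W] (p : V →ₗ[ℂ] W) {v : ι → V} {w : κ → V} (hv : LinearIndependent ℂ (p ∘ v))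
    (hw : LinearIndependent ℂ w) (hp : ∀ j, p (w j) = 0) :
    LinearIndependent ℂ (Sum.elim v w) := by
  refine LinearIndependent.sum_type (hv.of_comp p) hw ?_
  rw [Submodule.disjoint_def]
  intro x hx hx'
  have h0 : p x = 0 := by
    refine (Submodule.span_le.2 ?_ : Submodule.span ℂ (Set.range w) ≤ LinearMap.ker p) hx'
    rintro _ ⟨j, rfl⟩; exact hp j
  obtain ⟨c, rfl⟩ := (Finsupp.mem_span_range_iff_exists_finsupp).1 hx
  have h1 : c = 0 := by
    refine linearIndependent_iff.1 hv c ?_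
    rw [Finsupp.linearCombination_apply, ← h0, map_finsuppSum]
    simp
  simp [h1]

theorem JordanTorus.end_ext {J : Type} [NonAssocCommRing J] [Module ℂ J] (T : JordanTorus J)
    {S S' : Module.End ℂ J} (h : ∀ m, T.x m ≠ 0 → S (T.x m) = S' (T.x m)) : S = S' := by
  refine LinearMap.ext_on_range T.span_x fun m => ?_
  by_cases hm : T.x m = 0
  · rw [hm, map_zero, map_zero]
  · exact h m hm

variable {J : Type} [NonAssocCommRing J] [Module ℂ J] [IsScalarTower ℂ J J] [SMulCommClass ℂ J J]
  [IsCommJordan J]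

namespace JordanTorus

variable (T : JordanTorus J)

/-- The structure constants of `J` are integers, and the inner derivations have integral structure
constants with respect to operators `D l`, `l ∈ X`, of degree `l`. -/
structure IsIntegral (X : Set Lat) (D : Lat → Module.End ℂ J) : Prop extends T.IsNormalized where
  mul_int : ∀ l m, ∃ k : ℤ, T.x l * T.x m = (k : ℂ) • T.x (l + m)
  D_eq : ∀ l ∈ X, ∃ a b, ∃ k : ℤ, a + b = l ∧ D l = (k : ℂ) • ⁅L (T.x a), L (T.x b)⁆
  D_ne : ∀ l ∈ X, D l ≠ 0
  lie_eq : ∀ a b, ⁅L (T.x a), L (T.x b)⁆ = 0 ∨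
    a + b ∈ X ∧ ∃ k : ℤ, ⁅L (T.x a), L (T.x b)⁆ = (k : ℂ) • D (a + b)

variable {T} {X : Set Lat} {D : Lat → Module.End ℂ J}

namespace IsIntegral

theorem D_mem_inder (hT : T.IsIntegral X D) {l : Lat} (hl : l ∈ X) : D l ∈ inder J := by
  obtain ⟨a, b, k, -, h⟩ := hT.D_eq l hl
  rw [h]; exact Submodule.smul_mem _ _ (lie_L_mem_inder _ _)

theorem D_mem_opgr (hT : T.IsIntegral X D) {l : Lat} (hl : l ∈ X) : D l ∈ T.opgr l := by
  obtain ⟨a, b, k, rfl, h⟩ := hT.D_eq l hl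
  rw [h]; exact Submodule.smul_mem _ _ (T.lie_L_mem_opgr (T.x_mem a) (T.x_mem b))

theorem lie_x_int (hT : T.IsIntegral X D) (a b m : Lat) :
    ∃ k : ℤ, ⁅L (T.x a), L (T.x b)⁆ (T.x m) = (k : ℂ) • T.x (a + b + m) := by
  obtain ⟨k1, h1⟩ := hT.mul_int b m
  obtain ⟨k2, h2⟩ := hT.mul_int a (b + m)
  obtain ⟨k3, h3⟩ := hT.mul_int a m
  obtain ⟨k4, h4⟩ := hT.mul_int b (a + m)
  refine ⟨k1 * k2 - k3 * k4, ?_⟩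
  simp only [Ring.lie_def, LinearMap.sub_apply, Module.End.mul_apply, L_apply, h1, h3,
    mul_smul_comm, h2, h4]
  rw [show b + (a + m) = a + b + m by abel, show a + (b + m) = a + b + m by abel, smul_smul,
    smul_smul, ← sub_smul]
  push_cast; rfl

theorem D_x_int (hT : T.IsIntegral X D) {l : Lat} (hl : l ∈ X) (m : Lat) :
    ∃ k : ℤ, D l (T.x m) = (k : ℂ) • T.x (l + m) := by
  obtain ⟨a, b, k, rfl, h⟩ := hT.D_eq l hl
  obtain ⟨k', h'⟩ := hT.lie_x_int a b m
  refine ⟨k * k', ?_⟩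
  rw [h, LinearMap.smul_apply, h', smul_smul]; push_cast; rfl

/-- An inner derivation has no component of degree `0` in its image: the form `ε` is invariant. -/
theorem D_x_neg (hT : T.IsIntegral X D) {l : Lat} (hl : l ∈ X) {m : Lat} (hm : l + m = 0) :
    D l (T.x m) = 0 := by
  obtain ⟨k, hk⟩ := hT.D_x_int hl m
  have h0 : T.eps (D l (T.x m)) = 0 := by
    obtain ⟨a, b, k, rfl, h⟩ := hT.D_eq l hl
    have := T.eps_lie_swap (T.x a) (T.x b) (T.x m) 1
    have h1 : ⁅L (T.x m), L (1 : J)⁆ = 0 := by ext; simp [Ring.lie_def]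
    rw [h1, mul_one, LinearMap.zero_apply, zero_mul, map_zero] at this
    rw [h, LinearMap.smul_apply, map_smul, this, smul_zero]
  rw [hk, hm, map_smul, T.eps_x, if_pos rfl, smul_eq_mul, mul_one] at h0
  rw [hk, h0, zero_smul]

/-- The operators `D l` are nonzero and have different degrees. -/
theorem linearIndependent_D (hT : T.IsIntegral X D) : LinearIndependent ℂ (fun l : X => D l) := by
  refine linearIndependent_iff'.2 fun s g hg i hi => ?_
  have hm : ∃ m, D i (T.x m) ≠ 0 := by
    by_contra! hm
    refine hT.D_ne i i.2 (LinearMap.ext fun a => ?_)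
    induction a using T.induction_x with
    | hx l => rw [hm]; rfl
    | h0 => simp
    | hadd a b ha hb => rw [map_add, ha, hb]; simp
    | hsmul c a ha => rw [map_smul, ha]; simp
  obtain ⟨m, hm⟩ := hm
  obtain ⟨k, hk⟩ := hT.D_x_int i.2 m
  have hx : T.x (i + m) ≠ 0 := fun h => hm (by rw [hk, h, smul_zero])
  have h := congrArg (fun S => T.coef (i + m) (S (T.x m))) hg
  simp only [LinearMap.sum_apply, map_sum, LinearMap.smul_apply, map_smul, LinearMap.zero_apply,
    map_zero] at h
  rw [Finset.sum_eq_single i] at h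
  · rw [hk, map_smul, T.coef_x hx, if_pos rfl, smul_eq_mul, smul_eq_mul, mul_one] at h
    refine (mul_eq_zero.1 h).resolve_right fun h0 => hm ?_
    rw [hk, h0, zero_smul]
  · intro j _ hj
    rw [T.coef_eq_zero (fun h => hj (Subtype.ext (add_right_cancel h)))
      (T.opgr_apply (hT.D_mem_opgr j.2) (T.x_mem m)), smul_zero]
  · intro h; exact absurd hi h

variable (T D) in
/-- The basis of the inner structure algebra: the operators `2 L_1`, `L_{x^l}` and `D l`. -/
noncomputable def opFam : {l : Lat // T.x l ≠ 0} ⊕ X → Module.End ℂ J :=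
  Sum.elim (fun l => (if l.1 = 0 then 2 else 1 : ℂ) • L (T.x l)) fun l => D l

theorem opFam_mem (hT : T.IsIntegral X D) (i : {l : Lat // T.x l ≠ 0} ⊕ X) :
    opFam T D i ∈ instrl J := by
  rcases i with l | l
  · exact Submodule.smul_mem _ _ (L_mem _)
  · exact inder_le (hT.D_mem_inder l.2)

/-- Evaluation at `1` maps the operators `L_{x^l}` to independent elements and annihilates every
`D l`. -/
theorem linearIndependent_opFam (hT : T.IsIntegral X D) :
    LinearIndependent ℂ (opFam T (X := X) D) := by
  refine linearIndependent_sumElim (LinearMap.applyₗ (1 : J)) ?_ hT.linearIndependent_D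
    fun l => inder_one (hT.D_mem_inder l.2)
  have h : (LinearMap.applyₗ (1 : J) : Module.End ℂ J →ₗ[ℂ] J) ∘
      (fun l : {l : Lat // T.x l ≠ 0} => (if l.1 = 0 then 2 else 1 : ℂ) • L (T.x l)) =
      fun l : {l : Lat // T.x l ≠ 0} => (if l.1 = 0 then 2 else 1 : ℂ) • T.x l.1 := by
    funext l
    change ((_ : ℂ) • L (T.x l.1)) 1 = _
    rw [LinearMap.smul_apply, L_apply, mul_one]
  rw [h]
  have hu : ∀ l : Lat, (if l = 0 then 2 else 1 : ℂ) ≠ 0 := fun l => by split_ifs <;> norm_num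
  exact T.linInd.units_smul fun l => Units.mk0 _ (hu l.1)

theorem span_opFam (hT : T.IsIntegral X D) :
    Submodule.span ℂ (Set.range (opFam T (X := X) D)) = instrl J := by
  apply le_antisymm
  · rw [Submodule.span_le]
    rintro _ ⟨i, rfl⟩
    exact hT.opFam_mem i
  have hL (a : J) : L a ∈ Submodule.span ℂ (Set.range (opFam T (X := X) D)) := by
    induction a using T.induction_x with
    | hx l =>
      by_cases hl : T.x l = 0
      · rw [hl, L_zero]; exact zero_mem _
      · have h1 : opFam T (X := X) D (.inl ⟨l, hl⟩) ∈
          Submodule.span ℂ (Set.range (opFam T (X := X) D)) := Submodule.subset_span ⟨_, rfl⟩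
        have h2 : L (T.x l) = (if l = 0 then 2 else 1 : ℂ)⁻¹ •
            opFam T (X := X) D (.inl ⟨l, hl⟩) := by
          change _ = _ • (if l = 0 then 2 else 1 : ℂ) • L (T.x l)
          rw [smul_smul, inv_mul_cancel₀, one_smul]
          split_ifs <;> norm_num
        rw [h2]; exact Submodule.smul_mem _ _ h1
    | h0 => rw [L_zero]; exact zero_mem _
    | hadd a b ha hb => rw [L_add]; exact add_mem ha hb
    | hsmul c a ha => rw [L_smul]; exact Submodule.smul_mem _ _ ha
  refine sup_le (Submodule.span_le.2 ?_) (Submodule.span_le.2 ?_)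
  · rintro _ ⟨a, rfl⟩; exact hL a
  · rintro _ ⟨a, b, rfl⟩
    change _ ∈ Submodule.span ℂ (Set.range (opFam T (X := X) D))
    induction a using T.induction_x with
    | h0 => rw [L_zero, end_lie_swap, end_lie_zero, neg_zero]; exact zero_mem _
    | hadd a a' ha ha' =>
      rw [L_add, end_lie_swap, end_lie_add, neg_add, ← end_lie_swap, ← end_lie_swap]
      exact add_mem ha ha'
    | hsmul c a ha => rw [L_smul, end_smul_lie]; exact Submodule.smul_mem _ _ ha
    | hx l =>
    induction b using T.induction_x with
    | h0 => rw [L_zero, end_lie_zero]; exact zero_mem _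
    | hadd a a' ha ha' => rw [L_add, end_lie_add]; exact add_mem ha ha'
    | hsmul c a ha => rw [L_smul, end_lie_smul]; exact Submodule.smul_mem _ _ ha
    | hx m =>
      rcases hT.lie_eq l m with h | ⟨hX, k, h⟩
      · rw [h]; exact zero_mem _
      · rw [h]; exact Submodule.smul_mem _ _ (Submodule.subset_span ⟨.inr ⟨_, hX⟩, rfl⟩)

end IsIntegral
end JordanTorus

end

section

variable {J : Type} [NonAssocCommRing J] [Module ℂ J] [IsScalarTower ℂ J J] [SMulCommClass ℂ J J]
  [IsCommJordan J]

/-! ### Linear independence and spanning in the elliptic algebra -/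

namespace EALA

variable (T : JordanTorus J)

/-- The inclusion of `TKK(J)`. -/
def coreₗ : TKK J →ₗ[ℂ] EALA T where
  toFun u := ⟨u, 0, 0⟩
  map_add' _ _ := by ext1 <;> simp
  map_smul' _ _ := by ext1 <;> simp

/-- The inclusion of `J`. -/
def posₗ : J →ₗ[ℂ] EALA T where
  toFun a := ofPos T a
  map_add' _ _ := by ext1 <;> [ext1; skip; skip] <;> simp [ofPos]
  map_smul' _ _ := by ext1 <;> [ext1; skip; skip] <;> simp [ofPos]

/-- The inclusion of `J̄`. -/
def negₗ : J →ₗ[ℂ] EALA T where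
  toFun a := ofNeg T a
  map_add' _ _ := by ext1 <;> [ext1; skip; skip] <;> simp [ofNeg]
  map_smul' _ _ := by ext1 <;> [ext1; skip; skip] <;> simp [ofNeg]

/-- The inclusion of the inner structure algebra. -/
def opₗ : instrl J →ₗ[ℂ] EALA T where
  toFun a := ofOp T a
  map_add' _ _ := by ext1 <;> [ext1; skip; skip] <;> simp [ofOp]
  map_smul' _ _ := by ext1 <;> [ext1; skip; skip] <;> simp [ofOp]

/-- The inclusion of the graded dual of `SCDer`. -/
def centₗ : T.grDual →ₗ[ℂ] EALA T where
  toFun c := ofCent c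
  map_add' _ _ := by ext1 <;> simp [ofCent]
  map_smul' _ _ := by ext1 <;> simp [ofCent]

/-- The inclusion of `SCDer`. -/
def derₗ : T.scder →ₗ[ℂ] EALA T where
  toFun d := ofDer d
  map_add' _ _ := by ext1 <;> simp [ofDer]
  map_smul' _ _ := by ext1 <;> simp [ofDer]

/-- The projection onto `J`. -/
def prPos : EALA T →ₗ[ℂ] J where
  toFun u := u.core.pos
  map_add' _ _ := rfl
  map_smul' _ _ := rfl

/-- The projection onto `J̄`. -/
def prNeg : EALA T →ₗ[ℂ] J where
  toFun u := u.core.neg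
  map_add' _ _ := rfl
  map_smul' _ _ := rfl

/-- The projection onto the inner structure algebra. -/
def prOp : EALA T →ₗ[ℂ] Module.End ℂ J where
  toFun u := u.core.op
  map_add' _ _ := rfl
  map_smul' _ _ := rfl

/-- The projection onto the graded dual of `SCDer`. -/
def prCent : EALA T →ₗ[ℂ] T.grDual where
  toFun u := u.cent
  map_add' _ _ := rfl
  map_smul' _ _ := rfl

/-- The projection onto `SCDer`. -/
def prDer : EALA T →ₗ[ℂ] T.scder where
  toFun u := u.der
  map_add' _ _ := rfl
  map_smul' _ _ := rfl

end EALA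

namespace JordanTorus

open EALA

variable {T : JordanTorus J} {X : Set Lat} {D : Lat → Module.End ℂ J}

variable (T X D) in
/-- The operators in the root spaces of the nonzero isotropic roots. -/
def opSet : Set (Module.End ℂ J) :=
  {S | ∃ l : Lat, l ≠ 0 ∧ T.x l ≠ 0 ∧ S = L (T.x l)} ∪ {S | ∃ l ∈ X, S = D l}

theorem sqrt_two_ne_zero : (((√2 : ℝ) : ℂ)) ≠ 0 := by
  simp

theorem sqrt_two_mul_self : (((√2 : ℝ) : ℂ)) * ((√2 : ℝ) : ℂ) = 2 := by
  rw [← Complex.ofReal_mul, Real.mul_self_sqrt (by norm_num)]; norm_num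

namespace IsIntegral

/-- The basis of the elliptic algebra as an indexed family. -/
noncomputable def eFam (hT : T.IsIntegral X D) : {l : Lat // T.x l ≠ 0} ⊕ {l : Lat // T.x l ≠ 0} ⊕
    ({l : Lat // T.x l ≠ 0} ⊕ X) ⊕ T.DerIdx ⊕ T.DerIdx → EALA T :=
  Sum.elim (fun l => ofPos T (((√2 : ℝ) : ℂ) • T.x l)) <|
  Sum.elim (fun l => ofNeg T (((√2 : ℝ) : ℂ) • T.x l)) <|
  Sum.elim (fun i => ofOp T ⟨opFam T D i, hT.opFam_mem i⟩) <|
  Sum.elim (fun i => ofCent (centVec i)) (fun i => ofDer (derVec i))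

theorem linearIndependent_eFam (hT : T.IsIntegral X D) : LinearIndependent ℂ hT.eFam := by
  have hx : LinearIndependent ℂ fun l : {l : Lat // T.x l ≠ 0} => (((√2 : ℝ) : ℂ)) • T.x l :=
    T.linInd.units_smul fun _ => Units.mk0 _ sqrt_two_ne_zero
  refine linearIndependent_sumElim (prPos T) hx ?_ ?_
  · refine linearIndependent_sumElim (prNeg T) hx ?_ ?_
    · refine linearIndependent_sumElim (prOp T) hT.linearIndependent_opFam ?_ ?_
      · refine linearIndependent_sumElim (prCent T) hT.linearIndependent_centVec ?_ ?_
        · exact LinearIndependent.of_comp (prDer T) hT.linearIndependent_derVec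
        · intro i; rfl
      · rintro (i | i) <;> rfl
    · rintro (i | i | i) <;> rfl
  · rintro (i | i | i | i) <;> rfl

theorem span_eFam (hT : T.IsIntegral X D) : Submodule.span ℂ (Set.range hT.eFam) = ⊤ := by
  set P := Submodule.span ℂ (Set.range hT.eFam) with hP
  have hmem (i) : hT.eFam i ∈ P := Submodule.subset_span ⟨i, rfl⟩
  have key {V : Type} [AddCommGroup V] [Module ℂ V] (f : V →ₗ[ℂ] EALA T) (s : Set V)
      (hs : Submodule.span ℂ s = ⊤) (h : ∀ v ∈ s, f v ∈ P) (v : V) : f v ∈ P :=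
    (Submodule.span_le.2 h : Submodule.span ℂ s ≤ P.comap f) (by rw [hs]; trivial)
  have hdiv {v : EALA T} (h : ((√2 : ℝ) : ℂ) • v ∈ P) : v ∈ P := by
    have := Submodule.smul_mem P (((√2 : ℝ) : ℂ))⁻¹ h
    rwa [smul_smul, inv_mul_cancel₀ sqrt_two_ne_zero, one_smul] at this
  have hpos (a : J) : posₗ T a ∈ P := by
    refine key _ _ T.span_x ?_ a
    rintro _ ⟨l, rfl⟩
    by_cases hl : T.x l = 0
    · rw [hl, map_zero]; exact zero_mem _
    · refine hdiv ?_
      rw [← map_smul]; exact hmem (.inl ⟨l, hl⟩)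
  have hneg (a : J) : negₗ T a ∈ P := by
    refine key _ _ T.span_x ?_ a
    rintro _ ⟨l, rfl⟩
    by_cases hl : T.x l = 0
    · rw [hl, map_zero]; exact zero_mem _
    · refine hdiv ?_
      rw [← map_smul]; exact hmem (.inr (.inl ⟨l, hl⟩))
  have hop (S : instrl J) : opₗ T S ∈ P := by
    have h1 : (S : Module.End ℂ J) ∈ (P.comap (opₗ T)).map (instrl J).subtype := by
      have h2 := hT.span_opFam.ge S.2
      refine Submodule.span_le.2 ?_ h2
      rintro _ ⟨i, rfl⟩
      exact ⟨⟨_, hT.opFam_mem i⟩, hmem (.inr (.inr (.inl i))), rfl⟩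
    obtain ⟨S', h2, h3⟩ := h1
    rwa [← show S' = S from Subtype.ext h3]
  have hcent (c : T.grDual) : centₗ T c ∈ P := by
    refine key _ _ hT.span_centVec ?_ c
    rintro _ ⟨i, rfl⟩
    exact hmem (.inr (.inr (.inr (.inl i))))
  have hder (d : T.scder) : derₗ T d ∈ P := by
    refine key _ _ hT.span_derVec ?_ d
    rintro _ ⟨i, rfl⟩
    exact hmem (.inr (.inr (.inr (.inr i))))
  rw [eq_top_iff]
  rintro u -
  have hu : u = posₗ T u.core.pos + opₗ T u.core.op + negₗ T u.core.neg + centₗ T u.cent +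
      derₗ T u.der := by
    ext1 <;> [ext1; skip; skip] <;> simp [posₗ, opₗ, negₗ, centₗ, derₗ, ofPos, ofOp, ofNeg, ofCent,
      ofDer]
  rw [hu]
  exact add_mem (add_mem (add_mem (add_mem (hpos _) (hop _)) (hneg _)) (hcent _)) (hder _)

theorem range_eFam (hT : T.IsIntegral X D) : Set.range hT.eFam = T.basis (T.opSet X D) := by
  ext z
  constructor
  · rintro ⟨i | i | (i | i) | i | i, rfl⟩
    · exact Or.inl (Or.inl (Or.inl ⟨i, i.2, Or.inl rfl⟩))
    · exact Or.inl (Or.inl (Or.inl ⟨i, i.2, Or.inr rfl⟩))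
    · by_cases hi : i.1 = 0
      · refine Or.inr (Or.inl ?_)
        change ofOp T ⟨opFam T D (.inl i), _⟩ = _
        congr 1
        apply Subtype.ext
        change (if i.1 = 0 then 2 else 1 : ℂ) • L (T.x i) = (2 : ℂ) • L 1
        rw [hi, if_pos rfl, T.x_zero]
      · refine Or.inl (Or.inl (Or.inr ⟨_, Or.inl ⟨i, hi, i.2, ?_⟩, rfl⟩))
        change (if i.1 = 0 then 2 else 1 : ℂ) • L (T.x i) = L (T.x i)
        rw [if_neg hi, one_smul]
    · exact Or.inl (Or.inl (Or.inr ⟨_, Or.inr ⟨i, i.2, rfl⟩, rfl⟩))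
    · rcases (hT.cent_basis_iff (centVec i)).2 ⟨i, rfl⟩ with ⟨l, hl, h⟩ | h
      · exact Or.inl (Or.inr ⟨l, hl, Or.inr ⟨_, h, rfl⟩⟩)
      · exact Or.inr (Or.inr (Or.inr ⟨_, h, rfl⟩))
    · rcases (hT.scder_basis_iff (derVec i)).2 ⟨i, rfl⟩ with ⟨l, hl, h⟩ | h
      · exact Or.inl (Or.inr ⟨l, hl, Or.inl ⟨_, h, rfl⟩⟩)
      · exact Or.inr (Or.inr (Or.inl ⟨_, h, rfl⟩))
  · have hc {c : T.grDual} (h : c ∈ Set.range (centVec (T := T))) :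
        ofCent c ∈ Set.range hT.eFam := by
      obtain ⟨i, rfl⟩ := h; exact ⟨.inr (.inr (.inr (.inl i))), rfl⟩
    have hd {d : T.scder} (h : d ∈ Set.range (derVec (T := T))) :
        ofDer d ∈ Set.range hT.eFam := by
      obtain ⟨i, rfl⟩ := h; exact ⟨.inr (.inr (.inr (.inr i))), rfl⟩
    rintro (((⟨l, hl, rfl | rfl⟩ | ⟨S, ⟨l, h0, hl, hS⟩ | ⟨l, hl, hS⟩, rfl⟩) |
      ⟨l, hl, ⟨d, h, rfl⟩ | ⟨c, h, rfl⟩⟩) | (rfl | ⟨d, h, rfl⟩ | ⟨c, h, rfl⟩))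
    · exact ⟨.inl ⟨l, hl⟩, rfl⟩
    · exact ⟨.inr (.inl ⟨l, hl⟩), rfl⟩
    · refine ⟨.inr (.inr (.inl (.inl ⟨l, hl⟩))), ?_⟩
      change ofOp T ⟨opFam T D (.inl ⟨l, hl⟩), _⟩ = _
      congr 1
      apply Subtype.ext
      change (if l = 0 then 2 else 1 : ℂ) • L (T.x l) = S
      rw [if_neg h0, one_smul, hS]
    · refine ⟨.inr (.inr (.inl (.inr ⟨l, hl⟩))), ?_⟩
      change ofOp T ⟨opFam T D (.inr ⟨l, hl⟩), _⟩ = _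
      congr 1
      exact Subtype.ext hS.symm
    · exact hd ((hT.scder_basis_iff d).1 (Or.inl ⟨l, hl, h⟩))
    · exact hc ((hT.cent_basis_iff c).1 (Or.inl ⟨l, hl, h⟩))
    · have h0 : T.x 0 ≠ 0 := zero_mem_ctr.1
      refine ⟨.inr (.inr (.inl (.inl ⟨0, h0⟩))), ?_⟩
      change ofOp T ⟨opFam T D (.inl ⟨0, h0⟩), _⟩ = _
      congr 1
      apply Subtype.ext
      change (if (0 : Lat) = 0 then 2 else 1 : ℂ) • L (T.x 0) = (2 : ℂ) • L 1
      rw [if_pos rfl, T.x_zero]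
    · exact hd ((hT.scder_basis_iff d).1 (Or.inr h))
    · exact hc ((hT.cent_basis_iff c).1 (Or.inr h))

end IsIntegral
end JordanTorus

end

section

variable {J : Type} [NonAssocCommRing J] [Module ℂ J] [IsScalarTower ℂ J J] [SMulCommClass ℂ J J]
  [IsCommJordan J]

/-! ### Brackets of the components of the elliptic algebra -/

namespace EALA

variable {T : JordanTorus J}

theorem scderLie_zero (d : T.scder) : T.scderLie d 0 = 0 := by
  apply Subtype.ext; simp [T.scderLie_coe, Ring.lie_def]

theorem lie_core_core (u v : TKK J) : ⁅coreₗ T u, coreₗ T v⁆ =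
    coreₗ T ⁅u, v⁆ + ofCent ⟨T.cocyc u v, T.cocyc_mem u v⟩ := by
  ext1
  · simp [lie_core, coreₗ, ofCent]
  · ext d; simp [lie_cent, coreₗ, ofCent, T.cocyc_apply]
  · simp [lie_der, coreₗ, ofCent, T.scderLie_self]

theorem lie_der_core (d : T.scder) (u : TKK J) : ⁅ofDer d, coreₗ T u⁆ =
    coreₗ T ((d : Module.End ℂ (TKK J)) u) := by
  ext1
  · simp [lie_core, coreₗ, ofDer]
  · ext e; simp [lie_cent, coreₗ, ofDer]
  · simp [lie_der, coreₗ, ofDer, scderLie_zero]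

theorem lie_der_der (d e : T.scder) : (⁅ofDer d, ofDer e⁆ : EALA T) = ofDer (T.scderLie d e) := by
  ext1
  · simp [lie_core, ofDer]
  · ext f; simp [lie_cent, ofDer]
  · simp [lie_der, ofDer]

theorem lie_der_cent (d : T.scder) (c : T.grDual) : (⁅ofDer d, ofCent c⁆ : EALA T) =
    ofCent ⟨T.coact d c, T.coact_mem d c.2⟩ := by
  ext1
  · simp [lie_core, ofDer, ofCent]
  · ext e; simp [lie_cent, ofDer, ofCent, T.coact_apply]
  · simp [lie_der, ofDer, ofCent, scderLie_zero]

theorem lie_core_cent (u : TKK J) (c : T.grDual) : ⁅coreₗ T u, ofCent c⁆ = 0 := by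
  ext1
  · simp [lie_core, coreₗ, ofCent]
  · ext e; simp [lie_cent, coreₗ, ofCent, scderLie_zero]
  · simp [lie_der, coreₗ, ofCent, scderLie_zero]

theorem lie_cent_cent (b c : T.grDual) : (⁅ofCent b, ofCent c⁆ : EALA T) = 0 := by
  ext1
  · simp [lie_core, ofCent]
  · ext e; simp [lie_cent, ofCent, scderLie_zero]
  · simp [lie_der, ofCent, scderLie_zero]

end EALA

namespace JordanTorus

open EALA

variable {T : JordanTorus J} {X : Set Lat} {D : Lat → Module.End ℂ J}

/-! ### Brackets of skew centroidal derivations -/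

theorem IsNormalized.chiDer_lie (hT : T.IsNormalized) (m n : T.ctr) (θ ψ : Lat →+ ℂ) :
    ⁅T.chiDer m θ, T.chiDer n ψ⁆ =
      T.chiDer ⟨m + n, hT.add_mem_ctr m.2 n.2⟩ (θ n • ψ - ψ m • θ) := by
  have e1 := (T.isDegDer_degDer θ).comp_endgr (toEnd_mem_endgr n.2.2)
  have e2 := (T.isDegDer_degDer ψ).comp_endgr (toEnd_mem_endgr m.2.2)
  have hmn := hT.toEnd_mul m.2 n.2
  have hnm := centroid_comm T n.2.2.toEnd_mem_centroid m.2.2.toEnd_mem_centroid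
  have hδ := (T.isDegDer_degDer θ).comm (T.isDegDer_degDer ψ)
  have e3 : T.degDer (θ n • ψ - ψ m • θ) = θ n • T.degDer ψ - ψ m • T.degDer θ := by
    rw [sub_eq_add_neg, ← neg_smul, degDer_add, degDer_smul, degDer_smul, neg_smul, sub_eq_add_neg]
  simp only [chiDer]
  rw [e3, ← hmn, Ring.lie_def]
  calc m.2.2.toEnd * T.degDer θ * (n.2.2.toEnd * T.degDer ψ) -
        n.2.2.toEnd * T.degDer ψ * (m.2.2.toEnd * T.degDer θ)
      = m.2.2.toEnd * (T.degDer θ * n.2.2.toEnd) * T.degDer ψ -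
        n.2.2.toEnd * (T.degDer ψ * m.2.2.toEnd) * T.degDer θ := by noncomm_ring
    _ = m.2.2.toEnd * n.2.2.toEnd * (T.degDer θ * T.degDer ψ) +
        θ n • (m.2.2.toEnd * n.2.2.toEnd * T.degDer ψ) -
        (n.2.2.toEnd * m.2.2.toEnd * (T.degDer ψ * T.degDer θ) +
          ψ m • (n.2.2.toEnd * m.2.2.toEnd * T.degDer θ)) := by
        rw [e1, e2]
        simp only [mul_add, add_mul, mul_smul_comm, smul_mul_assoc, mul_assoc]
    _ = _ := by
        rw [hnm, hδ, mul_sub, mul_smul_comm, mul_smul_comm]; abel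

/-- The integral span of the basis of `SCDer` is closed under the commutator: for elements
`χ^m ∂_{θ_m}` and `χ^n ∂_{θ_n}` it is `θ_m(n) χ^{m+n} ∂_{θ_{m+n}}`, as `θ_n(m) = -θ_m(n)`. -/
theorem IsNormalized.scderLie_derVec (hT : T.IsNormalized) (i j : T.DerIdx) :
    T.scderLie (derVec i) (derVec j) ∈ AddSubgroup.closure (Set.range (derVec (T := T))) := by
  have hmem (m : T.ctr) (h : T.chiDer m (thetaOf m) ∈ T.scder) :
      (⟨T.chiDer m (thetaOf m), h⟩ : T.scder) ∈
        AddSubgroup.closure (Set.range (derVec (T := T))) := by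
    by_cases hm : (m : Lat) = 0
    · have : (⟨T.chiDer m (thetaOf m), h⟩ : T.scder) = 0 := by
        apply Subtype.ext
        have h0 : thetaOf m = 0 := by
          refine AddMonoidHom.ext fun l => ?_
          rw [thetaOf_apply, hm]; simp
        change T.chiDer m (thetaOf m) = 0
        rw [h0, chiDer_zero]
      rw [this]; exact zero_mem _
    · exact AddSubgroup.subset_closure ⟨.inl ⟨m, hm⟩, rfl⟩
  have hint (d : T.scder) (m : T.ctr) (k : ℤ)
      (h : (d : Module.End ℂ (TKK J)) = T.chiDer m ((k : ℂ) • thetaOf m)) :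
      d ∈ AddSubgroup.closure (Set.range (derVec (T := T))) := by
    have h1 : d = (k : ℂ) • ⟨T.chiDer m (thetaOf m), chiDer_mem_scder m (thetaOf_self m)⟩ := by
      apply Subtype.ext; rw [h, chiDer_smul]; rfl
    rw [h1]
    exact intCast_smul_mem _ (hmem _ _) k
  have hcoe := T.scderLie_coe (derVec i) (derVec j)
  rw [derVec_coe, derVec_coe, hT.chiDer_lie] at hcoe
  rcases i with m | i <;> rcases j with n | j
  · refine hint _ ⟨_, hT.add_mem_ctr m.1.2 n.1.2⟩ (((m : T.ctr) : Lat).2 * ((n : T.ctr) : Lat).1 -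
      ((m : T.ctr) : Lat).1 * ((n : T.ctr) : Lat).2) (hcoe.trans ?_)
    congr 1
    change thetaOf (m : T.ctr) (n : T.ctr) • thetaOf (n : T.ctr) -
      thetaOf (n : T.ctr) (m : T.ctr) • thetaOf (m : T.ctr) =
      _ • thetaOf ((m : T.ctr) + (n : T.ctr) : Lat)
    refine AddMonoidHom.ext fun l => ?_
    rw [thetaOf_add]
    simp only [AddMonoidHom.sub_apply, AddMonoidHom.smul_apply, AddMonoidHom.add_apply,
      thetaOf_apply, smul_eq_mul]
    push_cast; ring
  · obtain ⟨k, hk⟩ := derTheta_int (T := T) (.inr j) (m : T.ctr)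
    refine hint _ m (-k) (hcoe.trans ?_)
    have e : (⟨(derCtr (.inl m) : T.ctr) + (derCtr (.inr j) : T.ctr),
      hT.add_mem_ctr (derCtr (.inl m)).2 (derCtr (.inr j)).2⟩ : T.ctr) = m :=
      Subtype.ext (add_zero _)
    rw [e]
    congr 1
    change derTheta (.inl m) 0 • _ - derTheta (.inr j) (m : T.ctr) • thetaOf (m : T.ctr) = _
    rw [hk, map_zero, zero_smul, zero_sub]; push_cast; rw [neg_smul]
  · obtain ⟨k, hk⟩ := derTheta_int (T := T) (.inr i) (n : T.ctr)
    refine hint _ n k (hcoe.trans ?_)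
    have e : (⟨(derCtr (.inr i) : T.ctr) + (derCtr (.inl n) : T.ctr),
      hT.add_mem_ctr (derCtr (.inr i)).2 (derCtr (.inl n)).2⟩ : T.ctr) = n :=
      Subtype.ext (zero_add _)
    rw [e]
    congr 1
    change derTheta (.inr i) (n : T.ctr) • thetaOf (n : T.ctr) - derTheta (.inl n) 0 • _ = _
    rw [hk, map_zero, zero_smul, sub_zero]
  · have : T.scderLie (derVec (.inr i)) (derVec (.inr j)) = 0 := by
      apply Subtype.ext
      rw [hcoe]
      change T.chiDer _ (derTheta (.inr i) 0 • _ - derTheta (.inr j) 0 • _) = 0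
      rw [map_zero, map_zero, zero_smul, zero_smul, sub_zero, chiDer_zero]
    rw [this]; exact zero_mem _

theorem cocyc_mem_dualgr {l m : Lat} {u v : TKK J} (hu : u ∈ T.gr l) (hv : v ∈ T.gr m) :
    T.cocyc u v ∈ T.dualgr (-(l + m)) := fun n hn d hd => by
  refine T.form_gr (fun h => hn ?_) (hd l u hu) hv
  rw [eq_neg_iff_add_eq_zero, ← h]; abel

theorem coact_mem_dualgr {m n : Lat} {d : T.scder} (hd : d ∈ T.scdergr n)
    {φ : Module.Dual ℂ T.scder} (hφ : φ ∈ T.dualgr m) : T.coact d φ ∈ T.dualgr (m - n) := by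
  intro k hk d' hd'
  rw [coact_apply]
  refine hφ (k + n) (fun h => hk (by rw [← h]; abel)) _ ?_
  exact endgr_lie (T := T) hd' hd

/-- The values of `c_D(u, v)` on the basis of `SCDer` are integral multiples of `(χ^n(u), v)`. -/
theorem IsNormalized.cocyc_int (hT : T.IsNormalized) {l m : Lat} {u v : TKK J} (hu : u ∈ T.gr l)
    (hv : v ∈ T.gr m) (h : ∀ n : T.ctr, ∃ k : ℤ, T.form (n.2.2.toEnd u) v = k) :
    (⟨T.cocyc u v, T.cocyc_mem u v⟩ : T.grDual) ∈
      AddSubgroup.closure (Set.range (centVec (T := T))) := by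
  refine hT.mem_closure_centVec (cocyc_mem_dualgr hu hv) fun i => ?_
  obtain ⟨k, hk⟩ := h (derCtr i)
  obtain ⟨k', hk'⟩ := derTheta_int i l
  refine ⟨k' * k, ?_⟩
  change T.form (T.chiDer (derCtr i) (derTheta i) u) v = _
  rw [chiDer_apply hu, map_smul, LinearMap.smul_apply, hk, hk']
  simp

theorem IsNormalized.coact_int (hT : T.IsNormalized) (i j : T.DerIdx) :
    (⟨T.coact (derVec i) (centVec j), T.coact_mem _ (centVec j).2⟩ : T.grDual) ∈
      AddSubgroup.closure (Set.range (centVec (T := T))) := by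
  classical
  refine hT.mem_closure_centVec (coact_mem_dualgr (derVec_mem i) (derDual_mem j)) fun r => ?_
  change ∃ k : ℤ, derDual j (T.scderLie (derVec r) (derVec i)) = k
  have h := hT.scderLie_derVec r i
  generalize T.scderLie (derVec r) (derVec i) = d at h
  induction h using AddSubgroup.closure_induction with
  | mem x hx =>
    obtain ⟨s, rfl⟩ := hx
    rw [hT.derDual_derVec]
    split_ifs
    · exact ⟨1, by simp⟩
    · exact ⟨0, by simp⟩
  | zero => exact ⟨0, by simp⟩
  | add x y _ _ hx hy =>
    obtain ⟨a, ha⟩ := hx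
    obtain ⟨b, hb⟩ := hy
    exact ⟨a + b, by rw [map_add, ha, hb]; simp⟩
  | neg x _ hx =>
    obtain ⟨a, ha⟩ := hx
    exact ⟨-a, by rw [map_neg, ha]; simp⟩

end JordanTorus

end

section

variable {J : Type} [NonAssocCommRing J] [Module ℂ J] [IsScalarTower ℂ J J] [SMulCommClass ℂ J J]
  [IsCommJordan J]

/-! ### The integral span of the basis -/

namespace JordanTorus

open EALA

variable {T : JordanTorus J} {X : Set Lat} {D : Lat → Module.End ℂ J}

variable (T X D) in
/-- The integral span of the basis of the elliptic algebra. -/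
def intSpan : AddSubgroup (EALA T) := AddSubgroup.closure (T.basis (T.opSet X D))

variable (T X D) in
/-- The operators in the inner structure algebra that belong to the integral span of the basis. -/
def opInt : AddSubgroup (Module.End ℂ J) :=
  ((T.intSpan X D).comap (opₗ T).toAddMonoidHom).map (instrl J).subtype.toAddMonoidHom

variable (T) in
/-- The integral span of the operators `x^a △ x^b`. -/
def triInt : AddSubgroup (instrl J) :=
  AddSubgroup.closure {S | ∃ a b, S = tri (T.x a) (T.x b)}

theorem ofOp_mem_intSpan {S : instrl J} (hS : (S : Module.End ℂ J) ∈ T.opInt X D) :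
    coreₗ T ⟨0, S, 0⟩ ∈ T.intSpan X D := by
  obtain ⟨S', h1, h2⟩ := hS
  rwa [← show S' = S from Subtype.ext h2]

variable (T X D) in
/-- The operators that occur in the basis of the elliptic algebra. -/
inductive IsBasisOp : Lat → instrl J → Prop
  | two_L : IsBasisOp 0 ((2 : ℂ) • ⟨L 1, L_mem 1⟩)
  | L (l : Lat) (hl : l ≠ 0) : IsBasisOp l ⟨L (T.x l), L_mem _⟩
  | D (l : Lat) (hl : l ∈ X) (S : instrl J) (hS : (S : Module.End ℂ J) = D l) : IsBasisOp l S

namespace IsIntegral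

theorem eFam_mem (hT : T.IsIntegral X D) (i) : hT.eFam i ∈ T.intSpan X D :=
  AddSubgroup.subset_closure (hT.range_eFam ▸ Set.mem_range_self i)

theorem pos_mem (hT : T.IsIntegral X D) (l : Lat) (k : ℤ) :
    coreₗ T ⟨(k : ℂ) • ((√2 : ℝ) : ℂ) • T.x l, 0, 0⟩ ∈ T.intSpan X D := by
  have h1 : coreₗ T ⟨(k : ℂ) • ((√2 : ℝ) : ℂ) • T.x l, 0, 0⟩ =
      (k : ℂ) • posₗ T (((√2 : ℝ) : ℂ) • T.x l) := by
    rw [← map_smul]; rfl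
  rw [h1]
  refine intCast_smul_mem _ ?_ k
  by_cases hl : T.x l = 0
  · rw [hl, smul_zero, map_zero]; exact zero_mem _
  · exact hT.eFam_mem (.inl ⟨l, hl⟩)

theorem neg_mem' (hT : T.IsIntegral X D) (l : Lat) (k : ℤ) :
    coreₗ T ⟨0, 0, (k : ℂ) • ((√2 : ℝ) : ℂ) • T.x l⟩ ∈ T.intSpan X D := by
  have h1 : coreₗ T ⟨0, 0, (k : ℂ) • ((√2 : ℝ) : ℂ) • T.x l⟩ =
      (k : ℂ) • negₗ T (((√2 : ℝ) : ℂ) • T.x l) := by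
    rw [← map_smul]; rfl
  rw [h1]
  refine intCast_smul_mem _ ?_ k
  by_cases hl : T.x l = 0
  · rw [hl, smul_zero, map_zero]; exact zero_mem _
  · exact hT.eFam_mem (.inr (.inl ⟨l, hl⟩))

theorem der_mem (hT : T.IsIntegral X D) {d : T.scder}
    (hd : d ∈ AddSubgroup.closure (Set.range (derVec (T := T)))) : ofDer d ∈ T.intSpan X D := by
  have : AddSubgroup.closure (Set.range (derVec (T := T))) ≤
      (T.intSpan X D).comap (derₗ T).toAddMonoidHom := by
    rw [AddSubgroup.closure_le]
    rintro _ ⟨i, rfl⟩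
    exact hT.eFam_mem (.inr (.inr (.inr (.inr i))))
  exact this hd

theorem cent_mem (hT : T.IsIntegral X D) {c : T.grDual}
    (hc : c ∈ AddSubgroup.closure (Set.range (centVec (T := T)))) : ofCent c ∈ T.intSpan X D := by
  have : AddSubgroup.closure (Set.range (centVec (T := T))) ≤
      (T.intSpan X D).comap (centₗ T).toAddMonoidHom := by
    rw [AddSubgroup.closure_le]
    rintro _ ⟨i, rfl⟩
    exact hT.eFam_mem (.inr (.inr (.inr (.inl i))))
  exact this hc

theorem opFam_mem_opInt (hT : T.IsIntegral X D) (i) : opFam T (X := X) D i ∈ T.opInt X D :=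
  ⟨⟨_, hT.opFam_mem i⟩, hT.eFam_mem (.inr (.inr (.inl i))), rfl⟩

theorem D_mem_opInt (hT : T.IsIntegral X D) {l : Lat} (hl : l ∈ X) : D l ∈ T.opInt X D :=
  hT.opFam_mem_opInt (.inr ⟨l, hl⟩)

theorem L_mem_opInt (hT : T.IsIntegral X D) {l : Lat} (hl : l ≠ 0) : L (T.x l) ∈ T.opInt X D := by
  by_cases h : T.x l = 0
  · rw [h, L_zero]; exact zero_mem _
  · have h1 := hT.opFam_mem_opInt (.inl ⟨l, h⟩)
    have h2 : opFam T (X := X) D (.inl ⟨l, h⟩) = L (T.x l) := by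
      change (if l = 0 then 2 else 1 : ℂ) • L (T.x l) = _
      rw [if_neg hl, one_smul]
    rwa [h2] at h1

/-- In degree `0` the integral span contains `2 L_1`, but not `L_1`; the factors `√2` double the
operator `L_{ab}` in the brackets of basis elements of `J` with those of its second copy. -/
theorem two_L_mem_opInt (hT : T.IsIntegral X D) (l : Lat) :
    (2 : ℂ) • L (T.x l) ∈ T.opInt X D := by
  by_cases hl : l = 0
  · subst hl
    have h1 := hT.opFam_mem_opInt (.inl ⟨0, zero_mem_ctr.1⟩)
    have h2 : opFam T (X := X) D (.inl ⟨0, zero_mem_ctr.1⟩) = (2 : ℂ) • L (T.x 0) := by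
      change (if (0 : Lat) = 0 then 2 else 1 : ℂ) • L (T.x 0) = _
      rw [if_pos rfl]
    rwa [h2] at h1
  · rw [two_smul]; exact add_mem (hT.L_mem_opInt hl) (hT.L_mem_opInt hl)

theorem lie_mem_opInt (hT : T.IsIntegral X D) (a b : Lat) :
    ⁅L (T.x a), L (T.x b)⁆ ∈ T.opInt X D := by
  rcases hT.lie_eq a b with h | ⟨hX, k, h⟩
  · rw [h]; exact zero_mem _
  · rw [h]; exact intCast_smul_mem _ (hT.D_mem_opInt hX) k

theorem isBasisOp_opgr (hT : T.IsIntegral X D) {l : Lat} {S : instrl J} (hS : T.IsBasisOp X D l S) :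
    (S : Module.End ℂ J) ∈ T.opgr l := by
  cases hS with
  | two_L => exact Submodule.smul_mem _ _ (T.L_mem_opgr T.one_mem_jgr)
  | L l hl => exact T.L_mem_opgr (T.x_mem l)
  | D l hl S hS => rw [hS]; exact hT.D_mem_opgr hl

theorem isBasisOp_mem_gr (hT : T.IsIntegral X D) {l : Lat} {S : instrl J}
    (hS : T.IsBasisOp X D l S) : (⟨0, S, 0⟩ : TKK J) ∈ T.gr l :=
  ⟨zero_mem _, hT.isBasisOp_opgr hS, zero_mem _⟩

theorem isBasisOp_x (hT : T.IsIntegral X D) {l : Lat} {S : instrl J} (hS : T.IsBasisOp X D l S)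
    (m : Lat) : (∃ k : ℤ, (S : Module.End ℂ J) (T.x m) = (k : ℂ) • T.x (l + m)) ∧
      ∃ k : ℤ, (bar S : Module.End ℂ J) (T.x m) = (k : ℂ) • T.x (l + m) := by
  have hbar {k k' : ℤ} (h : (S : Module.End ℂ J) (T.x m) = (k : ℂ) • T.x (l + m))
      (h' : (S : Module.End ℂ J) 1 * T.x m = (k' : ℂ) • T.x (l + m)) :
      ∃ k : ℤ, (bar S : Module.End ℂ J) (T.x m) = (k : ℂ) • T.x (l + m) := by
    refine ⟨k - 2 * k', ?_⟩
    rw [bar_coe, LinearMap.sub_apply, LinearMap.smul_apply, L_apply, h, h', smul_smul, ← sub_smul]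
    push_cast; rfl
  cases hS with
  | two_L =>
    have h : (((2 : ℂ) • ⟨L 1, L_mem 1⟩ : instrl J) : Module.End ℂ J) (T.x m) =
        ((2 : ℤ) : ℂ) • T.x (0 + m) := by simp
    refine ⟨⟨2, h⟩, hbar h (k' := 2) ?_⟩
    simp
  | L l hl =>
    obtain ⟨k, hk⟩ := hT.mul_int l m
    refine ⟨⟨k, hk⟩, hbar hk (k' := k) ?_⟩
    rw [← hk]; simp
  | D l hl S hS =>
    obtain ⟨k, hk⟩ := hT.D_x_int hl m
    rw [← hS] at hk
    refine ⟨⟨k, hk⟩, hbar hk (k' := 0) ?_⟩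
    rw [hS, inder_one (hT.D_mem_inder hl)]; simp

theorem isBasisOp_mem_triInt (hT : T.IsIntegral X D) {l : Lat} {S : instrl J}
    (hS : T.IsBasisOp X D l S) : S ∈ T.triInt := by
  have htri (a b : Lat) : tri (T.x a) (T.x b) ∈ T.triInt := AddSubgroup.subset_closure ⟨a, b, rfl⟩
  have hone : ∀ a : J, ⁅L a, L (1 : J)⁆ = 0 := by
    intro a; ext; simp [Ring.lie_def]
  have hL (l : Lat) : (⟨L (T.x l), L_mem _⟩ : instrl J) ∈ T.triInt := by
    convert htri l 0 using 1
    apply Subtype.ext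
    simp [tri_coe, T.x_zero, hone]
  cases hS with
  | two_L =>
    rw [two_smul]
    have := hL 0
    simp only [T.x_zero] at this
    exact add_mem this this
  | L l hl => exact hL l
  | D l hl S hS =>
    obtain ⟨a, b, k, rfl, h⟩ := hT.D_eq l hl
    obtain ⟨k', hk'⟩ := hT.mul_int a b
    have h1 : S = (k : ℂ) • (tri (T.x a) (T.x b) - (k' : ℂ) • ⟨L (T.x (a + b)), L_mem _⟩) := by
      apply Subtype.ext
      rw [hS, h]
      simp [tri_coe, hk', L_smul]
    rw [h1]
    exact intCast_smul_mem _ (sub_mem (htri a b) (intCast_smul_mem _ (hL _) k')) k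

theorem eps_mul_int (hT : T.IsIntegral X D) (a b : Lat) :
    ∃ k : ℤ, T.eps (T.x a * T.x b) = k := by
  obtain ⟨k, hk⟩ := hT.mul_int a b
  rw [hk, map_smul, T.eps_x]
  split_ifs
  · exact ⟨k, by simp⟩
  · exact ⟨0, by simp⟩

/-- The form of `Instrl(J)` is determined by `(S, a △ b) = ε(S(a) b)`, so it is integral on the
operators `x^a △ x^b`. -/
theorem opForm_int (hT : T.IsIntegral X D) {l : Lat} {S : instrl J}
    (hS : ∀ m, ∃ k : ℤ, (S : Module.End ℂ J) (T.x m) = (k : ℂ) • T.x (l + m)) {F : instrl J}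
    (hF : F ∈ T.triInt) : ∃ k : ℤ, T.opForm S F = k := by
  induction hF using AddSubgroup.closure_induction with
  | mem x hx =>
    obtain ⟨a, b, rfl⟩ := hx
    obtain ⟨k, hk⟩ := hS a
    obtain ⟨k', hk'⟩ := hT.eps_mul_int (l + a) b
    exact ⟨k * k', by rw [opForm_tri, hk, smul_mul_assoc, map_smul, hk']; simp⟩
  | zero => exact ⟨0, by simp⟩
  | add x y _ _ hx hy =>
    obtain ⟨a, ha⟩ := hx
    obtain ⟨b, hb⟩ := hy
    exact ⟨a + b, by rw [map_add, ha, hb]; simp⟩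
  | neg x _ hx =>
    obtain ⟨a, ha⟩ := hx
    exact ⟨-a, by rw [map_neg, ha]; simp⟩

theorem lie_D_L_mem (hT : T.IsIntegral X D) {l : Lat} (hl : l ∈ X) (m : Lat) :
    ⁅D l, L (T.x m)⁆ ∈ T.opInt X D := by
  rw [inder_lie_L (hT.D_mem_inder hl)]
  by_cases h : l + m = 0
  · rw [hT.D_x_neg hl h, L_zero]; exact zero_mem _
  · obtain ⟨k, hk⟩ := hT.D_x_int hl m
    rw [hk, L_smul]
    exact intCast_smul_mem _ (hT.L_mem_opInt h) k

theorem isBasisOp_lie (hT : T.IsIntegral X D) {l m : Lat} {S F : instrl J}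
    (hS : T.IsBasisOp X D l S) (hF : T.IsBasisOp X D m F) :
    ⁅(S : Module.End ℂ J), (F : Module.End ℂ J)⁆ ∈ T.opInt X D := by
  have hL1 : (L 1 : Module.End ℂ J) = 1 := by ext; simp
  have h2 : ∀ A : Module.End ℂ J,
      ⁅(((2 : ℂ) • ⟨L 1, L_mem 1⟩ : instrl J) : Module.End ℂ J), A⁆ = 0 := by
    intro A; simp [Ring.lie_def, hL1]
  cases hS with
  | two_L => rw [h2]; exact zero_mem _
  | L l hl =>
    cases hF with
    | two_L => rw [end_lie_swap, h2, neg_zero]; exact zero_mem _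
    | L m hm => exact hT.lie_mem_opInt l m
    | D m hm F hF => rw [end_lie_swap, hF]; exact neg_mem (hT.lie_D_L_mem hm l)
  | D l hl S hS =>
    rw [hS]
    cases hF with
    | two_L => rw [end_lie_swap, h2, neg_zero]; exact zero_mem _
    | L m hm => exact hT.lie_D_L_mem hl m
    | D m hm F hF =>
      obtain ⟨a, b, k, -, h⟩ := hT.D_eq m hm
      obtain ⟨k1, h1⟩ := hT.D_x_int hl a
      obtain ⟨k2, h2⟩ := hT.D_x_int hl b
      rw [hF, h, end_lie_smul, inder_lie_lie (hT.D_mem_inder hl), h1, h2, L_smul, L_smul,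
        end_smul_lie, end_lie_smul]
      exact intCast_smul_mem _ (add_mem (intCast_smul_mem _ (hT.lie_mem_opInt _ _) k1)
        (intCast_smul_mem _ (hT.lie_mem_opInt _ _) k2)) k

theorem toEnd_op_x (hT : T.IsIntegral X D) (n : T.ctr) {l : Lat} {S : instrl J}
    (hS : T.IsBasisOp X D l S) (m : Lat) : ∃ k : ℤ,
      ((n.2.2.toEnd ⟨0, S, 0⟩).op : Module.End ℂ J) (T.x m) = (k : ℂ) • T.x (n + l + m) := by
  obtain ⟨k, hk⟩ := (hT.isBasisOp_x hS m).1
  refine ⟨k, ?_⟩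
  rw [n.2.2.toEnd_op]
  change T.x n * (S : Module.End ℂ J) (T.x m) = _
  rw [hk, mul_smul_comm, hT.ctr_mul n n.2, add_assoc]

/-- A derivation `χ^n ∂_{θ_n}` maps an operator of the basis to an integral combination: in degree
`0`, where the integral span of the operators is smaller, the image vanishes as `θ_n(-n) = 0`. -/
theorem der_op_mem (hT : T.IsIntegral X D) (i : T.DerIdx) {l : Lat} {S : instrl J}
    (hS : T.IsBasisOp X D l S) :
    (((derVec i : Module.End ℂ (TKK J)) ⟨0, S, 0⟩).op : Module.End ℂ J) ∈ T.opInt X D := by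
  rw [derVec_coe, chiDer_apply (hT.isBasisOp_mem_gr hS)]
  change derTheta i l • (L (T.x (derCtr i)) * (S : Module.End ℂ J)) ∈ T.opInt X D
  obtain ⟨k, hk⟩ := derTheta_int i l
  have hc := (derCtr i).2
  cases hS with
  | two_L => rw [map_zero, zero_smul]; exact zero_mem _
  | L l hl =>
    by_cases h : (derCtr i : Lat) + l = 0
    · have h1 : derTheta i l = 0 := by
        rw [eq_neg_of_add_eq_zero_right h, map_neg, derTheta_self, neg_zero]
      rw [h1, zero_smul]; exact zero_mem _
    · rw [hk]
      refine intCast_smul_mem _ ?_ k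
      change L (T.x (derCtr i)) * L (T.x l) ∈ _
      rw [← hc.2.L_mul, hT.ctr_mul _ hc]
      exact hT.L_mem_opInt h
  | D l hl S hS =>
    rw [hk, hS]
    refine intCast_smul_mem _ ?_ k
    obtain ⟨a, b, k', -, h'⟩ := hT.D_eq l hl
    rw [h', mul_smul_comm, hc.2.L_mul_lie, hT.ctr_mul _ hc]
    exact intCast_smul_mem _ (hT.lie_mem_opInt _ _) k'

end IsIntegral
end JordanTorus

end

section

variable {J : Type} [NonAssocCommRing J] [Module ℂ J] [IsScalarTower ℂ J J] [SMulCommClass ℂ J J]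
  [IsCommJordan J]

/-! ### Brackets of the basis -/

namespace JordanTorus

open EALA

variable {T : JordanTorus J} {X : Set Lat} {D : Lat → Module.End ℂ J}

namespace IsIntegral

theorem pos_mem_gr (c : ℂ) (l : Lat) : (⟨c • T.x l, 0, 0⟩ : TKK J) ∈ T.gr l :=
  ⟨Submodule.smul_mem _ _ (T.x_mem l), zero_mem (T.opgr l), zero_mem _⟩

theorem neg_mem_gr (c : ℂ) (l : Lat) : (⟨0, 0, c • T.x l⟩ : TKK J) ∈ T.gr l :=
  ⟨zero_mem _, zero_mem (T.opgr l), Submodule.smul_mem _ _ (T.x_mem l)⟩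

theorem core_lie_mem (hT : T.IsIntegral X D) {l m : Lat} {u v : TKK J} (hu : u ∈ T.gr l)
    (hv : v ∈ T.gr m) (h1 : coreₗ T ⁅u, v⁆ ∈ T.intSpan X D)
    (h2 : ∀ n : T.ctr, ∃ k : ℤ, T.form (n.2.2.toEnd u) v = k) :
    ⁅coreₗ T u, coreₗ T v⁆ ∈ T.intSpan X D := by
  rw [lie_core_core]
  exact add_mem h1 (hT.cent_mem (hT.cocyc_int hu hv h2))

theorem pos_pos (hT : T.IsIntegral X D) (l m : Lat) :
    ⁅coreₗ T ⟨((√2 : ℝ) : ℂ) • T.x l, 0, 0⟩, coreₗ T ⟨((√2 : ℝ) : ℂ) • T.x m, 0, 0⟩⁆ ∈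
      T.intSpan X D := by
  refine hT.core_lie_mem (pos_mem_gr _ l) (pos_mem_gr _ m) ?_ fun n => ⟨0, ?_⟩
  · rw [TKK.lie_pos_pos, map_zero]; exact zero_mem _
  · simp [form_apply, IsCentral.toEnd_neg]

theorem neg_neg (hT : T.IsIntegral X D) (l m : Lat) :
    ⁅coreₗ T ⟨0, 0, ((√2 : ℝ) : ℂ) • T.x l⟩, coreₗ T ⟨0, 0, ((√2 : ℝ) : ℂ) • T.x m⟩⁆ ∈
      T.intSpan X D := by
  refine hT.core_lie_mem (neg_mem_gr _ l) (neg_mem_gr _ m) ?_ fun n => ⟨0, ?_⟩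
  · rw [TKK.lie_neg_neg, map_zero]; exact zero_mem _
  · simp [form_apply, IsCentral.toEnd_pos]

theorem pos_neg (hT : T.IsIntegral X D) (l m : Lat) :
    ⁅coreₗ T ⟨((√2 : ℝ) : ℂ) • T.x l, 0, 0⟩, coreₗ T ⟨0, 0, ((√2 : ℝ) : ℂ) • T.x m⟩⁆ ∈
      T.intSpan X D := by
  refine hT.core_lie_mem (pos_mem_gr _ l) (neg_mem_gr _ m) ?_ fun n => ?_
  · rw [TKK.lie_pos_neg]
    refine ofOp_mem_intSpan ?_
    obtain ⟨k, hk⟩ := hT.mul_int l m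
    rw [TKK.tri_smul_left, TKK.tri_smul_right, smul_smul, sqrt_two_mul_self, Submodule.coe_smul,
      tri_coe, hk, L_smul, smul_add, smul_comm, two_smul ℂ ⁅L (T.x l), L (T.x m)⁆]
    exact add_mem (intCast_smul_mem _ (hT.two_L_mem_opInt _) k)
      (add_mem (hT.lie_mem_opInt _ _) (hT.lie_mem_opInt _ _))
  · obtain ⟨k, hk⟩ := hT.eps_mul_int (n + l) m
    refine ⟨2 * k, ?_⟩
    rw [form_apply, n.2.2.toEnd_pos]
    have h0 : (n.2.2.toEnd ⟨((√2 : ℝ) : ℂ) • T.x l, 0, 0⟩).op = 0 := by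
      apply Subtype.ext; simp [IsCentral.toEnd_op]
    rw [h0]
    simp only [mul_smul_comm, smul_mul_assoc, hT.ctr_mul n n.2, zero_mul, map_zero, map_smul, hk,
      smul_smul, sqrt_two_mul_self, add_zero, smul_eq_mul]
    push_cast; rfl

theorem op_pos (hT : T.IsIntegral X D) {l : Lat} {S : instrl J} (hS : T.IsBasisOp X D l S)
    (m : Lat) : ⁅coreₗ T ⟨0, S, 0⟩, coreₗ T ⟨((√2 : ℝ) : ℂ) • T.x m, 0, 0⟩⁆ ∈ T.intSpan X D := by
  refine hT.core_lie_mem (hT.isBasisOp_mem_gr hS) (pos_mem_gr _ m) ?_ fun n => ⟨0, ?_⟩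
  · obtain ⟨k, hk⟩ := (hT.isBasisOp_x hS m).1
    rw [TKK.lie_op_pos, map_smul, hk, smul_comm]
    exact hT.pos_mem _ k
  · simp [form_apply, IsCentral.toEnd_neg]

theorem op_neg (hT : T.IsIntegral X D) {l : Lat} {S : instrl J} (hS : T.IsBasisOp X D l S)
    (m : Lat) : ⁅coreₗ T ⟨0, S, 0⟩, coreₗ T ⟨0, 0, ((√2 : ℝ) : ℂ) • T.x m⟩⁆ ∈ T.intSpan X D := by
  refine hT.core_lie_mem (hT.isBasisOp_mem_gr hS) (neg_mem_gr _ m) ?_ fun n => ⟨0, ?_⟩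
  · obtain ⟨k, hk⟩ := (hT.isBasisOp_x hS m).2
    rw [TKK.lie_op_neg, map_smul, hk, smul_comm]
    exact hT.neg_mem' _ k
  · simp [form_apply, IsCentral.toEnd_pos]

theorem op_op (hT : T.IsIntegral X D) {l m : Lat} {S F : instrl J} (hS : T.IsBasisOp X D l S)
    (hF : T.IsBasisOp X D m F) : ⁅coreₗ T ⟨0, S, 0⟩, coreₗ T ⟨0, F, 0⟩⁆ ∈ T.intSpan X D := by
  refine hT.core_lie_mem (hT.isBasisOp_mem_gr hS) (hT.isBasisOp_mem_gr hF) ?_ fun n => ?_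
  · rw [TKK.lie_op_op]
    exact ofOp_mem_intSpan (hT.isBasisOp_lie hS hF)
  · obtain ⟨k, hk⟩ := hT.opForm_int (hT.toEnd_op_x n hS) (hT.isBasisOp_mem_triInt hF)
    refine ⟨k, ?_⟩
    rw [form_apply, hk]
    simp

theorem der_pos (hT : T.IsIntegral X D) (i : T.DerIdx) (l : Lat) :
    ⁅ofDer (derVec i), coreₗ T ⟨((√2 : ℝ) : ℂ) • T.x l, 0, 0⟩⁆ ∈ T.intSpan X D := by
  obtain ⟨k, hk⟩ := derTheta_int i l
  have h : (derVec i : Module.End ℂ (TKK J)) ⟨((√2 : ℝ) : ℂ) • T.x l, 0, 0⟩ =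
      ⟨(k : ℂ) • ((√2 : ℝ) : ℂ) • T.x (derCtr i + l), 0, 0⟩ := by
    rw [derVec_coe, chiDer_apply (pos_mem_gr _ l), hk]
    ext1
    · simp [IsCentral.toEnd_pos, mul_smul_comm, hT.ctr_mul _ (derCtr i).2]
    · apply Subtype.ext; simp [IsCentral.toEnd_op]
    · simp [IsCentral.toEnd_neg]
  rw [lie_der_core, h]
  exact hT.pos_mem _ k

theorem der_neg (hT : T.IsIntegral X D) (i : T.DerIdx) (l : Lat) :
    ⁅ofDer (derVec i), coreₗ T ⟨0, 0, ((√2 : ℝ) : ℂ) • T.x l⟩⁆ ∈ T.intSpan X D := by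
  obtain ⟨k, hk⟩ := derTheta_int i l
  have h : (derVec i : Module.End ℂ (TKK J)) ⟨0, 0, ((√2 : ℝ) : ℂ) • T.x l⟩ =
      ⟨0, 0, (k : ℂ) • ((√2 : ℝ) : ℂ) • T.x (derCtr i + l)⟩ := by
    rw [derVec_coe, chiDer_apply (neg_mem_gr _ l), hk]
    ext1
    · simp [IsCentral.toEnd_pos]
    · apply Subtype.ext; simp [IsCentral.toEnd_op]
    · simp [IsCentral.toEnd_neg, mul_smul_comm, hT.ctr_mul _ (derCtr i).2]
  rw [lie_der_core, h]
  exact hT.neg_mem' _ k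

theorem der_op (hT : T.IsIntegral X D) (i : T.DerIdx) {l : Lat} {S : instrl J}
    (hS : T.IsBasisOp X D l S) : ⁅ofDer (derVec i), coreₗ T ⟨0, S, 0⟩⁆ ∈ T.intSpan X D := by
  have h : (derVec i : Module.End ℂ (TKK J)) ⟨0, S, 0⟩ =
      ⟨0, ((derVec i : Module.End ℂ (TKK J)) ⟨0, S, 0⟩).op, 0⟩ := by
    rw [derVec_coe, chiDer_apply (hT.isBasisOp_mem_gr hS)]
    ext1
    · simp [IsCentral.toEnd_pos]
    · rfl
    · simp [IsCentral.toEnd_neg]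
  rw [lie_der_core, h]
  exact ofOp_mem_intSpan (hT.der_op_mem i hS)

variable (T X D) in
/-- The elements of the basis of the elliptic algebra, by type. -/
inductive IsBasisElt : EALA T → Prop
  | pos (l : Lat) : IsBasisElt (coreₗ T ⟨((√2 : ℝ) : ℂ) • T.x l, 0, 0⟩)
  | neg (l : Lat) : IsBasisElt (coreₗ T ⟨0, 0, ((√2 : ℝ) : ℂ) • T.x l⟩)
  | op (l : Lat) (S : instrl J) (hS : T.IsBasisOp X D l S) : IsBasisElt (coreₗ T ⟨0, S, 0⟩)
  | cent (i : T.DerIdx) : IsBasisElt (ofCent (centVec i))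
  | der (i : T.DerIdx) : IsBasisElt (ofDer (derVec i))

theorem isBasisElt (hT : T.IsIntegral X D) {u : EALA T} (hu : u ∈ T.basis (T.opSet X D)) :
    IsBasisElt T X D u := by
  rw [← hT.range_eFam] at hu
  obtain ⟨i | i | (i | i) | i | i, rfl⟩ := hu
  · exact .pos i
  · exact .neg i
  · change IsBasisElt T X D (coreₗ T ⟨0, ⟨opFam T D (.inl i), hT.opFam_mem _⟩, 0⟩)
    by_cases hi : i.1 = 0
    · have h : (⟨opFam T D (.inl i), hT.opFam_mem _⟩ : instrl J) = (2 : ℂ) • ⟨L 1, L_mem 1⟩ := by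
        apply Subtype.ext
        change (if i.1 = 0 then 2 else 1 : ℂ) • L (T.x i) = (2 : ℂ) • L 1
        rw [hi, if_pos rfl, T.x_zero]
      rw [h]
      exact .op 0 _ .two_L
    · have h : (⟨opFam T D (.inl i), hT.opFam_mem _⟩ : instrl J) = ⟨L (T.x i), L_mem _⟩ := by
        apply Subtype.ext
        change (if i.1 = 0 then 2 else 1 : ℂ) • L (T.x i) = L (T.x i)
        rw [if_neg hi, one_smul]
      rw [h]
      exact .op i _ (.L i hi)
  · exact .op i ⟨opFam T D (.inr i), hT.opFam_mem _⟩ (.D i i.2 _ rfl)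
  · exact .cent i
  · exact .der i

theorem lie_mem_intSpan (hT : T.IsIntegral X D) {u v : EALA T} (hu : IsBasisElt T X D u)
    (hv : IsBasisElt T X D v) : ⁅u, v⁆ ∈ T.intSpan X D := by
  have swap {u v : EALA T} (h : ⁅u, v⁆ ∈ T.intSpan X D) : ⁅v, u⁆ ∈ T.intSpan X D := by
    rw [← lie_skew]; exact AddSubgroup.neg_mem _ h
  have core_cent (w : TKK J) (c : T.grDual) : ⁅coreₗ T w, ofCent c⁆ ∈ T.intSpan X D := by
    rw [lie_core_cent]; exact zero_mem _
  have der_cent (i j : T.DerIdx) :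
      (⁅ofDer (derVec i), ofCent (centVec j)⁆ : EALA T) ∈ T.intSpan X D := by
    rw [lie_der_cent]; exact hT.cent_mem (hT.coact_int i j)
  cases hu with
  | pos l =>
    cases hv with
    | pos m => exact hT.pos_pos l m
    | neg m => exact hT.pos_neg l m
    | op m S hS => exact swap (hT.op_pos hS l)
    | cent j => exact core_cent _ _
    | der j => exact swap (hT.der_pos j l)
  | neg l =>
    cases hv with
    | pos m => exact swap (hT.pos_neg m l)
    | neg m => exact hT.neg_neg l m
    | op m S hS => exact swap (hT.op_neg hS l)
    | cent j => exact core_cent _ _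
    | der j => exact swap (hT.der_neg j l)
  | op l S hS =>
    cases hv with
    | pos m => exact hT.op_pos hS m
    | neg m => exact hT.op_neg hS m
    | op m F hF => exact hT.op_op hS hF
    | cent j => exact core_cent _ _
    | der j => exact swap (hT.der_op j hS)
  | cent i =>
    cases hv with
    | pos m => exact swap (core_cent _ _)
    | neg m => exact swap (core_cent _ _)
    | op m F hF => exact swap (core_cent _ _)
    | cent j => rw [lie_cent_cent]; exact zero_mem _
    | der j => exact swap (der_cent j i)
  | der i =>
    cases hv with
    | pos m => exact hT.der_pos i m
    | neg m => exact hT.der_neg i m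
    | op m F hF => exact hT.der_op i hF
    | cent j => exact der_cent i j
    | der j => rw [lie_der_der]; exact hT.der_mem (hT.scderLie_derVec i j)

/-- Integral structure constants of a Jordan torus make the set `B` of its elliptic algebra a
Chevalley basis. -/
theorem isChevalleyBasis (hT : T.IsIntegral X D) : IsChevalleyBasis (T.basis (T.opSet X D)) := by
  refine ⟨?_, ?_, fun u hu v hv => hT.lie_mem_intSpan (hT.isBasisElt hu) (hT.isBasisElt hv)⟩
  · rw [← hT.range_eFam]
    exact hT.linearIndependent_eFam.linearIndepOn_id
  · rw [← hT.range_eFam]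
    exact hT.span_eFam

end IsIntegral
end JordanTorus

end

/-! ### The Jordan tori `J_S` -/

theorem mem_coset_iff (t l : Lat) : l ∈ coset t ↔ parity l = parity t := by
  constructor
  · rintro ⟨m, rfl⟩
    rw [parity_add, two_smul, parity_add, CharTwo.add_self_eq_zero, add_zero]
  · intro h
    obtain ⟨h1, h2⟩ := Prod.ext_iff.1 h
    simp only [parity] at h1 h2
    rw [← sub_eq_zero, ← Int.cast_sub, ZMod.intCast_zmod_eq_zero_iff_dvd] at h1 h2
    obtain ⟨a, ha⟩ := h1
    obtain ⟨b, hb⟩ := h2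
    refine ⟨(a, b), Prod.ext ?_ ?_⟩
    · rw [two_smul]; simp only [Prod.fst_add]; push_cast at ha; linarith
    · rw [two_smul]; simp only [Prod.snd_add]; push_cast at hb; linarith

theorem Semilat.mem_of_parity_eq (S : Semilat) {l m : Lat} (hm : m ∈ S.carrier)
    (h : parity l = parity m) : l ∈ S.carrier := by
  obtain ⟨n, rfl⟩ := (mem_coset_iff m l).2 h
  exact S.add_two_mem m hm n

theorem parity_neg (l : Lat) : parity (-l) = parity l := by
  rw [← sub_eq_zero, sub_eq_add_neg, ← CharTwo.neg_eq (parity l), neg_neg, ← parity_add,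
    neg_add_cancel]; rfl

/-- The structure constants of the operators `[L_{x^a}, L_{x^b}]` on `J_S`, in terms of parities. -/
def gamLie (p q g : ZMod 2 × ZMod 2) : ℤ := gam q g * gam p (q + g) - gam p g * gam q (p + g)

theorem gamLie_eq_zero : ∀ p q g, gam p q = 1 → gamLie p q g = 0 := by decide

/-- For `r ≠ 0` there are, up to order, only two parities `p`, `q` with `p + q = r` and
`p`, `q`, `r` distinct and nonzero. -/
theorem gamLie_eq : ∀ p q s, gam p q = 0 → gam s (p + q) = 0 →
    (s = q ∧ ∀ g, gamLie p q g = gamLie (p + q + s) s g) ∨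
      (s = p ∧ ∀ g, gamLie p q g = -gamLie (p + q + s) s g) := by decide

theorem gamLie_self : ∀ l s, gam s l = 0 → gamLie (l + s) s s = 1 := by decide

theorem gam_cases : ∀ p q, gam p q = 0 ∨ gam p q = 1 := by decide

theorem gam_eq_zero_or : ∀ p, p = 0 ∨ gam p (1, 0) = 0 ∨ gam p (0, 1) = 0 := by decide

theorem gam_self : ∀ p, gam p p = 1 := by decide

theorem gam_zero : ∀ p, gam p 0 = 1 := by decide

namespace JS

variable {S : Semilat}

theorem lie_x {a b m : Lat} (ha : a ∈ S.carrier) (hb : b ∈ S.carrier) (hm : m ∈ S.carrier) :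
    ⁅L (x S a), L (x S b)⁆ (x S m) =
      (gamLie (parity a) (parity b) (parity m) : ℂ) • x S (a + b + m) := by
  simp only [Ring.lie_def, LinearMap.sub_apply, Module.End.mul_apply, L_apply]
  rw [x_mul' ha hb hm, x_mul' hb ha hm, show b + (a + m) = a + b + m by abel, ← add_assoc,
    ← sub_smul, gamLie]
  push_cast; rfl

theorem isNormalized (h1 : sig1 ∈ S.carrier) (h2 : sig2 ∈ S.carrier) :
    (torus S).IsNormalized where
  sig1_ne := x_ne_zero_iff.2 h1
  sig2_ne := x_ne_zero_iff.2 h2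
  ctr_mul m hm l := by
    have hmS : m ∈ S.carrier := x_ne_zero_iff.1 hm.1
    -- If `x^a` does not commute with `x^m`, then `x^m (x^a x^a) ≠ 0 = x^a (x^m x^a)`.
    have hc : ∀ a ∈ S.carrier, gam (parity m) (parity a) ≠ 0 := by
      intro a ha h0
      have h := hm.2 (x S a) (x S a)
      change x S m * _ = x S a * (x S m * _) at h
      rw [x_mul hmS ha, x_mul' hmS ha ha, h0, gam_self, ← two_smul ℕ (parity a),
        show (2 : ℕ) • parity a = 0 by rw [two_smul, CharTwo.add_self_eq_zero], gam_zero] at h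
      simp only [Int.cast_zero, zero_smul, mul_zero, mul_one, Int.cast_one, one_smul] at h
      refine x_ne_zero_iff.2 (S.mem_of_parity_eq hmS ?_) h
      rw [parity_add, parity_add, CharTwo.add_self_eq_zero, add_zero]
    have hp : parity m = 0 :=
      ((gam_eq_zero_or (parity m)).resolve_right fun h => h.elim
        (fun h => hc sig1 h1 (by simpa [parity, sig1] using h))
        (fun h => hc sig2 h2 (by simpa [parity, sig2] using h)))
    change x S m * x S l = x S (m + l)
    by_cases hl : l ∈ S.carrier
    · rw [x_mul hmS hl, gam_comm, hp, gam_zero]; simp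
    · rw [x_of_not_mem hl, mul_zero, x_of_not_mem]
      intro h
      refine hl (S.mem_of_parity_eq h ?_)
      rw [parity_add, hp, zero_add]

/-- `J_S` has integral structure constants with respect to `D l = [L_{x^{l+τ}}, L_{x^{-τ}}]`, where
the degree `τ = τ(l)` is chosen with `x^{l+τ} x^{-τ} = 0`. -/
theorem isIntegral (h1 : sig1 ∈ S.carrier) (h2 : sig2 ∈ S.carrier) {X : Set Lat} {τ : Lat → Lat}
    (hτ : ∀ l ∈ X, τ l ∈ S.carrier ∧ l + τ l ∈ S.carrier ∧ gam (parity (τ l)) (parity l) = 0)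
    (hX : ∀ a ∈ S.carrier, ∀ b ∈ S.carrier, gam (parity a) (parity b) = 0 → a + b ∈ X) :
    (torus S).IsIntegral X fun l => (torus S).lieL l (τ l) where
  toIsNormalized := isNormalized h1 h2
  mul_int l m := by
    change ∃ k : ℤ, x S l * x S m = (k : ℂ) • x S (l + m)
    by_cases hl : l ∈ S.carrier
    · by_cases hm : m ∈ S.carrier
      · exact ⟨_, x_mul hl hm⟩
      · exact ⟨0, by rw [x_of_not_mem hm]; simp⟩
    · exact ⟨0, by rw [x_of_not_mem hl]; simp⟩
  D_eq l _ := ⟨l + τ l, -τ l, 1, by abel, by simp [JordanTorus.lieL]⟩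
  D_ne l hl h := by
    obtain ⟨ht, hlt, hg⟩ := hτ l hl
    have h' := LinearMap.congr_fun h (x S (τ l))
    have hneg : -τ l ∈ S.carrier := S.mem_of_parity_eq ht (parity_neg _)
    change ⁅L (x S (l + τ l)), L (x S (-τ l))⁆ (x S (τ l)) = 0 at h'
    rw [lie_x hlt hneg ht, parity_neg, parity_add, gamLie_self _ _ hg] at h'
    simp only [Int.cast_one, one_smul, add_neg_cancel_right] at h'
    exact x_ne_zero_iff.2 hlt h'
  lie_eq a b := by
    change ⁅L (x S a), L (x S b)⁆ = 0 ∨ a + b ∈ X ∧ ∃ k : ℤ, ⁅L (x S a), L (x S b)⁆ =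
      (k : ℂ) • ⁅L (x S (a + b + τ (a + b))), L (x S (-τ (a + b)))⁆
    by_cases ha : a ∈ S.carrier
    swap; · left; rw [x_of_not_mem ha, L_zero, end_lie_swap, end_lie_zero, neg_zero]
    by_cases hb : b ∈ S.carrier
    swap; · left; rw [x_of_not_mem hb, L_zero, end_lie_zero]
    rcases gam_cases (parity a) (parity b) with h | h
    · right
      have hab := hX a ha b hb h
      obtain ⟨ht, hlt, hg⟩ := hτ _ hab
      have hneg : -τ (a + b) ∈ S.carrier := S.mem_of_parity_eq ht (parity_neg _)
      have hx : ∀ m ∈ S.carrier,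
          ⁅L (x S (a + b + τ (a + b))), L (x S (-τ (a + b)))⁆ (x S m) =
          (gamLie (parity a + parity b + parity (τ (a + b))) (parity (τ (a + b))) (parity m) : ℂ) •
            x S (a + b + m) := by
        intro m hm
        rw [lie_x hlt hneg hm, parity_neg, parity_add, parity_add, add_neg_cancel_right]
      refine ⟨hab, ?_⟩
      rw [parity_add] at hg
      rcases gamLie_eq _ _ _ h hg with ⟨-, h'⟩ | ⟨-, h'⟩
      · refine ⟨1, (torus S).end_ext fun m hm => ?_⟩
        change ⁅L (x S a), L (x S b)⁆ (x S m) = ((1 : ℤ) : ℂ) •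
          ⁅L (x S (a + b + τ (a + b))), L (x S (-τ (a + b)))⁆ (x S m)
        have hmS : m ∈ S.carrier := x_ne_zero_iff.1 hm
        rw [lie_x ha hb hmS, hx m hmS, h']; simp
      · refine ⟨-1, (torus S).end_ext fun m hm => ?_⟩
        change ⁅L (x S a), L (x S b)⁆ (x S m) = ((-1 : ℤ) : ℂ) •
          ⁅L (x S (a + b + τ (a + b))), L (x S (-τ (a + b)))⁆ (x S m)
        have hmS : m ∈ S.carrier := x_ne_zero_iff.1 hm
        rw [lie_x ha hb hmS, hx m hmS, h']; simp
    · left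
      refine (torus S).end_ext fun m hm => ?_
      change ⁅L (x S a), L (x S b)⁆ (x S m) = 0
      rw [lie_x ha hb (x_ne_zero_iff.1 hm), gamLie_eq_zero _ _ _ h]
      simp

end JS

theorem parity_sig1 : parity sig1 = (1, 0) := by simp [parity, sig1]
theorem parity_sig2 : parity sig2 = (0, 1) := by simp [parity, sig2]
theorem parity_sig_add : parity (sig1 + sig2) = (1, 1) := by simp [parity, sig1, sig2]

theorem mem_semilatThree_iff (l : Lat) :
    l ∈ semilatThree.carrier ↔ parity l = 0 ∨ parity l = (1, 0) ∨ parity l = (0, 1) := by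
  change l ∈ coset 0 ∪ coset sig1 ∪ coset sig2 ↔ _
  rw [Set.mem_union, Set.mem_union, mem_coset_iff, mem_coset_iff, mem_coset_iff, parity_sig1,
    parity_sig2, or_assoc]
  rfl

theorem isChevalleyBasis_basisThree : IsChevalleyBasis basisThree := by
  have hpar : ∀ p q : ZMod 2 × ZMod 2, (p = 0 ∨ p = (1, 0) ∨ p = (0, 1)) →
      (q = 0 ∨ q = (1, 0) ∨ q = (0, 1)) → gam p q = 0 → p + q = (1, 1) := by decide
  have hT := JS.isIntegral (S := semilatThree) (X := coset (sig1 + sig2)) (τ := fun _ => sig2)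
    ((mem_semilatThree_iff _).2 (by simp [parity_sig1]))
    ((mem_semilatThree_iff _).2 (by simp [parity_sig2]))
    (fun l hl => by
      rw [mem_coset_iff, parity_sig_add] at hl
      refine ⟨(mem_semilatThree_iff _).2 (by simp [parity_sig2]), (mem_semilatThree_iff _).2 ?_, ?_⟩
      · rw [parity_add, parity_sig2, hl]; decide
      · rw [parity_sig2, hl]; decide)
    (fun a ha b hb h => by
      rw [mem_coset_iff, parity_sig_add, parity_add]
      exact hpar _ _ ((mem_semilatThree_iff a).1 ha) ((mem_semilatThree_iff b).1 hb) h)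
  convert hT.isChevalleyBasis using 1
  rw [basisThree]
  congr 1
  ext S
  simp only [JordanTorus.opSet, Set.mem_union, Set.mem_ofPred_eq]
  refine or_congr ⟨?_, ?_⟩ Iff.rfl
  · rintro ⟨l, h0, hl, rfl⟩
    exact ⟨l, h0, JS.x_ne_zero_iff.2 hl, rfl⟩
  · rintro ⟨l, h0, hl, rfl⟩
    exact ⟨l, h0, JS.x_ne_zero_iff.1 hl, rfl⟩

theorem isChevalleyBasis_basisFull : IsChevalleyBasis basisFull := by
  classical
  have hpar : ∀ p q : ZMod 2 × ZMod 2, gam p q = 0 → p + q ≠ 0 := by decide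
  have h3 : ∀ p : ZMod 2 × ZMod 2, p ≠ 0 → p ≠ (0, 1) → p = (1, 0) ∨ p = (1, 1) := by decide
  have hgam : ∀ p : ZMod 2 × ZMod 2, p = (1, 0) ∨ p = (1, 1) → gam (0, 1) p = 0 := by decide
  have hT := JS.isIntegral (S := semilatFull) (X := {l | parity l ≠ 0})
    (τ := fun l => if parity l = (0, 1) then sig1 else sig2) trivial trivial
    (fun l hl => by
      refine ⟨trivial, trivial, ?_⟩
      split_ifs with h
      · rw [h, parity_sig1]; decide
      · rw [parity_sig2]; exact hgam _ (h3 _ hl h))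
    (fun a _ b _ h => by
      change parity (a + b) ≠ 0
      rw [parity_add]; exact hpar _ _ h)
  convert hT.isChevalleyBasis using 1
  rw [basisFull]
  congr 1
  ext S
  have hx (l : Lat) : (JS.torus semilatFull).x l ≠ 0 := JS.x_ne_zero_iff.2 trivial
  have hp0 : parity (0 : Lat) = 0 := rfl
  have hne : (0, 1) ≠ (0 : ZMod 2 × ZMod 2) := by decide
  have hne' : ∀ p : ZMod 2 × ZMod 2, p = (1, 0) ∨ p = (1, 1) → p ≠ 0 ∧ p ≠ (0, 1) := by decide
  simp only [JordanTorus.opSet, Set.mem_union, Set.mem_ofPred_eq, mem_coset_iff, parity_sig1,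
    parity_sig2, parity_sig_add, hp0]
  constructor
  · rintro ((⟨l, hl, rfl | rfl⟩ | ⟨l, hl, rfl | rfl⟩) | ⟨l, -, h0, rfl⟩)
    · exact Or.inl ⟨l, by rintro rfl; exact (hne' _ hl).1 rfl, hx l, rfl⟩
    · exact Or.inr ⟨l, (hne' _ hl).1, by rw [if_neg (hne' _ hl).2]⟩
    · exact Or.inl ⟨l, by rintro rfl; exact hne hl.symm, hx l, rfl⟩
    · exact Or.inr ⟨l, by rw [hl]; exact hne, by rw [if_pos hl]⟩
    · exact Or.inl ⟨l, h0, hx l, rfl⟩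
  · rintro (⟨l, h0, -, rfl⟩ | ⟨l, hl, rfl⟩)
    · by_cases hl : parity l = 0
      · exact Or.inr ⟨l, hl, h0, rfl⟩
      · by_cases hl' : parity l = (0, 1)
        · exact Or.inl (Or.inr ⟨l, hl', Or.inl rfl⟩)
        · exact Or.inl (Or.inl ⟨l, h3 _ hl hl', Or.inl rfl⟩)
    · by_cases hl' : parity l = (0, 1)
      · exact Or.inl (Or.inr ⟨l, hl', Or.inr (by rw [if_pos hl'])⟩)
      · exact Or.inl (Or.inl ⟨l, h3 _ hl hl', Or.inr (by rw [if_neg hl'])⟩)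

/-! ### The Jordan tori `K_e^+` -/

section Eta

variable {e : ℤˣ}

theorem eta_cases (e : ℤˣ) (l m : Lat) : eta e l m = 1 ∨ eta e l m = -1 :=
  mul_self_eq_one_iff.1 (QTorus.eta_sq l m)

theorem eta_swap (e : ℤˣ) (l m : Lat) :
    eta e m l = eta e (l + m) (l + m) * eta e l l * eta e m m * eta e l m := by
  have h1 := QTorus.eta_sq (e := e) l l
  have h2 := QTorus.eta_sq (e := e) m m
  have h3 := QTorus.eta_sq (e := e) l m
  simp only [eta_add_left, eta_add_right]
  linear_combination (-eta e m l * eta e l m * eta e l m * eta e m m * eta e m m) * h1 -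
    (eta e m l * eta e l m * eta e l m) * h2 - eta e m l * h3

theorem eta_eq_one_of_comm {m : Lat} (h : ∀ a, eta e a a = 1 → eta e m a = eta e a m) (l : Lat) :
    eta e m l = 1 ∧ eta e l m = 1 := by
  have h1 := h (l.1, 0) (by simp [eta])
  have h2 := h (0, l.2) (by simp [eta])
  simp only [eta, mul_zero, zero_mul, zpow_zero, Units.val_one] at h1 h2 ⊢
  exact ⟨h1, h2.symm⟩

end Eta

namespace KPlus

variable {e : ℤˣ}

theorem mul_int (l m : Lat) : ∃ k : ℤ, x e l * x e m = (k : ℂ) • x e (l + m) := by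
  rw [x_mul]
  rcases eta_cases e l m with h1 | h1 <;> rcases eta_cases e m l with h2 | h2 <;> rw [h1, h2]
  exacts [⟨1, by norm_num⟩, ⟨0, by norm_num⟩, ⟨0, by norm_num⟩, ⟨-1, by norm_num⟩]

theorem lie_x (a b m : Lat) : ⁅L (x e a), L (x e b)⁆ (x e m) =
    ((1 / 4 : ℂ) * (eta e a b - eta e b a) * (eta e (a + b) m - eta e m (a + b))) •
      x e (a + b + m) := by
  simp only [Ring.lie_def, LinearMap.sub_apply, Module.End.mul_apply, L_apply]
  rw [x_mul b m, x_mul a m, mul_smul_comm, mul_smul_comm, x_mul, x_mul,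
    show b + (a + m) = a + b + m by abel, ← add_assoc, smul_smul, smul_smul, ← sub_smul]
  congr 1
  simp only [eta_add_left, eta_add_right]
  push_cast
  ring

theorem L_sub_r_x (l m : Lat) : (L (x e l) - r e l) (x e m) =
    ((1 / 2 : ℂ) * (eta e m l - eta e l m)) • x e (l + m) := by
  rw [LinearMap.sub_apply, L_apply, r_x, x_mul, ← sub_smul]
  congr 1
  ring

/-- The inner derivations of `K_e^+` are multiples of the inner derivations
`L_{x^l} - r_l = -1/2 [x^l, -]` of the associative algebra `K_e`. -/
theorem lie_eq (a b : Lat) : ⁅L (x e a), L (x e b)⁆ =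
    ((1 / 2 : ℂ) * (eta e b a - eta e a b)) • (L (x e (a + b)) - r e (a + b)) := by
  refine (torus e).end_ext fun m _ => ?_
  change ⁅L (x e a), L (x e b)⁆ (x e m) = ((1 / 2 : ℂ) * (eta e b a - eta e a b)) •
    (L (x e (a + b)) - r e (a + b)) (x e m)
  rw [lie_x, L_sub_r_x, smul_smul]
  congr 1
  ring

/-- If `η(m, a) = -η(a, m)`, then `x^m (x^a x^a) ≠ 0 = x^a (x^m x^a)`. -/
theorem eta_comm_of_central {m a : Lat} (h : x e m * (x e a * x e a) = x e a * (x e m * x e a)) :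
    eta e m a = eta e a m := by
  have h3 : eta e a a ≠ 0 := by rcases eta_cases e a a with h | h <;> rw [h] <;> decide
  have h1 := QTorus.eta_sq (e := e) m a
  have h2 := QTorus.eta_sq (e := e) a m
  by_contra hne
  have h0 : eta e m a + eta e a m = 0 := by
    rcases eta_cases e m a with h1 | h1 <;> rcases eta_cases e a m with h2 | h2 <;>
      rw [h1, h2] at hne ⊢ <;> first | rfl | exact absurd rfl hne
  have h0' : (eta e m a : ℂ) + eta e a m = 0 := by exact_mod_cast h0
  rw [x_mul m a, h0', mul_zero, zero_smul, mul_zero, x_mul a a, mul_smul_comm, x_mul, smul_smul,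
    eta_add_left, eta_add_right, h1, h2] at h
  refine (smul_eq_zero.1 h).elim (fun h => h3 ?_) (x_ne_zero _)
  have h' : (eta e a a : ℂ) = 0 := by
    push_cast at h
    linear_combination h
  exact_mod_cast h'

theorem isNormalized : (torus e).IsNormalized where
  sig1_ne := x_ne_zero _
  sig2_ne := x_ne_zero _
  ctr_mul m hm l := by
    obtain ⟨h1, h2⟩ := eta_eq_one_of_comm
      (fun a _ => eta_comm_of_central (hm.2 (x e a) (x e a))) l
    change x e m * x e l = x e (m + l)
    rw [x_mul, h1, h2]
    norm_num

theorem isIntegral : (torus e).IsIntegral (rad e)ᶜ fun l => L (x e l) - r e l where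
  toIsNormalized := isNormalized
  mul_int := mul_int
  D_eq l hl := by
    change ∃ a b, ∃ k : ℤ, a + b = l ∧ L (x e l) - r e l = (k : ℂ) • ⁅L (x e a), L (x e b)⁆
    obtain ⟨m, hm⟩ := not_forall.1 hl
    have h1 := eta_add_left e (l - m) m m
    have h2 := eta_add_right e m (l - m) m
    rw [sub_add_cancel] at h1 h2
    have h3 := QTorus.eta_sq (e := e) m (l - m)
    have h4 : eta e (l - m) m = -eta e m (l - m) := by
      rw [h1, h2] at hm
      rcases eta_cases e (l - m) m with h | h <;> rcases eta_cases e m (l - m) with h' | h' <;>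
        rw [h, h'] at hm ⊢ <;> first | rfl | exact absurd rfl hm
    have h5 : (eta e m (l - m) : ℂ) * eta e m (l - m) = 1 := by exact_mod_cast h3
    have hk : (eta e m (l - m) : ℂ) *
        ((1 / 2 : ℂ) * (eta e m (l - m) - eta e (l - m) m)) = 1 := by
      rw [h4]; push_cast; linear_combination h5
    refine ⟨l - m, m, eta e m (l - m), sub_add_cancel l m, ?_⟩
    rw [lie_eq, smul_smul, hk, one_smul, sub_add_cancel]
  D_ne l hl h := by
    obtain ⟨m, hm⟩ := not_forall.1 hl
    have h' := LinearMap.congr_fun h (x e m)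
    rw [L_sub_r_x, LinearMap.zero_apply] at h'
    refine (smul_eq_zero.1 h').elim (fun h => hm ?_) (x_ne_zero _)
    have h'' : (eta e l m : ℂ) = eta e m l := by linear_combination -2 * h
    exact_mod_cast h''
  lie_eq a b := by
    change ⁅L (x e a), L (x e b)⁆ = 0 ∨ a + b ∈ (rad e)ᶜ ∧ ∃ k : ℤ, ⁅L (x e a), L (x e b)⁆ =
      (k : ℂ) • (L (x e (a + b)) - r e (a + b))
    rw [lie_eq]
    by_cases hab : a + b ∈ rad e
    · left
      have h := hab b
      rw [eta_add_left, eta_add_right] at h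
      rw [mul_right_cancel₀ (b := eta e b b) _ h, sub_self, mul_zero, zero_smul]
      rcases eta_cases e b b with h | h <;> rw [h] <;> decide
    · refine Or.inr ⟨hab, ?_⟩
      rcases eta_cases e a b with h1 | h1 <;> rcases eta_cases e b a with h2 | h2 <;> rw [h1, h2]
      exacts [⟨0, by norm_num⟩, ⟨-1, by norm_num⟩, ⟨1, by norm_num⟩, ⟨0, by norm_num⟩]

end KPlus

theorem isChevalleyBasis_basisKPlus (e : ℤˣ) : IsChevalleyBasis (basisKPlus e) := by
  convert (KPlus.isIntegral (e := e)).isChevalleyBasis using 1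
  rw [basisKPlus]
  congr 1
  ext S
  have h0 : (0 : Lat) ∈ rad e := fun m => by simp [eta]
  have hx (l : Lat) : (KPlus.torus e).x l ≠ 0 := KPlus.x_ne_zero l
  simp only [JordanTorus.opSet, Set.mem_union, Set.mem_ofPred_eq]
  constructor
  · rintro (⟨l, hl, rfl | rfl⟩ | ⟨l, -, hl, rfl⟩)
    · exact Or.inl ⟨l, by rintro rfl; exact hl h0, hx l, rfl⟩
    · exact Or.inr ⟨l, hl, rfl⟩
    · exact Or.inl ⟨l, hl, hx l, rfl⟩
  · rintro (⟨l, hl, -, rfl⟩ | ⟨l, hl, rfl⟩)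
    · by_cases h : l ∈ rad e
      · exact Or.inr ⟨l, h, hl, rfl⟩
      · exact Or.inl ⟨l, h, Or.inl rfl⟩
    · exact Or.inl ⟨l, hl, Or.inr rfl⟩

/-! ### The Jordan tori `H(K_e, -)` -/

namespace Herm

variable {e : ℤˣ}

theorem x_ne_zero_iff_eta {l : Lat} : x e l ≠ 0 ↔ eta e l l = 1 :=
  (x_ne_zero_iff l).trans (x_mem_iff l)

theorem x_eq_zero {l : Lat} (h : eta e l l ≠ 1) : x e l = 0 :=
  x_of_not_mem fun h' => h ((x_mem_iff l).1 h')

theorem coe_x {l : Lat} (h : eta e l l = 1) : (x e l : KPlus e) = KPlus.x e l := by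
  rw [x_of_mem ((x_mem_iff l).2 h)]

theorem r_x' (l : Lat) {m : Lat} (h : eta e m m = 1) :
    r e l (x e m) = (eta e l m : ℂ) • x e (l + m) := r_x e l m ((x_mem_iff m).2 h)

/-- The elements `x^l` and `x^m` of `K_e` commute if `x^{l+m}` is fixed by the involution, and they
anticommute otherwise. -/
theorem x_mul {l m : Lat} (hl : eta e l l = 1) (hm : eta e m m = 1) :
    x e l * x e m = (eta e l m : ℂ) • x e (l + m) := by
  have hs := eta_swap e l m
  apply Subtype.ext
  change (x e l : KPlus e) * (x e m : KPlus e) = (eta e l m : ℂ) • (x e (l + m) : KPlus e)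
  rw [coe_x hl, coe_x hm, KPlus.x_mul]
  by_cases h : eta e (l + m) (l + m) = 1
  · rw [coe_x h, hs, hl, hm, h]
    congr 1
    push_cast
    ring
  · rw [x_eq_zero h, hs, hl, hm, (eta_cases e _ _).resolve_left h]
    change _ = _ • (0 : KPlus e)
    rw [smul_zero]
    push_cast
    convert zero_smul ℂ _ using 2
    ring

theorem coe_lie_x {a b m : Lat} (ha : eta e a a = 1) (hb : eta e b b = 1) (hm : eta e m m = 1) :
    ((⁅L (x e a), L (x e b)⁆ (x e m) : Herm e) : KPlus e) =
      ⁅L (KPlus.x e a), L (KPlus.x e b)⁆ (KPlus.x e m) := by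
  change (x e a : KPlus e) * ((x e b : KPlus e) * (x e m : KPlus e)) -
    (x e b : KPlus e) * ((x e a : KPlus e) * (x e m : KPlus e)) = _
  rw [coe_x ha, coe_x hb, coe_x hm]
  rfl

theorem lie_eq_zero {a b : Lat} (ha : eta e a a = 1) (hb : eta e b b = 1)
    (hab : eta e (a + b) (a + b) = 1) : ⁅L (x e a), L (x e b)⁆ = 0 := by
  refine (torus e).end_ext fun m hm => Subtype.ext ?_
  change ((⁅L (x e a), L (x e b)⁆ (x e m) : Herm e) : KPlus e) = 0
  rw [coe_lie_x ha hb (x_ne_zero_iff_eta.1 hm), KPlus.lie_x, eta_swap e a b, ha, hb, hab]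
  simp

theorem lie_eq {a b : Lat} (ha : eta e a a = 1) (hb : eta e b b = 1)
    (hab : eta e (a + b) (a + b) ≠ 1) : ⁅L (x e a), L (x e b)⁆ = (eta e a b : ℂ) • r e (a + b) := by
  have hab' := (eta_cases e _ _).resolve_left hab
  refine (torus e).end_ext fun m hm => Subtype.ext ?_
  have hm' : eta e m m = 1 := x_ne_zero_iff_eta.1 hm
  change ((⁅L (x e a), L (x e b)⁆ (x e m) : Herm e) : KPlus e) =
    (eta e a b : ℂ) • ((r e (a + b) (x e m) : Herm e) : KPlus e)
  rw [coe_lie_x ha hb hm', KPlus.lie_x, r_x' _ hm', eta_swap e a b, ha, hb, hab',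
    eta_swap e (a + b) m, hm', hab']
  change _ = (eta e a b : ℂ) • (eta e (a + b) m : ℂ) • ((x e (a + b + m) : Herm e) : KPlus e)
  by_cases h : eta e (a + b + m) (a + b + m) = 1
  · rw [coe_x h, h, smul_smul]
    congr 1
    push_cast
    ring
  · rw [x_eq_zero h, (eta_cases e _ _).resolve_left h]
    change _ = _ • _ • (0 : KPlus e)
    rw [smul_zero, smul_zero]
    push_cast
    convert zero_smul ℂ _ using 2
    ring

theorem isNormalized : (torus e).IsNormalized where
  sig1_ne := x_ne_zero_iff_eta.2 (by simp [eta, sig1])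
  sig2_ne := x_ne_zero_iff_eta.2 (by simp [eta, sig2])
  ctr_mul m hm l := by
    have hm' : eta e m m = 1 := x_ne_zero_iff_eta.1 hm.1
    obtain ⟨h1, h2⟩ := eta_eq_one_of_comm (e := e) (m := m) (fun a ha => by
      refine KPlus.eta_comm_of_central ?_
      have h := congrArg (Subtype.val : Herm e → KPlus e) (hm.2 (x e a) (x e a))
      change (x e m : KPlus e) * ((x e a : KPlus e) * (x e a : KPlus e)) =
        (x e a : KPlus e) * ((x e m : KPlus e) * (x e a : KPlus e)) at h
      rwa [coe_x hm', coe_x ha] at h) l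
    change x e m * x e l = x e (m + l)
    by_cases hl : eta e l l = 1
    · rw [x_mul hm' hl, h1]; simp
    · rw [x_eq_zero hl, mul_zero, x_eq_zero]
      rwa [eta_add_left, eta_add_right, eta_add_right, h1, h2, hm', one_mul, one_mul, one_mul]

theorem isIntegral : (torus e).IsIntegral {l | eta e l l ≠ 1} (r e) where
  toIsNormalized := isNormalized
  mul_int l m := by
    change ∃ k : ℤ, x e l * x e m = (k : ℂ) • x e (l + m)
    by_cases hl : eta e l l = 1
    · by_cases hm : eta e m m = 1
      · exact ⟨_, x_mul hl hm⟩
      · exact ⟨0, by rw [x_eq_zero hm]; simp⟩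
    · exact ⟨0, by rw [x_eq_zero hl]; simp⟩
  D_eq l hl := by
    have h : ((l.1, 0) : Lat) + (0, l.2) = l := by ext <;> simp
    refine ⟨(l.1, 0), (0, l.2), 1, h, ?_⟩
    change r e l = ((1 : ℤ) : ℂ) • ⁅L (x e (l.1, 0)), L (x e (0, l.2))⁆
    rw [lie_eq (by simp [eta]) (by simp [eta]) (by rw [h]; exact hl), h]
    simp [eta]
  D_ne l hl h := by
    have hl' : eta e l l = -1 := (eta_cases e l l).resolve_left hl
    have h' := LinearMap.congr_fun h (x e (0, l.2))
    rw [r_x' l (by simp [eta]), LinearMap.zero_apply] at h'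
    refine (smul_eq_zero.1 h').elim (by simp [eta]) (x_ne_zero_iff_eta.2 ?_)
    rw [eta_add_left, eta_add_right, eta_add_right, hl',
      show eta e l (0, l.2) = 1 by simp [eta], show eta e (0, l.2) (0, l.2) = 1 by simp [eta],
      show eta e (0, l.2) l = -1 from hl']
    rfl
  lie_eq a b := by
    change ⁅L (x e a), L (x e b)⁆ = 0 ∨ eta e (a + b) (a + b) ≠ 1 ∧
      ∃ k : ℤ, ⁅L (x e a), L (x e b)⁆ = (k : ℂ) • r e (a + b)
    by_cases ha : eta e a a = 1
    swap; · left; rw [x_eq_zero ha, L_zero, end_lie_swap, end_lie_zero, neg_zero]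
    by_cases hb : eta e b b = 1
    swap; · left; rw [x_eq_zero hb, L_zero, end_lie_zero]
    by_cases hab : eta e (a + b) (a + b) = 1
    · exact Or.inl (lie_eq_zero ha hb hab)
    · exact Or.inr ⟨hab, _, lie_eq ha hb hab⟩

theorem eta_self_of_not_mem {l : Lat} (h : l ∉ coset (sig1 + sig2)) : eta e l l = 1 := by
  have he : Even (l.2 * l.1) := by
    by_contra ho
    rw [Int.not_even_iff_odd, Int.odd_mul] at ho
    refine h ((mem_coset_iff _ _).2 ?_)
    rw [parity_sig_add]
    exact Prod.ext ((ZMod.intCast_eq_one_iff_odd).2 ho.2) ((ZMod.intCast_eq_one_iff_odd).2 ho.1)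
  obtain ⟨k, hk⟩ := he
  rw [eta, hk, zpow_add, Int.units_mul_self, Units.val_one]

theorem r_eq_L {l : Lat} (hl : eta e l l = 1) : r e l = L (x e l) := by
  refine (torus e).end_ext fun m hm => ?_
  have hm' : eta e m m = 1 := x_ne_zero_iff_eta.1 hm
  change r e l (x e m) = x e l * x e m
  rw [r_x' l hm', x_mul hl hm']

end Herm

theorem isChevalleyBasis_basisHerm (e : ℤˣ) : IsChevalleyBasis (basisHerm e) := by
  convert (Herm.isIntegral (e := e)).isChevalleyBasis using 1
  rw [basisHerm]
  congr 1
  ext S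
  have h0 : (0 : Lat) ∉ coset (sig1 + sig2) := by
    rw [mem_coset_iff, parity_sig_add]; decide
  simp only [JordanTorus.opSet, Set.mem_union, Set.mem_ofPred_eq]
  constructor
  · rintro (⟨l, h, hl, rfl⟩ | ⟨l, h, rfl⟩)
    · exact Or.inl ⟨l, hl, Herm.x_ne_zero_iff_eta.2 (Herm.eta_self_of_not_mem h), rfl⟩
    · by_cases hl : eta e l l = 1
      · exact Or.inl ⟨l, by rintro rfl; exact h0 h, Herm.x_ne_zero_iff_eta.2 hl, Herm.r_eq_L hl⟩
      · exact Or.inr ⟨l, hl, rfl⟩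
  · rintro (⟨l, hl, hx, rfl⟩ | ⟨l, hl, rfl⟩)
    · by_cases h : l ∈ coset (sig1 + sig2)
      · exact Or.inr ⟨l, h, (Herm.r_eq_L (Herm.x_ne_zero_iff_eta.1 hx)).symm⟩
      · exact Or.inl ⟨l, h, hl, rfl⟩
    · exact Or.inr ⟨l, by by_contra h; exact hl (Herm.eta_self_of_not_mem h), rfl⟩

end Elliptic

theorem mainTheorem2 :
    Elliptic.IsChevalleyBasis Elliptic.basisThree ∧
    Elliptic.IsChevalleyBasis Elliptic.basisFull ∧
    (∀ e : ℤˣ, Elliptic.IsChevalleyBasis (Elliptic.basisKPlus e)) ∧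
    (∀ e : ℤˣ, Elliptic.IsChevalleyBasis (Elliptic.basisHerm e)) :=
  ⟨Elliptic.isChevalleyBasis_basisThree, Elliptic.isChevalleyBasis_basisFull,
    Elliptic.isChevalleyBasis_basisKPlus, Elliptic.isChevalleyBasis_basisHerm⟩
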